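/- **Setting.** Let $G=SU(3)\times SU(2)\times U(1)$ act linearly on the 49 complex scalar fields $\phi$ of the MSSM, which are grouped in 17 multiplets ($i=1,2,3$): $$Q_i:(\mathbf 3,\mathbf 2)_{1/6},\quad u_i:(\bar{\mathbf 3},\mathbf 1)_{-2/3},\quad d_i:(\bar{\mathbf 3},\mathbf 1)_{1/3},\quad L_i:(\mathbf 1,\mathbf 2)_{-1/2},\quad e_i:(\mathbf 1,\mathbf 1)_{1},\quad H_u:(\mathbf 1,\mathbf 2)_{1/2},\quad H_d:(\mathbf 1,\mathbf 2)_{-1/2}.$$ (The $U(1)$ factor is parametrised by $w$ with $x=w^6$, so that charge $Y$ means multiplication by $w^{6Y}$.) The ring $\mathbb C[\phi]$ is graded by $\mathbb N^{17}$, each component having the degree of its multiplet. Let $(r_j)_{j\in J}$ be a (finite or infinite) family of $\mathbb N^{17}$-homogeneous polynomials, $r_j$ of multidegree $\delta_j$, which generates the algebra $\mathbb C[\phi]^G$ of gauge invariant polynomials. The vacuum moduli space for a superpotential $W$ is given by the ideal $\mathcal M=\langle \partial W/\partial\phi,\ y_j-r_j(\phi)\rangle\cap\mathbb C[y]$ of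 $\mathbb C[y]=\mathbb C[y_j:j\in J]$; here $W=0$. Its coordinate ring $\mathcal R=\mathbb C[y]/\mathcal M$ is graded by $\deg y_j=\delta_j$; $\mathcal R_n$ is the piece of multidegree $n\in\mathbb N^{17}$. **Proposition.** Let $t=(Q_i,L_i,u_i,d_i,e_i,H_u,H_d)\in\mathbb C^{17}$ be fugacities, each of modulus less than $1$. Every $\mathcal R_n$ is finite-dimensional, and the Hilbert series $\sum_{n\in\mathbb N^{17}}\dim(\mathcal R_n)\,t^n$ of the vacuum moduli space of the MSSM with $W=0$ converges absolutely to $$\mathrm{PI}=\frac1{(2\pi i)^4}\oint_{|x|=1}\oint_{|y|=1}\oint_{|z_1|=1}\oint_{|z_2|=1} F(x,y,z_1,z_2)\,dz_2\,dz_1\,dy\,dx,$$ where, with principal values of the fractional powers of $x$, $$F=-\,\frac{x^9y^{13}(y^2-1)\,z_1^{10}(z_1^2-z_2)\,z_2^{10}(z_1z_2-1)(z_1-z_2^2)}{D},$$ $$\begin{aligned} D={}&(y-H_u\sqrt x)(H_dy-\sqrt x)(\sqrt x\,y-H_d)(H_u\sqrt x\,y-1)\\ &\times\prod_{i=1}^3\Big[(xe_i-1)(\sqrt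 x\,y-L_i)(yL_i-\sqrt x)(x^{1/3}d_i-z_1)(x^{1/3}d_iz_1-z_2)(x^{1/3}d_iz_2-1)\\ &\qquad\times(x^{2/3}z_1-u_i)(x^{2/3}z_2-u_iz_1)(x^{2/3}-u_iz_2)(y-x^{1/6}Q_iz_1)(x^{1/6}yQ_iz_1-1)\\ &\qquad\times(x^{1/6}yQ_i-z_2)(yz_2-x^{1/6}Q_i)(yz_1-x^{1/6}Q_iz_2)(x^{1/6}yQ_iz_2-z_1)\Big]. \end{aligned}$$ The function $D$ has no zero with $|x|=|y|=|z_1|=|z_2|=1$, and $F$ is integrable over the product of these four circles. On it, $F$ is the Haar density of $G$ written with positive roots, times the plethystic exponential of the characters of the fields: the series below converges, and $$F=\frac{(1-z_1z_2)\big(1-\tfrac{z_1^2}{z_2}\big)\big(1-\tfrac{z_2^2}{z_1}\big)(1-y^2)}{x\,y\,z_1z_2}\;\exp\Big(\sum_{k\ge1}\frac1k\,\chi(t^k,\xi^k,y^k,z_1^k,z_2^k)\Big),\qquad \xi=x^{1/6},$$ where $t^k$ denotes the family of $k$-th powers of the fugacities and $$\begin{aligned}\chi(t,\xi,y,z_1,z_2)={}&\sum_{i=1}^3\Big[Q_i\,\xi\big(y+\tfrac1y\big)\big(z_1+\tfrac1{z_2}+\tfrac{z_2}{z_1}\big)+\big(u_i\xi^{-4}+d_i\xi^{2}\big)\big(\tfrac{z_1}{z_2}+z_2+\tfrac1{z_1}\big)+L_i\xi^{-3}\big(y+\tfrac1y\big)+e_i\xi^6\Big]\\&+\big(H_u\xi^3+H_d\xi^{-3}\big)\big(y+\tfrac1y\big).\end{aligned}$$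 -/

import Mathlib

noncomputable section

/-! ### The matter content -/

/-- The 17 chiral multiplets of the MSSM (three generations of `Q, u, d, L, e` and the two Higgs
multiplets). There is one fugacity for each of them. -/
inductive MSSMField : Type
  | Q (i : Fin 3)
  | u (i : Fin 3)
  | d (i : Fin 3)
  | L (i : Fin 3)
  | e (i : Fin 3)
  | Hu
  | Hd

/-- The 49 scalar components of the chiral multiplets. The index `i` is the generation, `a` the
colour index (of `3` for `Q`, of `3̄` for `u` and `d`), `α` the weak isospin index. -/
inductive MSSMComponent : Type
  | Q (i : Fin 3) (a : Fin 3) (α : Fin 2)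
  | u (i : Fin 3) (a : Fin 3)
  | d (i : Fin 3) (a : Fin 3)
  | L (i : Fin 3) (α : Fin 2)
  | e (i : Fin 3)
  | Hu (α : Fin 2)
  | Hd (α : Fin 2)

/-- The multiplet to which a scalar component belongs. -/
def MSSMComponent.field : MSSMComponent → MSSMField
  | .Q i _ _ => .Q i
  | .u i _ => .u i
  | .d i _ => .d i
  | .L i _ => .L i
  | .e i => .e i
  | .Hu _ => .Hu
  | .Hd _ => .Hd

/-- The multidegree of a scalar component: the basis vector of its multiplet. -/
def MSSMComponent.degree (c : MSSMComponent) : MSSMField →₀ ℕ :=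
  Finsupp.single c.field 1

/-! ### The gauge group and the gauge invariant operators -/

/-- The gauge group `SU(3) × SU(2) × U(1)`. The `U(1)` factor is parametrised by `w` with
`x = w ^ 6`, so that a multiplet of hypercharge `Y ∈ (1/6)ℤ` has the character
`x ^ Y = w ^ (6 Y)`. -/
abbrev MSSMGaugeGroup : Type :=
  Matrix.specialUnitaryGroup (Fin 3) ℂ × Matrix.specialUnitaryGroup (Fin 2) ℂ × Circle

/-- The gauge transformation of the scalar components: `Q : (3, 2)_{1/6}`, `u : (3̄, 1)_{-2/3}`,
`d : (3̄, 1)_{1/3}`, `L : (1, 2)_{-1/2}`, `e : (1, 1)_1`, `Hu : (1, 2)_{1/2}`,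
`Hd : (1, 2)_{-1/2}`. -/
def MSSMGaugeGroup.transform (g : MSSMGaugeGroup) :
    MSSMComponent → MvPolynomial MSSMComponent ℂ
  | .Q i a α => ∑ b, ∑ β, MvPolynomial.C
      ((g.2.2 : ℂ) * g.1.1 a b * g.2.1.1 α β) * MvPolynomial.X (.Q i b β)
  | .u i a => ∑ b, MvPolynomial.C
      ((g.2.2 : ℂ) ^ (-4 : ℤ) * star (g.1.1 a b)) * MvPolynomial.X (.u i b)
  | .d i a => ∑ b, MvPolynomial.C
      ((g.2.2 : ℂ) ^ (2 : ℤ) * star (g.1.1 a b)) * MvPolynomial.X (.d i b)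
  | .L i α => ∑ β, MvPolynomial.C
      ((g.2.2 : ℂ) ^ (-3 : ℤ) * g.2.1.1 α β) * MvPolynomial.X (.L i β)
  | .e i => MvPolynomial.C ((g.2.2 : ℂ) ^ (6 : ℤ)) * MvPolynomial.X (.e i)
  | .Hu α => ∑ β, MvPolynomial.C
      ((g.2.2 : ℂ) ^ (3 : ℤ) * g.2.1.1 α β) * MvPolynomial.X (.Hu β)
  | .Hd α => ∑ β, MvPolynomial.C
      ((g.2.2 : ℂ) ^ (-3 : ℤ) * g.2.1.1 α β) * MvPolynomial.X (.Hd β)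

/-- The substitution `p(φ) ↦ p(g φ)` on polynomials in the scalar components. -/
def MSSMGaugeGroup.substitute (g : MSSMGaugeGroup) :
    MvPolynomial MSSMComponent ℂ →ₐ[ℂ] MvPolynomial MSSMComponent ℂ :=
  MvPolynomial.aeval g.transform

/-- The algebra of gauge invariant polynomials in the scalar components. -/
def MSSMInvariants : Subalgebra ℂ (MvPolynomial MSSMComponent ℂ) :=
  ⨅ g : MSSMGaugeGroup, AlgHom.equalizer g.substitute (AlgHom.id ℂ _)

/-- `r` is a system of generators of the gauge invariant operators of the MSSM, where `r j` is
multihomogeneous of multidegree `δ j`. -/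
structure IsMSSMGeneratingSystem {J : Type*} (r : J → MvPolynomial MSSMComponent ℂ)
    (δ : J → MSSMField →₀ ℕ) : Prop where
  homogeneous : ∀ j, MvPolynomial.IsWeightedHomogeneous MSSMComponent.degree (r j) (δ j)
  adjoin_eq : Algebra.adjoin ℂ (Set.range r) = MSSMInvariants

/-! ### The vacuum moduli space and its Hilbert series -/

/-- The ideal `⟨∂W/∂φ, y_j - r_j(φ)⟩` of `ℂ[φ, y]`. -/
def vacuumIdeal {Φ J : Type*} (W : MvPolynomial Φ ℂ) (r : J → MvPolynomial Φ ℂ) :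
    Ideal (MvPolynomial (Φ ⊕ J) ℂ) :=
  Ideal.span
    (Set.range (fun i : Φ => MvPolynomial.rename Sum.inl (MvPolynomial.pderiv i W)) ∪
      Set.range (fun j : J =>
        MvPolynomial.X (Sum.inr j) - MvPolynomial.rename Sum.inl (r j)))

/-- The ideal of the vacuum moduli space in `ℂ[y]`, obtained from `vacuumIdeal W r` by eliminating
all the variables `φ`. -/
def moduliIdeal {Φ J : Type*} (W : MvPolynomial Φ ℂ) (r : J → MvPolynomial Φ ℂ) :
    Ideal (MvPolynomial J ℂ) :=
  (vacuumIdeal W r).comap (MvPolynomial.rename (R := ℂ) (Sum.inr : J → Φ ⊕ J))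

/-- The coordinate ring `ℂ[y] / M` of the vacuum moduli space. -/
abbrev ModuliRing {Φ J : Type*} (W : MvPolynomial Φ ℂ) (r : J → MvPolynomial Φ ℂ) : Type _ :=
  MvPolynomial J ℂ ⧸ moduliIdeal W r

/-- The piece of multidegree `n` of the coordinate ring of the vacuum moduli space, where the
coordinate `y_j` has multidegree `δ j`. -/
def moduliPiece {Φ J ι : Type*} (W : MvPolynomial Φ ℂ) (r : J → MvPolynomial Φ ℂ)
    (δ : J → ι →₀ ℕ) (n : ι →₀ ℕ) : Submodule ℂ (ModuliRing W r) :=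
  (MvPolynomial.weightedHomogeneousSubmodule ℂ δ n).map
    (Ideal.Quotient.mkₐ ℂ (moduliIdeal W r)).toLinearMap

/-! ### The plethystic integrand -/

/-- The sum over the multiplets of fugacity times character, where `ξ` stands for `x ^ (1/6)`. -/
def mssmCharacterSum (t : MSSMField → ℂ) (ξ y z₁ z₂ : ℂ) : ℂ :=
  (∑ i : Fin 3,
    (t (.Q i) * (ξ * (y + 1 / y) * (z₁ + 1 / z₂ + z₂ / z₁))
      + t (.u i) * (1 / ξ ^ 4 * (z₁ / z₂ + z₂ + 1 / z₁))
      + t (.d i) * (ξ ^ 2 * (z₁ / z₂ + z₂ + 1 / z₁))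
      + t (.L i) * (1 / ξ ^ 3 * (y + 1 / y))
      + t (.e i) * ξ ^ 6))
    + t .Hu * (ξ ^ 3 * (y + 1 / y))
    + t .Hd * (1 / ξ ^ 3 * (y + 1 / y))

/-- The term of index `k ≥ 1` of the exponent of the plethystic exponential: `1 / k` times
`mssmCharacterSum` with every variable replaced by its `k`-th power. -/
def mssmPlethysticTerm (t : MSSMField → ℂ) (ξ y z₁ z₂ : ℂ) (k : ℕ) : ℂ :=
  mssmCharacterSum (fun f => t f ^ k) (ξ ^ k) (y ^ k) (z₁ ^ k) (z₂ ^ k) / k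

/-- The density of the Haar measure of `SU(3) × SU(2) × U(1)` on the maximal torus, written with
the positive roots only and including the factors `1/x`, `1/y`, `1/z₁`, `1/z₂`. -/
def mssmHaarDensity (x y z₁ z₂ : ℂ) : ℂ :=
  (1 - z₁ * z₂) * (1 - z₁ ^ 2 / z₂) * (1 - z₂ ^ 2 / z₁) * (1 - y ^ 2) / (x * y * z₁ * z₂)

/-- The denominator, with 49 factors, of the integrand. The fractional powers of `x` are principal
values. -/
def mssmDenominator (t : MSSMField → ℂ) (x y z₁ z₂ : ℂ) : ℂ :=
  (y - t .Hu * x ^ (1 / 2 : ℂ)) * (t .Hd * y - x ^ (1 / 2 : ℂ)) *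
  (x ^ (1 / 2 : ℂ) * y - t .Hd) * (t .Hu * x ^ (1 / 2 : ℂ) * y - 1) *
  ∏ i : Fin 3,
    ((x * t (.e i) - 1) *
    ((x ^ (1 / 2 : ℂ) * y - t (.L i)) * (y * t (.L i) - x ^ (1 / 2 : ℂ))) *
    ((x ^ (1 / 3 : ℂ) * t (.d i) - z₁) * (x ^ (1 / 3 : ℂ) * t (.d i) * z₁ - z₂) *
      (x ^ (1 / 3 : ℂ) * t (.d i) * z₂ - 1)) *
    ((x ^ (2 / 3 : ℂ) * z₁ - t (.u i)) * (x ^ (2 / 3 : ℂ) * z₂ - t (.u i) * z₁) *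
      (x ^ (2 / 3 : ℂ) - t (.u i) * z₂)) *
    ((y - x ^ (1 / 6 : ℂ) * t (.Q i) * z₁) * (x ^ (1 / 6 : ℂ) * y * t (.Q i) * z₁ - 1) *
      (x ^ (1 / 6 : ℂ) * y * t (.Q i) - z₂) * (y * z₂ - x ^ (1 / 6 : ℂ) * t (.Q i)) *
      (y * z₁ - x ^ (1 / 6 : ℂ) * t (.Q i) * z₂) *
      (x ^ (1 / 6 : ℂ) * y * t (.Q i) * z₂ - z₁)))

/-- The integrand of the plethystic integral. -/
def mssmIntegrand (t : MSSMField → ℂ) (x y z₁ z₂ : ℂ) : ℂ :=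
  -(x ^ 9 * y ^ 13 * (y ^ 2 - 1) * z₁ ^ 10 * (z₁ ^ 2 - z₂) * z₂ ^ 10 * (z₁ * z₂ - 1) *
      (z₁ - z₂ ^ 2)) / mssmDenominator t x y z₁ z₂

/-- The plethystic integral: the fourfold contour integral over `|x| = |y| = |z₁| = |z₂| = 1`. -/
def mssmPlethysticIntegral (t : MSSMField → ℂ) : ℂ :=
  1 / (2 * (Real.pi : ℂ) * Complex.I) ^ 4 *
    ∮ x in C(0, 1), ∮ y in C(0, 1), ∮ z₁ in C(0, 1), ∮ z₂ in C(0, 1),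
      mssmIntegrand t x y z₁ z₂

end

/-!
The proof that the Hilbert series of the moduli space is the plethystic integral has an algebraic
and an analytic half, which meet in a counting formula for gauge invariants.

Without superpotential, eliminating the scalar fields leaves the ideal of relations among the
generators (`moduliIdeal_zero`), so the coordinate ring of the moduli space is the ring of gauge
invariant polynomials, and its piece of multidegree `n` is the space of invariants in the
finite-dimensional space of polynomials of multidegree `n` (`map_moduliPiece`).

The dimension of that space is computed without integration over the group. A polynomial is gauge
invariant if and only if it has weight zero for the maximal torus and is annihilated by the vector
fields of the root vectors of `sl 3` and `sl 2` (`mem_lieInvariants_iff`). In one direction,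
`SL(3)` and `SL(2)` are generated by diagonal matrices and transvections, and a transvection is the
flow of a root vector. In the other direction, differentiating along rotations shows that
`E_ij - E_ji` annihilates an invariant, and the two terms have different weights.

The multiplicity of the trivial representation is the alternating sum over the Weyl group of the
multiplicities of the weights `w ρ - ρ` (`finrank_lieInvariants`). This case of Weyl's character
formula is proved with the Casimir operator `C`. Taking traces along root strings, as in
Freudenthal's recursion, shows that the alternating sum of the traces of `C P` over these weight
spaces vanishes for each operator `P` commuting with the Lie algebra (`trace_casimir_three`,
`trace_casimir_two`). The operator `C` is a sum of operators `A† A` for the Fischer inner product,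
so its kernel consists of the invariants and it is invertible on a complement of the kernel. With
`P` the inverse there, only the trace on the invariants remains, and invariants have weight zero.

On the analytic side, the denominator of the integrand is, up to a monomial, the product over the 49
components of `1 - fugacity * weight` (`mssmDenominator_eq`), and the Haar density expands into the
same twelve signed weights (`weylSum_weightChar_neg`). Expanding the geometric series gives an
absolutely convergent series of characters of the torus, uniformly on the contour
(`hasSum_mssmIntegrand`). Integrating term by term keeps the terms of weight zero
(`hasSum_mssmPlethysticIntegral`). The sixth root of `x` causes no trouble because the weights
satisfy congruences which force its exponent to be a multiple of six when the other exponents vanish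
(`dvd_seriesWeight`). The surviving terms of multidegree `n` form the alternating sum of weight
multiplicities.
-/

/-! ### Casimir operators and alternating sums of traces -/

section Casimir

/-- `D` satisfies the commutation relations of the matrix units of `gl n`. -/
def IsGLFamily {A ι : Type*} [Ring A] [DecidableEq ι] (D : ι → ι → A) : Prop :=
  ∀ i j k l, D i j * D k l - D k l * D i j =
    (if j = k then D i l else 0) - (if l = i then D k j else 0)

/-- The quadratic Casimir element `∑ D i j * D j i`. -/
def casimir {A ι : Type*} [Ring A] [Fintype ι] (D : ι → ι → A) : A :=
  ∑ i, ∑ j, D i j * D j i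

theorem IsGLFamily.commute_casimir {A ι : Type*} [Ring A] [Fintype ι] [DecidableEq ι]
    {D : ι → ι → A} (hD : IsGLFamily D) (k l : ι) : Commute (D k l) (casimir D) := by
  have key : casimir D * D k l - D k l * casimir D = 0 := by
    have h1 : casimir D * D k l - D k l * casimir D =
        ∑ i, ∑ j, (D i j * (D j i * D k l - D k l * D j i) +
          (D i j * D k l - D k l * D i j) * D j i) := by
      simp only [casimir, Finset.sum_mul, Finset.mul_sum, ← Finset.sum_sub_distrib]
      refine Finset.sum_congr rfl fun i _ => Finset.sum_congr rfl fun j _ => ?_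
      noncomm_ring
    rw [h1]
    simp only [hD _ _ k l, mul_sub, sub_mul, mul_ite, ite_mul, mul_zero, zero_mul,
      Finset.sum_add_distrib, Finset.sum_sub_distrib]
    rw [Finset.sum_comm (f := fun i j => if i = k then D i j * D j l else 0),
      Finset.sum_comm (f := fun i j => if l = i then D k j * D j i else 0)]
    simp
  exact (sub_eq_zero.mp key).symm

variable {V : Type*} [AddCommGroup V] [Module ℂ V]

/-- Recursion for the partial traces `tr (E f e X)` along the string of a root `e`, where `E` and
`E'` are the projections onto a weight space and onto the next one. -/
theorem trace_string_step {E E' e f h X : Module.End ℂ V} {c : ℂ} (hE : E' * e = e * E)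
    (hef : e * f - f * e = h) (hh : E' * h = c • E') (hX : Commute e X) :
    LinearMap.trace ℂ V (E * (f * e) * X) =
      LinearMap.trace ℂ V (E' * (f * e) * X) + c * LinearMap.trace ℂ V (E' * X) := by
  have h1 : E * (f * e) * X = (E * f * X) * e := by
    simp only [mul_assoc, hX.eq]
  have h2 : e * (E * f * X) = E' * (f * e) * X + c • (E' * X) := by
    have : e * (E * f * X) = E' * (e * f) * X := by
      rw [← mul_assoc, ← mul_assoc, ← hE]; simp only [mul_assoc]
    rw [this, ← smul_mul_assoc, ← hh, ← hef]
    noncomm_ring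
  rw [h1, LinearMap.trace_mul_comm, h2, map_add, map_smul, smul_eq_mul]

/-- For `sl 2`, the Casimir operator times any operator commuting with `sl 2` has the same trace on
the weight spaces of weight `0` and of weight a root. -/
theorem trace_casimir_two {D : Fin 2 → Fin 2 → Module.End ℂ V} (hD : IsGLFamily D)
    {E : ℕ → Module.End ℂ V} (hshift : ∀ a, E (a + 1) * D 1 0 = D 1 0 * E a)
    (h0 : ∀ a, E a * D 0 0 = (-a : ℂ) • E a) (h1 : ∀ a, E a * D 1 1 = (a : ℂ) • E a)
    {X : Module.End ℂ V} (hX : ∀ i j, Commute (D i j) X) :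
    LinearMap.trace ℂ V (E 0 * casimir D * X) - LinearMap.trace ℂ V (E 1 * casimir D * X) = 0 := by
  have hef : D 1 0 * D 0 1 - D 0 1 * D 1 0 = D 1 1 - D 0 0 := by simpa using hD 1 0 0 1
  have hC : ∀ a, LinearMap.trace ℂ V (E a * casimir D * X) =
      (2 * a ^ 2 + 2 * a) * LinearMap.trace ℂ V (E a * X) +
        2 * LinearMap.trace ℂ V (E a * (D 0 1 * D 1 0) * X) := by
    intro a
    have e1 : casimir D = D 0 0 * D 0 0 + D 1 1 * D 1 1 + (D 1 1 - D 0 0) +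
        (2 : ℂ) • (D 0 1 * D 1 0) := by
      simp only [casimir, Fin.sum_univ_two]
      rw [← hef, two_smul]; abel
    have e2 : E a * casimir D * X = (2 * a ^ 2 + 2 * a : ℂ) • (E a * X) +
        (2 : ℂ) • (E a * (D 0 1 * D 1 0) * X) := by
      rw [e1]
      simp only [mul_add, mul_sub, ← mul_assoc, h0, h1, smul_mul_assoc, mul_smul_comm, add_mul,
        sub_mul]
      module
    rw [e2, map_add, map_smul, map_smul, smul_eq_mul, smul_eq_mul]
  have s := trace_string_step (c := 2) (hshift 0) hef
    (by rw [mul_sub, h0, h1]; module) (hX 1 0)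
  rw [hC, hC]
  push_cast
  linear_combination 2 * s

/-- For `sl 3`, with `E a b` the projection onto the weight space of weight `a β₁ + b β₂` for
simple roots `β₁`, `β₂`: the alternating sum over the Weyl group of the traces of the Casimir
operator times an operator commuting with `sl 3`, over the weights `ρ - w ρ`, vanishes. This is
Freudenthal's recursion multiplied by the Weyl denominator. -/
theorem trace_casimir_three {D : Fin 3 → Fin 3 → Module.End ℂ V} (hD : IsGLFamily D)
    {E : ℕ → ℕ → Module.End ℂ V}
    (hs1 : ∀ a b, E (a + 1) b * D 1 0 = D 1 0 * E a b)
    (hs2 : ∀ a b, E a (b + 1) * D 2 1 = D 2 1 * E a b)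
    (hs3 : ∀ a b, E (a + 1) (b + 1) * D 2 0 = D 2 0 * E a b)
    (h0 : ∀ a b, E a b * D 0 0 = (-a : ℂ) • E a b)
    (h1 : ∀ a b, E a b * D 1 1 = (a - b : ℂ) • E a b)
    (h2 : ∀ a b, E a b * D 2 2 = (b : ℂ) • E a b)
    {X : Module.End ℂ V} (hX : ∀ i j, Commute (D i j) X) :
    LinearMap.trace ℂ V (E 0 0 * casimir D * X) - LinearMap.trace ℂ V (E 1 0 * casimir D * X)
      - LinearMap.trace ℂ V (E 0 1 * casimir D * X) + LinearMap.trace ℂ V (E 2 1 * casimir D * X)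
      + LinearMap.trace ℂ V (E 1 2 * casimir D * X)
      - LinearMap.trace ℂ V (E 2 2 * casimir D * X) = 0 := by
  have r1 : D 1 0 * D 0 1 - D 0 1 * D 1 0 = D 1 1 - D 0 0 := by simpa using hD 1 0 0 1
  have r2 : D 2 1 * D 1 2 - D 1 2 * D 2 1 = D 2 2 - D 1 1 := by simpa using hD 2 1 1 2
  have r3 : D 2 0 * D 0 2 - D 0 2 * D 2 0 = D 2 2 - D 0 0 := by simpa using hD 2 0 0 2
  have hC : ∀ a b, LinearMap.trace ℂ V (E a b * casimir D * X) =
      (a ^ 2 + (a - b) ^ 2 + b ^ 2 + 2 * a + 2 * b) * LinearMap.trace ℂ V (E a b * X) +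
        2 * (LinearMap.trace ℂ V (E a b * (D 0 1 * D 1 0) * X) +
          LinearMap.trace ℂ V (E a b * (D 1 2 * D 2 1) * X) +
          LinearMap.trace ℂ V (E a b * (D 0 2 * D 2 0) * X)) := by
    intro a b
    have e1 : casimir D = D 0 0 * D 0 0 + D 1 1 * D 1 1 + D 2 2 * D 2 2 + (D 1 1 - D 0 0) +
        (D 2 2 - D 1 1) + (D 2 2 - D 0 0) +
        (2 : ℂ) • (D 0 1 * D 1 0 + D 1 2 * D 2 1 + D 0 2 * D 2 0) := by
      simp only [casimir, Fin.sum_univ_three]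
      rw [← r1, ← r2, ← r3, two_smul]; abel
    have e2 : E a b * casimir D * X =
        (a ^ 2 + (a - b) ^ 2 + b ^ 2 + 2 * a + 2 * b : ℂ) • (E a b * X) +
        (2 : ℂ) • (E a b * (D 0 1 * D 1 0) * X + E a b * (D 1 2 * D 2 1) * X +
          E a b * (D 0 2 * D 2 0) * X) := by
      rw [e1]
      simp only [mul_add, mul_sub, ← mul_assoc, h0, h1, h2, smul_mul_assoc, mul_smul_comm,
        add_mul, sub_mul]
      module
    rw [e2]
    simp only [map_add, map_smul, smul_eq_mul]
  have s1 := fun a b : ℕ => trace_string_step (c := 2 * (a + 1 : ℂ) - b) (hs1 a b) r1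
    (by rw [mul_sub, h0, h1]; push_cast; module) (hX 1 0)
  have s2 := fun a b : ℕ => trace_string_step (c := 2 * (b + 1 : ℂ) - a) (hs2 a b) r2
    (by rw [mul_sub, h2, h1]; push_cast; module) (hX 2 1)
  have s3 := fun a b : ℕ => trace_string_step (c := (a + b + 2 : ℂ)) (hs3 a b) r3
    (by rw [mul_sub, h2, h0]; push_cast; module) (hX 2 0)
  have p1 := s1 0 0
  have p2 := s1 0 1
  have p3 := s1 1 1
  have p4 := s1 1 2
  have q1 := s2 0 0
  have q2 := s2 1 0
  have q3 := s2 1 1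
  have q4 := s2 2 1
  have t1 := s3 0 0
  have t2 := s3 1 0
  have t3 := s3 0 1
  have t4 := s3 1 1
  simp only [hC]
  norm_num at p1 p2 p3 p4 q1 q2 q3 q4 t1 t2 t3 t4 ⊢
  linear_combination 2 * (p1 - p2 - p3 + p4 + q1 - q2 - q3 + q4 + t1 - t2 - t3 + t4)

/-- An operator whose kernel meets its range trivially is inverted, up to a projection onto its
kernel, by a polynomial in it. -/
theorem exists_inverse_off_kernel [Module.Finite ℂ V] (C : Module.End ℂ V)
    (hC : ∀ v, C (C v) = 0 → C v = 0) :
    ∃ P ∈ Algebra.adjoin ℂ {C}, C * (1 - P * C) = 0 := by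
  obtain ⟨q, hq, hndvd⟩ := Polynomial.exists_eq_pow_rootMultiplicity_mul_and_not_dvd
    (minpoly ℂ C) (minpoly.ne_zero (Algebra.IsIntegral.isIntegral C)) 0
  rw [map_zero, sub_zero] at hq hndvd
  set k := (minpoly ℂ C).rootMultiplicity 0
  have hker : ∀ k v, (C ^ (k + 1)) v = 0 → C v = 0 := by
    intro k
    induction k with
    | zero => intro v h; simpa using h
    | succ k ih =>
      intro v h
      rw [pow_succ] at h
      exact hC v (ih (C v) h)
  have hCq : C * Polynomial.aeval C q = 0 := by
    have h0 : C ^ k * Polynomial.aeval C q = 0 := by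
      have := minpoly.aeval ℂ C
      rw [hq] at this
      simpa using this
    ext v
    refine hker k _ ?_
    rw [pow_succ', Module.End.mul_apply, ← Module.End.mul_apply (C ^ k), h0]
    simp
  have hq0 : q.coeff 0 ≠ 0 := fun h => hndvd (Polynomial.X_dvd_iff.mpr h)
  refine ⟨-(q.coeff 0)⁻¹ • Polynomial.aeval C q.divX, ?_, ?_⟩
  · exact Subalgebra.smul_mem _ (Polynomial.aeval_mem_adjoin_singleton ℂ C) _
  · have : Polynomial.aeval C q = Polynomial.aeval C q.divX * C + q.coeff 0 • 1 := by
      conv_lhs => rw [← Polynomial.divX_mul_X_add q]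
      simp [Algebra.algebraMap_eq_smul_one]
    have h2 : 1 - (-(q.coeff 0)⁻¹ • Polynomial.aeval C q.divX) * C =
        (q.coeff 0)⁻¹ • Polynomial.aeval C q := by
      rw [this, smul_add, smul_smul, inv_mul_cancel₀ hq0, smul_mul_assoc, one_smul, neg_smul]
      abel
    rw [h2, mul_smul_comm, hCq, smul_zero]

end Casimir

/-! ### Linear vector fields and linear substitutions on polynomials -/

section LinearAction

open MvPolynomial

variable {ι : Type*} [Fintype ι]

/-- The linear form `∑ M c c' X c'`, the `c`-th component of the linear map with matrix `M`. -/
noncomputable def linearForm (M : Matrix ι ι ℂ) (c : ι) : MvPolynomial ι ℂ :=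
  ∑ c', C (M c c') * X c'

/-- The linear vector field `∑ M c c' X c' ∂/∂X c`. -/
noncomputable def linDer (M : Matrix ι ι ℂ) : Derivation ℂ (MvPolynomial ι ℂ) (MvPolynomial ι ℂ) :=
  mkDerivation ℂ (linearForm M)

/-- The linear substitution `X c ↦ ∑ M c c' X c'`. -/
noncomputable def linSubst (M : Matrix ι ι ℂ) : MvPolynomial ι ℂ →ₐ[ℂ] MvPolynomial ι ℂ :=
  aeval (linearForm M)

theorem linDer_X (M : Matrix ι ι ℂ) (c : ι) : linDer M (X c) = linearForm M c := by
  simp [linDer, mkDerivation_X]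

theorem linSubst_X (M : Matrix ι ι ℂ) (c : ι) : linSubst M (X c) = linearForm M c := by
  simp [linSubst]

theorem derivation_apply_eq_sum (D : Derivation ℂ (MvPolynomial ι ℂ) (MvPolynomial ι ℂ))
    (p : MvPolynomial ι ℂ) : D p = ∑ c, pderiv c p * D (X c) := by
  classical
  have hs : ∀ q, (∑ c, (D (X c)) • (pderiv c : Derivation ℂ (MvPolynomial ι ℂ) (MvPolynomial ι ℂ)))
      q = ∑ c, pderiv c q * D (X c) := by
    intro q
    rw [← Derivation.coeFnAddMonoidHom_apply (∑ c, _), map_sum, Finset.sum_apply]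
    simp [mul_comm]
  have : D = ∑ c, (D (X c)) • (pderiv c : Derivation ℂ (MvPolynomial ι ℂ) (MvPolynomial ι ℂ)) := by
    apply MvPolynomial.derivation_ext
    intro i
    rw [hs]
    simp [pderiv_X, Pi.single_apply]
  conv_lhs => rw [this]
  rw [hs]

theorem linDer_apply (M : Matrix ι ι ℂ) (p : MvPolynomial ι ℂ) :
    linDer M p = ∑ c, ∑ c', C (M c c') * (X c' * pderiv c p) := by
  rw [derivation_apply_eq_sum]
  simp only [linDer_X, linearForm, Finset.mul_sum]
  exact Finset.sum_congr rfl fun c _ => Finset.sum_congr rfl fun c' _ => by ring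

theorem linDer_sub (M N : Matrix ι ι ℂ) (p : MvPolynomial ι ℂ) :
    linDer (M - N) p = linDer M p - linDer N p := by
  simp [linDer_apply, sub_mul, Finset.sum_sub_distrib]

theorem linDer_zero (p : MvPolynomial ι ℂ) : linDer (0 : Matrix ι ι ℂ) p = 0 := by
  simp [linDer_apply]

theorem linDer_linearForm (M N : Matrix ι ι ℂ) (c : ι) :
    linDer M (linearForm N c) = linearForm (N * M) c := by
  simp only [linearForm, map_sum, Derivation.leibniz, derivation_C, smul_eq_mul, mul_zero, add_zero,
    linDer_X, Matrix.mul_apply, Finset.mul_sum, Finset.sum_mul, C_mul]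
  rw [Finset.sum_comm]
  exact Finset.sum_congr rfl fun c _ => Finset.sum_congr rfl fun c' _ => by ring

theorem linSubst_linearForm (M N : Matrix ι ι ℂ) (c : ι) :
    linSubst M (linearForm N c) = linearForm (N * M) c := by
  simp only [linearForm, map_sum, map_mul, linSubst_X, algHom_C, algebraMap_eq,
    Matrix.mul_apply, Finset.mul_sum, Finset.sum_mul]
  rw [Finset.sum_comm]
  exact Finset.sum_congr rfl fun c _ => Finset.sum_congr rfl fun c' _ => by ring

/-- Vector fields compose in the opposite order to matrices. -/
theorem linDer_commutator (M N : Matrix ι ι ℂ) (p : MvPolynomial ι ℂ) :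
    linDer M (linDer N p) - linDer N (linDer M p) = linDer (N * M - M * N) p := by
  have : ⁅linDer M, linDer N⁆ = linDer (N * M - M * N) := by
    apply MvPolynomial.derivation_ext
    intro i
    rw [Derivation.commutator_apply, linDer_X, linDer_X, linDer_X, linDer_linearForm,
      linDer_linearForm]
    simp [linearForm, sub_mul, Finset.sum_sub_distrib]
  rw [← this, Derivation.commutator_apply]

theorem linSubst_mul (M N : Matrix ι ι ℂ) (p : MvPolynomial ι ℂ) :
    linSubst (M * N) p = linSubst N (linSubst M p) := by
  have : linSubst (M * N) = (linSubst N).comp (linSubst M) := by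
    apply MvPolynomial.algHom_ext
    intro i
    rw [AlgHom.comp_apply, linSubst_X, linSubst_X, linSubst_linearForm]
  rw [this, AlgHom.comp_apply]

theorem isWeightedHomogeneous_linDer {Λ : Type*} [AddCommMonoid Λ] {w : ι → Λ} {α μ : Λ}
    {M : Matrix ι ι ℂ} (hM : ∀ c c', M c c' ≠ 0 → w c' = w c + α) {p : MvPolynomial ι ℂ}
    (hp : IsWeightedHomogeneous w p μ) : IsWeightedHomogeneous w (linDer M p) (μ + α) := by
  classical
  intro m hm
  rw [linDer_apply, coeff_sum] at hm
  obtain ⟨c, -, hc⟩ := Finset.exists_ne_zero_of_sum_ne_zero hm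
  rw [coeff_sum] at hc
  obtain ⟨c', -, hc'⟩ := Finset.exists_ne_zero_of_sum_ne_zero hc
  rw [coeff_C_mul, coeff_X_mul', coeff_pderiv] at hc'
  have h1 := hM c c' (left_ne_zero_of_mul hc')
  have h2 := right_ne_zero_of_mul hc'
  split_ifs at h2 with h3
  · have h4 := hp (left_ne_zero_of_mul h2)
    have h5 : m - Finsupp.single c' 1 + Finsupp.single c' 1 = m :=
      Finsupp.sub_add_single_one_cancel (Finsupp.mem_support_iff.mp h3)
    rw [← h5, map_add, Finsupp.weight_single, one_smul, h1, ← h4, map_add,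
      Finsupp.weight_single, one_smul, add_assoc]
  · exact absurd rfl h2

theorem coeff_linDer_diagonal [DecidableEq ι] (d : ι → ℂ) (p : MvPolynomial ι ℂ) (a : ι →₀ ℕ) :
    coeff a (linDer (Matrix.diagonal d) p) = (∑ c, a c * d c) * coeff a p := by
  have h : ∀ c, ∑ c', C (Matrix.diagonal d c c') * (X c' * pderiv c p) =
      C (d c) * (X c * pderiv c p) := by
    intro c
    rw [Finset.sum_eq_single c]
    · simp
    · intro b _ hb; simp [Matrix.diagonal_apply_ne' d hb]
    · simp
  rw [linDer_apply]
  simp only [h, coeff_sum, coeff_C_mul, coeff_X_mul', coeff_pderiv, Finset.sum_mul]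
  refine Finset.sum_congr rfl fun c _ => ?_
  split_ifs with h3
  · have h5 := Finsupp.sub_add_single_one_cancel (Finsupp.mem_support_iff.mp h3)
    rw [h5]
    have : (((a - Finsupp.single c 1 : ι →₀ ℕ) c : ℕ) : ℂ) + 1 = a c := by
      conv_rhs => rw [← h5]
      rw [Finsupp.add_apply, Finsupp.single_eq_same]
      push_cast; rfl
    rw [this]; ring
  · simp [Finsupp.notMem_support_iff.mp h3]

theorem coeff_linSubst_diagonal [DecidableEq ι] (d : ι → ℂ) (p : MvPolynomial ι ℂ) (a : ι →₀ ℕ) :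
    coeff a (linSubst (Matrix.diagonal d) p) = (∏ c, d c ^ a c) * coeff a p := by
  have h : ∀ c, linearForm (Matrix.diagonal d) c = C (d c) * X c := by
    intro c
    rw [linearForm, Finset.sum_eq_single c]
    · simp
    · intro b _ hb; simp [Matrix.diagonal_apply_ne' d hb]
    · simp
  have hmon : ∀ (b : ι →₀ ℕ) (x : ℂ), linSubst (Matrix.diagonal d) (monomial b x) =
      monomial b ((∏ c, d c ^ b c) * x) := by
    intro b x
    rw [linSubst, aeval_monomial, Finsupp.prod_fintype _ _ (by simp), algebraMap_eq]
    simp only [h, mul_pow, Finset.prod_mul_distrib, ← map_pow, ← map_prod]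
    rw [← mul_assoc, ← C_mul, monomial_eq, Finsupp.prod_fintype _ _ (by simp), mul_comm x]
  induction p using MvPolynomial.induction_on' with
  | monomial b x =>
    rw [hmon, coeff_monomial, coeff_monomial]
    split_ifs with h
    · rw [h]
    · simp
  | add p q hp hq => rw [map_add, coeff_add, coeff_add, hp, hq, mul_add]

/-- Chain rule for the coefficients of a polynomial along a curve of substitutions. -/
theorem hasDerivAt_coeff_aeval {g : ℂ → ι → MvPolynomial ι ℂ} {g' : ι → MvPolynomial ι ℂ} {s : ℂ}
    (hg : ∀ c m, HasDerivAt (fun s => coeff m (g s c)) (coeff m (g' c)) s)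
    (p : MvPolynomial ι ℂ) (m : ι →₀ ℕ) :
    HasDerivAt (fun s => coeff m (aeval (g s) p))
      (coeff m (∑ c, aeval (g s) (pderiv c p) * g' c)) s := by
  classical
  induction p using MvPolynomial.induction_on generalizing m with
  | C a => simpa using hasDerivAt_const s _
  | add p q hp hq =>
    simp only [map_add, coeff_add, add_mul, Finset.sum_add_distrib]
    exact (hp m).add (hq m)
  | mul_X p i hp =>
    have h : ∑ c, aeval (g s) (pderiv c (p * X i)) * g' c =
        (∑ c, aeval (g s) (pderiv c p) * g' c) * g s i + aeval (g s) p * g' i := by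
      have h1 : ∀ c, aeval (g s) (pderiv c (p * X i)) * g' c =
          aeval (g s) (pderiv c p) * g' c * g s i +
            if c = i then aeval (g s) p * g' i else 0 := by
        intro c
        rw [pderiv_mul, map_add, map_mul, map_mul, aeval_X]
        split_ifs with hc
        · rw [hc, pderiv_X_self, map_one]; ring
        · rw [pderiv_X_of_ne (Ne.symm hc), map_zero]; ring
      rw [Finset.sum_congr rfl fun c _ => h1 c, Finset.sum_add_distrib, Finset.sum_ite_eq',
        if_pos (Finset.mem_univ i), Finset.sum_mul]
    rw [h, coeff_add, coeff_mul, coeff_mul, ← Finset.sum_add_distrib]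
    simp only [map_mul, aeval_X, coeff_mul]
    exact HasDerivAt.fun_sum fun x _ => (hp x.1).mul (hg i x.2)

theorem coeff_linearForm (M : Matrix ι ι ℂ) (c : ι) (m : ι →₀ ℕ) :
    coeff m (linearForm M c) = ∑ c', M c c' * coeff m (X c' : MvPolynomial ι ℂ) := by
  simp [linearForm, coeff_sum, coeff_C_mul]

/-- A polynomial annihilated by a vector field with square-zero matrix `N` is invariant under the
flow `1 + s N` of the field. -/
theorem linSubst_one_add_smul [DecidableEq ι] {N : Matrix ι ι ℂ} (hN : N * N = 0)
    {p : MvPolynomial ι ℂ} (hp : linDer N p = 0) (s : ℂ) : linSubst (1 + s • N) p = p := by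
  have hd : ∀ s m, HasDerivAt (fun s : ℂ => coeff m (linSubst (1 + s • N) p)) 0 s := by
    intro s m
    have h := hasDerivAt_coeff_aeval (g := fun s => linearForm (1 + s • N)) (g' := linearForm N)
      (s := s) ?_ p m
    · have h2 : ∀ c, linearForm N c = aeval (linearForm (1 + s • N)) (linDer N (X c)) := by
        intro c
        rw [linDer_X]
        change _ = linSubst (1 + s • N) _
        rw [linSubst_linearForm, mul_add, Matrix.mul_smul, hN, smul_zero, add_zero, mul_one]
      have h3 : ∑ c, aeval (linearForm (1 + s • N)) (pderiv c p) * linearForm N c = 0 := by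
        calc _ = aeval (linearForm (1 + s • N)) (linDer N p) := by
              rw [derivation_apply_eq_sum, map_sum]
              exact Finset.sum_congr rfl fun c _ => by rw [map_mul, ← h2]
          _ = 0 := by rw [hp, map_zero]
      rwa [h3, coeff_zero] at h
    · intro c m
      simp only [coeff_linearForm]
      refine HasDerivAt.fun_sum fun c' _ => HasDerivAt.mul_const ?_ _
      simpa using ((hasDerivAt_id s).mul_const (N c c')).const_add ((1 : Matrix ι ι ℂ) c c')
  ext m
  have h1 := is_const_of_deriv_eq_zero (fun s => (hd s m).differentiableAt)
    (fun s => (hd s m).deriv) s 0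
  rw [h1]
  have : linSubst (1 : Matrix ι ι ℂ) p = p := by
    ext a
    rw [← Matrix.diagonal_one, coeff_linSubst_diagonal]
    simp
  simp [this]

/-- A polynomial invariant under a curve of linear substitutions through the identity is annihilated
by the tangent vector field. -/
theorem linDer_eq_zero_of_invariant [DecidableEq ι] {G : ℂ → Matrix ι ι ℂ}
    {N : Matrix ι ι ℂ} (h1 : G 0 = 1) (hG : ∀ c c', HasDerivAt (fun s => G s c c') (N c c') 0)
    {p : MvPolynomial ι ℂ} (hp : ∀ s : ℝ, linSubst (G s) p = p) : linDer N p = 0 := by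
  ext m
  have h := hasDerivAt_coeff_aeval (g := fun s => linearForm (G s)) (g' := linearForm N)
      (s := 0) ?_ p m
  · have h2 : ∑ c, aeval (linearForm (G 0)) (pderiv c p) * linearForm N c = linDer N p := by
      rw [derivation_apply_eq_sum]
      refine Finset.sum_congr rfl fun c _ => ?_
      have h3 : linearForm (1 : Matrix ι ι ℂ) = X := by
        funext c
        rw [linearForm, Finset.sum_eq_single c]
        · simp
        · intro b _ hb; simp [Matrix.one_apply_ne' hb]
        · simp
      rw [h1, h3, aeval_X_left_apply, linDer_X]
    rw [h2] at h
    have h4 := HasDerivAt.comp_ofReal (z := 0) h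
    have h5 : (fun y : ℝ => coeff m (aeval (linearForm (G (y : ℂ))) p)) = fun _ => coeff m p := by
      funext y
      exact congrArg (coeff m) (hp y)
    rw [h5] at h4
    rw [coeff_zero]
    exact h4.unique (hasDerivAt_const _ _)
  · intro c m
    simp only [coeff_linearForm]
    exact HasDerivAt.fun_sum fun c' _ => HasDerivAt.mul_const (hG c c') _

end LinearAction

/-! ### The Fischer inner product -/

section Fischer

open MvPolynomial

variable {ι : Type*}

/-- The Fischer inner product on polynomials, for which the monomials `X ^ a` are orthogonal with
`⟨X ^ a, X ^ a⟩ = a!`. It is conjugate-linear in the first variable. -/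
def fischer (p q : MvPolynomial ι ℂ) : ℂ :=
  ∑ a ∈ q.support, (a.prod fun _ k => (k.factorial : ℂ)) * (star (coeff a p) * coeff a q)

theorem fischer_eq_sum {p q : MvPolynomial ι ℂ} {s : Finset (ι →₀ ℕ)}
    (hs : p.support ⊆ s ∨ q.support ⊆ s) : fischer p q =
      ∑ a ∈ s, (a.prod fun _ k => (k.factorial : ℂ)) * (star (coeff a p) * coeff a q) := by
  classical
  have h1 : fischer p q = ∑ a ∈ q.support ∪ s,
      (a.prod fun _ k => (k.factorial : ℂ)) * (star (coeff a p) * coeff a q) := by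
    refine Finset.sum_subset Finset.subset_union_left fun a _ ha => ?_
    simp [notMem_support_iff.mp ha]
  rw [h1]
  symm
  refine Finset.sum_subset Finset.subset_union_right fun a _ ha => ?_
  rcases hs with hs | hs
  · simp [notMem_support_iff.mp fun h => ha (hs h)]
  · simp [notMem_support_iff.mp fun h => ha (hs h)]

theorem fischer_add_right (p q r : MvPolynomial ι ℂ) :
    fischer p (q + r) = fischer p q + fischer p r := by
  rw [fischer_eq_sum (Or.inl subset_rfl), fischer_eq_sum (Or.inl subset_rfl),
    fischer_eq_sum (Or.inl subset_rfl), ← Finset.sum_add_distrib]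
  exact Finset.sum_congr rfl fun a _ => by rw [coeff_add]; ring

theorem fischer_star (p q : MvPolynomial ι ℂ) : star (fischer p q) = fischer q p := by
  rw [fischer, fischer_eq_sum (Or.inl subset_rfl), star_sum]
  refine Finset.sum_congr rfl fun a _ => ?_
  simp only [Finsupp.prod, star_mul', star_prod, star_star, star_natCast]
  ring

theorem fischer_C_mul_right (p q : MvPolynomial ι ℂ) (x : ℂ) :
    fischer p (C x * q) = x * fischer p q := by
  rw [fischer_eq_sum (Or.inl subset_rfl), fischer_eq_sum (Or.inl subset_rfl), Finset.mul_sum]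
  exact Finset.sum_congr rfl fun a _ => by rw [coeff_C_mul]; ring

theorem fischer_sum_right {κ : Type*} (p : MvPolynomial ι ℂ) (s : Finset κ)
    (q : κ → MvPolynomial ι ℂ) : fischer p (∑ k ∈ s, q k) = ∑ k ∈ s, fischer p (q k) := by
  let f : MvPolynomial ι ℂ →+ ℂ := AddMonoidHom.mk' (fischer p) (fischer_add_right p)
  exact map_sum f q s

theorem fischer_C_mul_left (p q : MvPolynomial ι ℂ) (x : ℂ) :
    fischer (C x * p) q = star x * fischer p q := by
  rw [← fischer_star, fischer_C_mul_right, star_mul', fischer_star]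

theorem fischer_sum_left {κ : Type*} (p : MvPolynomial ι ℂ) (s : Finset κ)
    (q : κ → MvPolynomial ι ℂ) : fischer (∑ k ∈ s, q k) p = ∑ k ∈ s, fischer (q k) p := by
  rw [← fischer_star, fischer_sum_right, star_sum]
  simp only [fischer_star]

theorem fischer_self_re_nonneg (p : MvPolynomial ι ℂ) : 0 ≤ (fischer p p).re := by
  rw [fischer, Complex.re_sum]
  refine Finset.sum_nonneg fun a _ => ?_
  have : ((a.prod fun _ k => (k.factorial : ℂ)) * (star (coeff a p) * coeff a p)) =
      (((a.prod fun _ k => (k.factorial : ℝ)) * Complex.normSq (coeff a p) : ℝ) : ℂ) := by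
    simp [Finsupp.prod, Complex.normSq_eq_conj_mul_self]
  rw [this, Complex.ofReal_re]
  exact mul_nonneg (Finset.prod_nonneg fun _ _ => Nat.cast_nonneg _) (Complex.normSq_nonneg _)

theorem eq_zero_of_fischer_self {p : MvPolynomial ι ℂ} (hp : (fischer p p).re = 0) : p = 0 := by
  rw [fischer, Complex.re_sum] at hp
  have h : ∀ a, ((a.prod fun _ k => (k.factorial : ℂ)) * (star (coeff a p) * coeff a p)) =
      (((a.prod fun _ k => (k.factorial : ℝ)) * Complex.normSq (coeff a p) : ℝ) : ℂ) := by
    intro a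
    simp [Finsupp.prod, Complex.normSq_eq_conj_mul_self]
  have hpos : ∀ a : ι →₀ ℕ, 0 < a.prod fun _ k => (k.factorial : ℝ) := fun a =>
    Finset.prod_pos fun _ _ => Nat.cast_pos.mpr (Nat.factorial_pos _)
  simp only [h, Complex.ofReal_re] at hp
  rw [Finset.sum_eq_zero_iff_of_nonneg fun a _ =>
    mul_nonneg (hpos a).le (Complex.normSq_nonneg _)] at hp
  ext a
  by_contra hne
  have := hp a (mem_support_iff.mpr hne)
  rcases mul_eq_zero.mp this with h1 | h1
  · exact (hpos a).ne' h1
  · exact hne (Complex.normSq_eq_zero.mp h1)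

/-- Multiplication by a variable is adjoint to the derivative. -/
theorem fischer_X_mul (i : ι) (p q : MvPolynomial ι ℂ) :
    fischer (X i * p) q = fischer p (pderiv i q) := by
  classical
  have h1 : fischer (X i * p) q = ∑ a ∈ p.support.map (addLeftEmbedding (Finsupp.single i 1)),
      (a.prod fun _ k => (k.factorial : ℂ)) * (star (coeff a (X i * p)) * coeff a q) :=
    fischer_eq_sum (Or.inl (support_X_mul i p).subset)
  rw [h1, Finset.sum_map, fischer_eq_sum (Or.inl subset_rfl)]
  refine Finset.sum_congr rfl fun a _ => ?_
  rw [addLeftEmbedding_apply, coeff_pderiv, coeff_X_mul, add_comm a]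
  have h2 : ((Finsupp.single i 1 + a).prod fun _ k => (k.factorial : ℂ)) =
      (a i + 1) * a.prod fun _ k => (k.factorial : ℂ) := by
    rw [← Finsupp.mul_prod_erase' _ i _ (by simp), ← Finsupp.mul_prod_erase' a i _ (by simp),
      Finsupp.erase_add, Finsupp.erase_single, zero_add]
    simp only [Finsupp.add_apply, Finsupp.single_eq_same, add_comm 1 (a i), Nat.factorial_succ]
    push_cast
    ring
  rw [h2]
  ring

/-- The adjoint of a linear vector field is the one of the conjugate transpose matrix. -/
theorem fischer_linDer [Fintype ι] (M : Matrix ι ι ℂ) (p q : MvPolynomial ι ℂ) :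
    fischer (linDer M p) q = fischer p (linDer M.conjTranspose q) := by
  have h : ∀ i j (p q : MvPolynomial ι ℂ),
      fischer (X j * pderiv i p) q = fischer p (X i * pderiv j q) := by
    intro i j p q
    rw [fischer_X_mul, ← fischer_star, ← fischer_X_mul, fischer_star]
  rw [linDer_apply, linDer_apply]
  simp only [fischer_sum_left, fischer_sum_right, fischer_C_mul_left, fischer_C_mul_right, h,
    Matrix.conjTranspose_apply]
  exact Finset.sum_comm

end Fischer

/-! ### The matter representation of the Lie algebra of the gauge group -/

section Matter

open MvPolynomial
open scoped Kronecker

noncomputable instance : DecidableEq MSSMComponent := Classical.decEq _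

/-- The scalar components as a disjoint union of index types, one for each kind of multiplet. -/
def mssmComponentEquiv : (Fin 3 × Fin 3 × Fin 2) ⊕ (Fin 3 × Fin 3) ⊕ (Fin 3 × Fin 3) ⊕
    (Fin 3 × Fin 2) ⊕ Fin 3 ⊕ Fin 2 ⊕ Fin 2 ≃ MSSMComponent where
  toFun
    | .inl (i, a, α) => .Q i a α
    | .inr (.inl (i, a)) => .u i a
    | .inr (.inr (.inl (i, a))) => .d i a
    | .inr (.inr (.inr (.inl (i, α)))) => .L i α
    | .inr (.inr (.inr (.inr (.inl i)))) => .e i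
    | .inr (.inr (.inr (.inr (.inr (.inl α))))) => .Hu α
    | .inr (.inr (.inr (.inr (.inr (.inr α))))) => .Hd α
  invFun
    | .Q i a α => .inl (i, a, α)
    | .u i a => .inr (.inl (i, a))
    | .d i a => .inr (.inr (.inl (i, a)))
    | .L i α => .inr (.inr (.inr (.inl (i, α))))
    | .e i => .inr (.inr (.inr (.inr (.inl i))))
    | .Hu α => .inr (.inr (.inr (.inr (.inr (.inl α)))))
    | .Hd α => .inr (.inr (.inr (.inr (.inr (.inr α)))))
  left_inv := by rintro (_ | _ | _ | _ | _ | _ | _) <;> rfl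
  right_inv := by rintro (_ | _ | _ | _ | _ | _ | _) <;> rfl

instance : Fintype MSSMComponent := Fintype.ofEquiv _ mssmComponentEquiv

@[to_additive]
theorem prod_mssmComponent {R : Type*} [CommMonoid R] (f : MSSMComponent → R) :
    ∏ c, f c = (∏ i, ∏ a, ∏ α, f (.Q i a α)) * ((∏ i, ∏ a, f (.u i a)) *
      ((∏ i, ∏ a, f (.d i a)) * ((∏ i, ∏ α, f (.L i α)) * ((∏ i, f (.e i)) *
        ((∏ α, f (.Hu α)) * ∏ α, f (.Hd α)))))) := by
  rw [← mssmComponentEquiv.prod_comp]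
  simp only [Fintype.prod_sum_type, Fintype.prod_prod_type]
  rfl

/-- The algebra of block-diagonal matrices on the scalar components which do not mix the
multiplets and act in the same way on the three generations. The blocks belong to
`Q`, `u`, `d`, `L`, `Hu`, `Hd`, `e`. -/
abbrev MatterBlocks : Type :=
  Matrix (Fin 3 × Fin 2) (Fin 3 × Fin 2) ℂ × Matrix (Fin 3) (Fin 3) ℂ × Matrix (Fin 3) (Fin 3) ℂ ×
    Matrix (Fin 2) (Fin 2) ℂ × Matrix (Fin 2) (Fin 2) ℂ × Matrix (Fin 2) (Fin 2) ℂ × ℂ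

/-- The matrix on the scalar components with the given blocks. -/
def MatterBlocks.toMatrix (b : MatterBlocks) : Matrix MSSMComponent MSSMComponent ℂ
  | .Q i a α, .Q j a' α' => if i = j then b.1 (a, α) (a', α') else 0
  | .u i a, .u j a' => if i = j then b.2.1 a a' else 0
  | .d i a, .d j a' => if i = j then b.2.2.1 a a' else 0
  | .L i α, .L j α' => if i = j then b.2.2.2.1 α α' else 0
  | .Hu α, .Hu α' => b.2.2.2.2.1 α α'
  | .Hd α, .Hd α' => b.2.2.2.2.2.1 α α'
  | .e i, .e j => if i = j then b.2.2.2.2.2.2 else 0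
  | _, _ => 0

theorem MatterBlocks.toMatrix_mul (b b' : MatterBlocks) :
    (b * b').toMatrix = b.toMatrix * b'.toMatrix := by
  ext c c'
  rw [Matrix.mul_apply, sum_mssmComponent]
  cases c <;> cases c' <;>
    simp [MatterBlocks.toMatrix, Matrix.mul_apply, Fintype.sum_prod_type, ite_mul, mul_ite,
      Finset.sum_ite_irrel, Finset.sum_ite_eq']

theorem MatterBlocks.toMatrix_add (b b' : MatterBlocks) :
    (b + b').toMatrix = b.toMatrix + b'.toMatrix := by
  ext c c'
  cases c <;> cases c' <;> simp [MatterBlocks.toMatrix] <;> split_ifs <;> simp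

theorem MatterBlocks.toMatrix_smul (x : ℂ) (b : MatterBlocks) :
    (x • b).toMatrix = x • b.toMatrix := by
  ext c c'
  cases c <;> cases c' <;> simp [MatterBlocks.toMatrix]

theorem MatterBlocks.toMatrix_one : (1 : MatterBlocks).toMatrix = 1 := by
  ext c c'
  cases c <;> cases c' <;> simp [MatterBlocks.toMatrix, Matrix.one_apply, ← ite_and]

theorem MatterBlocks.toMatrix_sub (b b' : MatterBlocks) :
    (b - b').toMatrix = b.toMatrix - b'.toMatrix := by
  rw [sub_eq_add_neg, toMatrix_add, ← neg_one_smul ℂ b', toMatrix_smul, neg_one_smul,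
    sub_eq_add_neg]

/-- Matter blocks do not mix the multiplets. -/
theorem MatterBlocks.degree_eq (b : MatterBlocks) {c c' : MSSMComponent}
    (h : b.toMatrix c c' ≠ 0) : c'.degree = c.degree := by
  cases c <;> cases c' <;>
    simp_all [MatterBlocks.toMatrix, MSSMComponent.degree, MSSMComponent.field]

theorem sub_kronecker_one {m n : Type*} [DecidableEq n] (A B : Matrix m m ℂ) :
    (A - B) ⊗ₖ (1 : Matrix n n ℂ) = A ⊗ₖ 1 - B ⊗ₖ 1 := by
  ext ⟨a, b⟩ ⟨c, d⟩; simp [sub_mul]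

theorem one_kronecker_sub {m n : Type*} [DecidableEq n] (A B : Matrix m m ℂ) :
    (1 : Matrix n n ℂ) ⊗ₖ (A - B) = 1 ⊗ₖ A - 1 ⊗ₖ B := by
  ext ⟨a, b⟩ ⟨c, d⟩; simp [mul_sub]

/-- The matrix units, made traceless: they span `sl n` and satisfy the relations of `gl n`. -/
noncomputable def tracelessUnit (n : ℕ) (i j : Fin n) : Matrix (Fin n) (Fin n) ℂ :=
  Matrix.single i j 1 - (if i = j then (1 / n : ℂ) else 0) • 1

theorem isGLFamily_tracelessUnit (n : ℕ) : IsGLFamily (tracelessUnit n) := by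
  intro i j k l
  have h : tracelessUnit n i j * tracelessUnit n k l - tracelessUnit n k l * tracelessUnit n i j =
      Matrix.single i j 1 * Matrix.single k l 1 - Matrix.single k l 1 * Matrix.single i j 1 := by
    simp only [tracelessUnit, sub_mul, mul_sub, smul_mul_assoc, mul_smul_comm, one_mul, mul_one]
    module
  rw [h]
  by_cases h1 : j = k <;> by_cases h2 : l = i
  · subst h1 h2; simp [tracelessUnit]
  · subst h1; simp [tracelessUnit, h2, Ne.symm h2, Matrix.single_mul_single_of_ne _ _ _ _ h2]
  · subst h2
    simp [tracelessUnit, h1, Ne.symm h1, Matrix.single_mul_single_of_ne _ _ _ _ h1]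
  · simp [h1, h2, Matrix.single_mul_single_of_ne _ _ _ _ h1,
      Matrix.single_mul_single_of_ne _ _ _ _ h2]

/-- The action of the Lie algebra `gl 3` of colour on the matter fields. -/
def colourRep (A : Matrix (Fin 3) (Fin 3) ℂ) : MatterBlocks :=
  (A ⊗ₖ 1, -A.transpose, -A.transpose, 0, 0, 0, 0)

/-- The action of the Lie algebra `gl 2` of weak isospin on the matter fields. -/
def isospinRep (B : Matrix (Fin 2) (Fin 2) ℂ) : MatterBlocks :=
  (1 ⊗ₖ B, 0, 0, B, B, B, 0)

theorem colourRep_commutator (A B : Matrix (Fin 3) (Fin 3) ℂ) :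
    colourRep A * colourRep B - colourRep B * colourRep A = colourRep (A * B - B * A) := by
  simp only [colourRep, Prod.mk_mul_mk, ← Matrix.mul_kronecker_mul, Prod.mk_sub_mk, neg_mul_neg,
    ← Matrix.transpose_mul, ← Matrix.transpose_sub, mul_zero, sub_zero, mul_one]
  refine Prod.ext (sub_kronecker_one _ _).symm (Prod.ext ?_ (Prod.ext ?_ ?_)) <;> simp

theorem isospinRep_commutator (A B : Matrix (Fin 2) (Fin 2) ℂ) :
    isospinRep A * isospinRep B - isospinRep B * isospinRep A = isospinRep (A * B - B * A) := by
  simp only [isospinRep, Prod.mk_mul_mk, ← Matrix.mul_kronecker_mul, Prod.mk_sub_mk,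
    mul_zero, sub_zero, mul_one]
  exact Prod.ext (one_kronecker_sub _ _).symm rfl

theorem colourRep_mul_isospinRep (A : Matrix (Fin 3) (Fin 3) ℂ) (B : Matrix (Fin 2) (Fin 2) ℂ) :
    colourRep A * isospinRep B = isospinRep B * colourRep A := by
  simp [colourRep, isospinRep, ← Matrix.mul_kronecker_mul]

theorem colourRep_sub (A B : Matrix (Fin 3) (Fin 3) ℂ) :
    colourRep (A - B) = colourRep A - colourRep B := by
  simp only [colourRep, Prod.mk_sub_mk, Matrix.transpose_sub]
  refine Prod.ext (sub_kronecker_one _ _) (Prod.ext ?_ (Prod.ext ?_ ?_)) <;> simp <;> abel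

theorem isospinRep_sub (A B : Matrix (Fin 2) (Fin 2) ℂ) :
    isospinRep (A - B) = isospinRep A - isospinRep B := by
  simp only [isospinRep, Prod.mk_sub_mk, sub_zero]
  exact Prod.ext (one_kronecker_sub _ _) rfl

theorem colourRep_zero : colourRep 0 = 0 := by simp [colourRep]

theorem isospinRep_zero : isospinRep 0 = 0 := by simp [isospinRep]

theorem isGLFamily_colourRep : IsGLFamily fun i j => colourRep (tracelessUnit 3 i j) := by
  intro i j k l
  simp only [colourRep_commutator, isGLFamily_tracelessUnit 3 i j k l, colourRep_sub]
  split_ifs <;> simp [colourRep_zero]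

theorem isGLFamily_isospinRep : IsGLFamily fun i j => isospinRep (tracelessUnit 2 i j) := by
  intro i j k l
  simp only [isospinRep_commutator, isGLFamily_tracelessUnit 2 i j k l, isospinRep_sub]
  split_ifs <;> simp [isospinRep_zero]

theorem conjTranspose_tracelessUnit (n : ℕ) (i j : Fin n) :
    (tracelessUnit n i j).conjTranspose = tracelessUnit n j i := by
  rw [tracelessUnit, tracelessUnit, Matrix.conjTranspose_sub, Matrix.conjTranspose_single,
    Matrix.conjTranspose_smul, Matrix.conjTranspose_one]
  by_cases h : i = j
  · simp [h]
  · simp [h, Ne.symm h]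

theorem conjTranspose_colourRep (A : Matrix (Fin 3) (Fin 3) ℂ) :
    (colourRep A).toMatrix.conjTranspose = (colourRep A.conjTranspose).toMatrix := by
  ext c c'
  cases c <;> cases c' <;>
    simp only [MatterBlocks.toMatrix, colourRep, Matrix.conjTranspose_apply, Matrix.kronecker_apply,
      Matrix.one_apply, Matrix.neg_apply, Matrix.transpose_apply, Matrix.zero_apply] <;>
    first | simp; done | (split_ifs <;> simp_all)

theorem conjTranspose_isospinRep (A : Matrix (Fin 2) (Fin 2) ℂ) :
    (isospinRep A).toMatrix.conjTranspose = (isospinRep A.conjTranspose).toMatrix := by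
  ext c c'
  cases c <;> cases c' <;>
    simp only [MatterBlocks.toMatrix, isospinRep, Matrix.conjTranspose_apply,
      Matrix.kronecker_apply, Matrix.one_apply, Matrix.zero_apply] <;>
    first | simp; done | (split_ifs <;> simp_all)

/-! ### Weights -/

/-- The weights of the maximal torus of the gauge group: the exponents of `z₁`, `z₂`, `y` and
`x ^ (1 / 6)`. -/
abbrev MSSMWeight : Type := ℤ × ℤ × ℤ × ℤ

/-- The weights `z₁`, `z₂ / z₁`, `1 / z₂` of the fundamental representation of `SU(3)`. -/
def colourWeight (a : Fin 3) : MSSMWeight :=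
  (![1, -1, 0] a, ![0, 1, -1] a, 0, 0)

/-- The weights `y`, `1 / y` of the fundamental representation of `SU(2)`. -/
def isospinWeight (α : Fin 2) : MSSMWeight :=
  (0, 0, ![1, -1] α, 0)

/-- The weight of a scalar component. -/
def MSSMComponent.weight : MSSMComponent → MSSMWeight
  | .Q _ a α => colourWeight a + isospinWeight α + (0, 0, 0, 1)
  | .u _ a => -colourWeight a + (0, 0, 0, -4)
  | .d _ a => -colourWeight a + (0, 0, 0, 2)
  | .L _ α => isospinWeight α + (0, 0, 0, -3)
  | .e _ => (0, 0, 0, 6)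
  | .Hu α => isospinWeight α + (0, 0, 0, 3)
  | .Hd α => isospinWeight α + (0, 0, 0, -3)

theorem tracelessUnit_ne_zero {n : ℕ} {i j k l : Fin n} (h : tracelessUnit n i j k l ≠ 0) :
    (k = i ∧ l = j) ∨ (i = j ∧ k = l) := by
  by_contra hne
  push Not at hne
  apply h
  by_cases h1 : k = i <;> by_cases h2 : l = j <;> by_cases h3 : i = j <;>
    by_cases h4 : k = l <;>
    simp_all [tracelessUnit, Matrix.single_apply, Matrix.one_apply, eq_comm]

theorem weight_of_colourRep {i j : Fin 3} {c c' : MSSMComponent}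
    (h : (colourRep (tracelessUnit 3 i j)).toMatrix c c' ≠ 0) :
    c'.weight = c.weight + (colourWeight j - colourWeight i) := by
  cases c <;> cases c' <;>
    simp only [MatterBlocks.toMatrix, colourRep, ne_eq, not_true_eq_false, ite_eq_right_iff,
      Classical.not_imp, Matrix.kronecker_apply, mul_eq_zero, not_or, Matrix.neg_apply, neg_eq_zero,
      Matrix.transpose_apply, Matrix.zero_apply, Matrix.one_apply, one_ne_zero, and_false] at h
  · obtain ⟨-, h1, rfl, -⟩ := h
    rcases tracelessUnit_ne_zero h1 with ⟨rfl, rfl⟩ | ⟨rfl, rfl⟩ <;>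
      simp only [MSSMComponent.weight] <;> abel
  all_goals
    rcases tracelessUnit_ne_zero h.2 with ⟨rfl, rfl⟩ | ⟨rfl, rfl⟩ <;>
      simp only [MSSMComponent.weight] <;> abel

theorem weight_of_isospinRep {i j : Fin 2} {c c' : MSSMComponent}
    (h : (isospinRep (tracelessUnit 2 i j)).toMatrix c c' ≠ 0) :
    c'.weight = c.weight + (isospinWeight j - isospinWeight i) := by
  cases c <;> cases c' <;>
    simp only [MatterBlocks.toMatrix, isospinRep, ne_eq, not_true_eq_false, ite_eq_right_iff,
      Classical.not_imp, Matrix.kronecker_apply, mul_eq_zero, not_or,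
      Matrix.zero_apply, Matrix.one_apply, one_ne_zero, and_false] at h
  · obtain ⟨-, ⟨rfl, -⟩, h1⟩ := h
    rcases tracelessUnit_ne_zero h1 with ⟨rfl, rfl⟩ | ⟨rfl, rfl⟩ <;>
      simp only [MSSMComponent.weight] <;> abel
  · rcases tracelessUnit_ne_zero h.2 with ⟨rfl, rfl⟩ | ⟨rfl, rfl⟩ <;>
      simp only [MSSMComponent.weight] <;> abel
  all_goals
    rcases tracelessUnit_ne_zero h with ⟨rfl, rfl⟩ | ⟨rfl, rfl⟩ <;>
      simp only [MSSMComponent.weight] <;> abel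

/-- The coordinates of a weight of `SU(3)` in `ℂ ^ 3 / ℂ (1, 1, 1)`, normalised to sum zero. -/
noncomputable def colourCoord (i : Fin 3) : MSSMWeight →+ ℂ where
  toFun μ := ![(2 * μ.1 + μ.2.1 : ℂ) / 3, (-μ.1 + μ.2.1 : ℂ) / 3, (-μ.1 - 2 * μ.2.1 : ℂ) / 3] i
  map_zero' := by fin_cases i <;> simp
  map_add' μ ν := by fin_cases i <;> simp <;> ring

/-- The coordinates of a weight of `SU(2)` in `ℂ ^ 2 / ℂ (1, 1)`, normalised to sum zero. -/
noncomputable def isospinCoord (i : Fin 2) : MSSMWeight →+ ℂ where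
  toFun μ := ![(μ.2.2.1 : ℂ) / 2, -(μ.2.2.1 : ℂ) / 2] i
  map_zero' := by fin_cases i <;> simp
  map_add' μ ν := by fin_cases i <;> simp <;> ring

theorem colourRep_diag (i : Fin 3) : (colourRep (tracelessUnit 3 i i)).toMatrix =
    Matrix.diagonal fun c => colourCoord i c.weight := by
  have hw : ∀ a, colourCoord i (colourWeight a) = tracelessUnit 3 i i a a := by
    intro a
    fin_cases i <;> fin_cases a <;>
      norm_num [colourCoord, colourWeight, tracelessUnit, Matrix.single_apply]
  have hz : ∀ k, colourCoord i (0, 0, 0, k) = 0 := by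
    intro k; fin_cases i <;> simp [colourCoord]
  have hs : ∀ α, colourCoord i (isospinWeight α) = 0 := by
    intro k; fin_cases i <;> simp [colourCoord, isospinWeight]
  have hoff : ∀ a a', a ≠ a' → tracelessUnit 3 i i a a' = 0 := by
    intro a a' h
    by_contra h'
    rcases tracelessUnit_ne_zero h' with ⟨rfl, rfl⟩ | ⟨-, rfl⟩ <;> exact h rfl
  ext c c'
  rw [Matrix.diagonal_apply]
  cases c with
  | Q j a α => cases c' with
    | Q j' a' α' =>
      by_cases h : a = a'
      · subst h
        simp [MatterBlocks.toMatrix, colourRep, MSSMComponent.weight, hw, hz, hs,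
          Matrix.one_apply, ← ite_and]
      · simp [MatterBlocks.toMatrix, colourRep, hoff _ _ h, h]
    | _ => simp [MatterBlocks.toMatrix]
  | u j a => cases c' with
    | u j' a' =>
      by_cases h : a = a'
      · subst h
        simp [MatterBlocks.toMatrix, colourRep, MSSMComponent.weight, hw, hz]
      · simp [MatterBlocks.toMatrix, colourRep, hoff _ _ (Ne.symm h), h]
    | _ => simp [MatterBlocks.toMatrix]
  | d j a => cases c' with
    | d j' a' =>
      by_cases h : a = a'
      · subst h
        simp [MatterBlocks.toMatrix, colourRep, MSSMComponent.weight, hw, hz]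
      · simp [MatterBlocks.toMatrix, colourRep, hoff _ _ (Ne.symm h), h]
    | _ => simp [MatterBlocks.toMatrix]
  | _ => cases c' <;> simp [MatterBlocks.toMatrix, colourRep, MSSMComponent.weight, hs, hz]

theorem isospinRep_diag (i : Fin 2) : (isospinRep (tracelessUnit 2 i i)).toMatrix =
    Matrix.diagonal fun c => isospinCoord i c.weight := by
  have hw : ∀ a, isospinCoord i (isospinWeight a) = tracelessUnit 2 i i a a := by
    intro a
    fin_cases i <;> fin_cases a <;>
      norm_num [isospinCoord, isospinWeight, tracelessUnit, Matrix.single_apply]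
  have hz : ∀ k, isospinCoord i (0, 0, 0, k) = 0 := by
    intro k; fin_cases i <;> simp [isospinCoord]
  have hs : ∀ a, isospinCoord i (colourWeight a) = 0 := by
    intro k; fin_cases i <;> simp [isospinCoord, colourWeight]
  have hoff : ∀ a a', a ≠ a' → tracelessUnit 2 i i a a' = 0 := by
    intro a a' h
    by_contra h'
    rcases tracelessUnit_ne_zero h' with ⟨rfl, rfl⟩ | ⟨-, rfl⟩ <;> exact h rfl
  ext c c'
  rw [Matrix.diagonal_apply]
  cases c with
  | Q j a α => cases c' with
    | Q j' a' α' =>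
      by_cases h : α = α'
      · subst h
        simp [MatterBlocks.toMatrix, isospinRep, MSSMComponent.weight, hw, hz, hs,
          Matrix.one_apply, ← ite_and]
      · simp [MatterBlocks.toMatrix, isospinRep, hoff _ _ h, h]
    | _ => simp [MatterBlocks.toMatrix]
  | L j α => cases c' with
    | L j' α' =>
      by_cases h : α = α'
      · subst h
        simp [MatterBlocks.toMatrix, isospinRep, MSSMComponent.weight, hw, hz]
      · simp [MatterBlocks.toMatrix, isospinRep, hoff _ _ h, h]
    | _ => simp [MatterBlocks.toMatrix]
  | Hu α => cases c' with
    | Hu α' =>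
      by_cases h : α = α'
      · subst h
        simp [MatterBlocks.toMatrix, isospinRep, MSSMComponent.weight, hw, hz]
      · simp [MatterBlocks.toMatrix, isospinRep, hoff _ _ h, h]
    | _ => simp [MatterBlocks.toMatrix]
  | Hd α => cases c' with
    | Hd α' =>
      by_cases h : α = α'
      · subst h
        simp [MatterBlocks.toMatrix, isospinRep, MSSMComponent.weight, hw, hz]
      · simp [MatterBlocks.toMatrix, isospinRep, hoff _ _ h, h]
    | _ => simp [MatterBlocks.toMatrix]
  | _ => cases c' <;> simp [MatterBlocks.toMatrix, isospinRep, MSSMComponent.weight, hs, hz]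

end Matter

/-! ### The multiplicity of the trivial representation -/

section Multiplicity

open MvPolynomial

/-- The polynomials in the scalar components of multidegree `n`. -/
noncomputable abbrev multidegreePiece (n : MSSMField →₀ ℕ) :
    Submodule ℂ (MvPolynomial MSSMComponent ℂ) :=
  weightedHomogeneousSubmodule ℂ MSSMComponent.degree n

/-- The exponents of the monomials of multidegree `n`. -/
def multidegreeExponents (n : MSSMField →₀ ℕ) : Set (MSSMComponent →₀ ℕ) :=
  {a | Finsupp.weight MSSMComponent.degree a = n}

theorem le_of_weight_degree {a : MSSMComponent →₀ ℕ} {n : MSSMField →₀ ℕ}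
    (h : Finsupp.weight MSSMComponent.degree a = n) (c : MSSMComponent) : a c ≤ n c.field := by
  have h1 : a c • c.degree ≤ n := by
    rw [← h, Finsupp.weight_apply, Finsupp.sum_fintype _ _ (by simp)]
    exact Finset.single_le_sum (f := fun c => a c • MSSMComponent.degree c)
      (fun _ _ => zero_le) (Finset.mem_univ c)
  have := h1 c.field
  simpa [MSSMComponent.degree] using this

instance finite_multidegreeExponents (n : MSSMField →₀ ℕ) : Finite (multidegreeExponents n) := by
  have : multidegreeExponents n ⊆
      Set.Iic (Finsupp.equivFunOnFinite.symm fun c : MSSMComponent => n c.field) :=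
    fun a ha c => le_of_weight_degree ha c
  exact ((Set.finite_Iic _).subset this).to_subtype

/-- Polynomials supported on a finite set of exponents form a space of the expected dimension. -/
theorem finrank_of_support {S : Set (MSSMComponent →₀ ℕ)} [Finite S]
    {K : Submodule ℂ (MvPolynomial MSSMComponent ℂ)}
    (hK : ∀ p, p ∈ K ↔ ∀ a, coeff a p ≠ 0 → a ∈ S) :
    Module.Finite ℂ K ∧ Module.finrank ℂ K = Nat.card S := by
  have : Fintype S := Fintype.ofFinite S
  classical
  let e : K ≃ₗ[ℂ] (S → ℂ) :=
    { toFun := fun p a => coeff a.1 p.1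
      map_add' := fun p q => by ext; simp
      map_smul' := fun x p => by ext; simp
      invFun := fun f => ⟨∑ a : S, monomial a.1 (f a), by
        rw [hK]
        intro b hb
        rw [coeff_sum] at hb
        obtain ⟨a, -, ha⟩ := Finset.exists_ne_zero_of_sum_ne_zero hb
        rw [coeff_monomial] at ha
        split_ifs at ha with h
        · exact h ▸ a.2
        · exact absurd rfl ha⟩
      left_inv := by
        intro p
        ext b
        simp only [coeff_sum, coeff_monomial]
        by_cases hb : b ∈ S
        · rw [Finset.sum_eq_single ⟨b, hb⟩]
          · simp
          · intro a _ ha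
            rw [if_neg fun h => ha (Subtype.ext h)]
          · simp
        · rw [Finset.sum_eq_zero]
          · by_contra h
            exact hb ((hK p.1).mp p.2 b (Ne.symm h))
          · intro a _
            rw [if_neg fun h : a.1 = b => hb (h ▸ a.2)]
      right_inv := by
        intro f
        ext b
        simp only [coeff_sum, coeff_monomial]
        rw [Finset.sum_eq_single b]
        · simp
        · intro a _ ha
          rw [if_neg fun h => ha (Subtype.ext h)]
        · simp }
  refine ⟨Module.Finite.equiv e.symm, ?_⟩
  rw [e.finrank_eq, Module.finrank_fintype_fun_eq_card, Nat.card_eq_fintype_card]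

instance finite_multidegreePiece (n : MSSMField →₀ ℕ) : Module.Finite ℂ (multidegreePiece n) :=
  (finrank_of_support (S := multidegreeExponents n) (K := multidegreePiece n)
    fun _ => ⟨fun h _ ha => h ha, fun h _ ha => h _ ha⟩).1

/-- The action of matter blocks on the polynomials of multidegree `n` by linear vector fields. -/
noncomputable def blockOp (n : MSSMField →₀ ℕ) (b : MatterBlocks) :
    Module.End ℂ (multidegreePiece n) :=
  (linDer b.toMatrix).toLinearMap.restrict fun p hp => by
    have := isWeightedHomogeneous_linDer (w := MSSMComponent.degree) (α := 0)
      (fun c c' h => by rw [add_zero, b.degree_eq h]) hp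
    rwa [add_zero] at this

theorem coe_blockOp (n : MSSMField →₀ ℕ) (b : MatterBlocks) (v : multidegreePiece n) :
    (blockOp n b v : MvPolynomial MSSMComponent ℂ) = linDer b.toMatrix v := rfl

theorem blockOp_commutator (n : MSSMField →₀ ℕ) (b b' : MatterBlocks) :
    blockOp n b * blockOp n b' - blockOp n b' * blockOp n b = blockOp n (b' * b - b * b') := by
  refine LinearMap.ext fun v => Subtype.ext ?_
  rw [coe_blockOp, MatterBlocks.toMatrix_sub, MatterBlocks.toMatrix_mul,
    MatterBlocks.toMatrix_mul, ← linDer_commutator]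
  rfl

theorem blockOp_sub (n : MSSMField →₀ ℕ) (b b' : MatterBlocks) :
    blockOp n (b - b') = blockOp n b - blockOp n b' := by
  refine LinearMap.ext fun v => Subtype.ext ?_
  rw [coe_blockOp, MatterBlocks.toMatrix_sub, linDer_sub]
  rfl

theorem blockOp_zero (n : MSSMField →₀ ℕ) : blockOp n 0 = 0 := by
  refine LinearMap.ext fun v => Subtype.ext ?_
  have h := MatterBlocks.toMatrix_sub 0 0
  rw [sub_self, sub_self] at h
  rw [coe_blockOp, h, linDer_zero]
  rfl

theorem isGLFamily_blockOp (n : MSSMField →₀ ℕ) {ι : Type*} [DecidableEq ι]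
    {T : ι → ι → MatterBlocks} (hT : IsGLFamily T) : IsGLFamily fun i j => blockOp n (T j i) := by
  intro i j k l
  simp only [blockOp_commutator, hT l k j i, blockOp_sub]
  congr 1 <;> split_ifs <;> simp_all [blockOp_zero]

/-- The vector field `X_i ∂_j` of colour, made traceless. -/
noncomputable def colourOp (n : MSSMField →₀ ℕ) (i j : Fin 3) :
    Module.End ℂ (multidegreePiece n) :=
  blockOp n (colourRep (tracelessUnit 3 j i))

/-- The vector field `X_i ∂_j` of weak isospin, made traceless. -/
noncomputable def isospinOp (n : MSSMField →₀ ℕ) (i j : Fin 2) :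
    Module.End ℂ (multidegreePiece n) :=
  blockOp n (isospinRep (tracelessUnit 2 j i))

theorem isGLFamily_colourOp (n : MSSMField →₀ ℕ) : IsGLFamily (colourOp n) :=
  isGLFamily_blockOp n isGLFamily_colourRep

theorem isGLFamily_isospinOp (n : MSSMField →₀ ℕ) : IsGLFamily (isospinOp n) :=
  isGLFamily_blockOp n isGLFamily_isospinRep

theorem commute_colourOp_isospinOp (n : MSSMField →₀ ℕ) (i j : Fin 3) (k l : Fin 2) :
    Commute (colourOp n i j) (isospinOp n k l) := by
  rw [commute_iff_eq, ← sub_eq_zero, colourOp, isospinOp, blockOp_commutator,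
    colourRep_mul_isospinRep, sub_self, blockOp_zero]

/-- The projection onto the weight space of weight `μ`. -/
noncomputable def weightProj (n : MSSMField →₀ ℕ) (μ : MSSMWeight) :
    Module.End ℂ (multidegreePiece n) :=
  (weightedHomogeneousComponent MSSMComponent.weight μ).restrict fun p hp a ha => by
    rw [coeff_weightedHomogeneousComponent] at ha
    split_ifs at ha
    · exact hp ha
    · exact absurd rfl ha

theorem coe_weightProj (n : MSSMField →₀ ℕ) (μ : MSSMWeight) (v : multidegreePiece n) :
    (weightProj n μ v : MvPolynomial MSSMComponent ℂ) =
      weightedHomogeneousComponent MSSMComponent.weight μ v := rfl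

theorem weightProj_mul_self (n : MSSMField →₀ ℕ) (μ : MSSMWeight) :
    weightProj n μ * weightProj n μ = weightProj n μ := by
  refine LinearMap.ext fun v => Subtype.ext ?_
  rw [Module.End.mul_apply, coe_weightProj, coe_weightProj]
  exact (weightedHomogeneousComponent_isWeightedHomogeneous μ _).weightedHomogeneousComponent_same

theorem trace_of_isProj {V : Type*} [AddCommGroup V] [Module ℂ V] [Module.Finite ℂ V]
    {p : Submodule ℂ V} {f : Module.End ℂ V} (h : LinearMap.IsProj p f) :
    LinearMap.trace ℂ V f = Module.finrank ℂ p := h.trace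

theorem trace_weightProj (n : MSSMField →₀ ℕ) (μ : MSSMWeight) :
    LinearMap.trace ℂ _ (weightProj n μ) =
      (Nat.card {a : multidegreeExponents n //
        Finsupp.weight MSSMComponent.weight a.1 = μ} : ℂ) := by
  let K : Submodule ℂ (MvPolynomial MSSMComponent ℂ) :=
    multidegreePiece n ⊓ weightedHomogeneousSubmodule ℂ MSSMComponent.weight μ
  have hproj : LinearMap.IsProj (K.comap (multidegreePiece n).subtype) (weightProj n μ) := by
    constructor
    · intro v
      exact ⟨(weightProj n μ v).2, weightedHomogeneousComponent_isWeightedHomogeneous μ _⟩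
    · intro v hv
      exact Subtype.ext (IsWeightedHomogeneous.weightedHomogeneousComponent_same hv.2)
  have hfin : Finite {a | Finsupp.weight MSSMComponent.degree a = n ∧
      Finsupp.weight MSSMComponent.weight a = μ} :=
    Finite.Set.subset (multidegreeExponents n) fun a ha => ha.1
  rw [trace_of_isProj hproj, Nat.cast_inj,
    (Submodule.comapSubtypeEquivOfLe (inf_le_left : K ≤ multidegreePiece n)).finrank_eq,
    (finrank_of_support (S := {a | Finsupp.weight MSSMComponent.degree a = n ∧
      Finsupp.weight MSSMComponent.weight a = μ}) (K := K) ?_).2]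
  · exact Nat.card_congr (Equiv.subtypeSubtypeEquivSubtypeInter _ _).symm
  · intro p
    exact ⟨fun h a ha => ⟨h.1 ha, h.2 ha⟩, fun h =>
      ⟨fun _ ha => (h _ ha).1, fun _ ha => (h _ ha).2⟩⟩

theorem weightProj_mul_blockOp (n : MSSMField →₀ ℕ) {b : MatterBlocks} {α : MSSMWeight}
    (hb : ∀ {c c'}, b.toMatrix c c' ≠ 0 → c'.weight = c.weight + α) (μ : MSSMWeight) :
    weightProj n (μ + α) * blockOp n b = blockOp n b * weightProj n μ := by
  refine LinearMap.ext fun v => Subtype.ext ?_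
  rw [Module.End.mul_apply, Module.End.mul_apply, coe_weightProj, coe_blockOp, coe_blockOp,
    coe_weightProj]
  generalize (v : MvPolynomial MSSMComponent ℂ) = p
  have hM : ∀ c c', b.toMatrix c c' ≠ 0 → c'.weight = c.weight + α := fun c c' => hb
  induction p using MvPolynomial.induction_on' with
  | add p q hp hq => simp only [map_add, hp, hq]
  | monomial a x =>
    have h1 := isWeightedHomogeneous_monomial MSSMComponent.weight a x (m := _) rfl
    have h2 := isWeightedHomogeneous_linDer hM h1
    by_cases h : Finsupp.weight MSSMComponent.weight a = μ
    · rw [← h, h2.weightedHomogeneousComponent_same, h1.weightedHomogeneousComponent_same]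
    · rw [h2.weightedHomogeneousComponent_ne _ fun h' => h (add_right_cancel h').symm,
        h1.weightedHomogeneousComponent_ne _ (Ne.symm h), map_zero]

theorem weightProj_mul_colourOp (n : MSSMField →₀ ℕ) (i j : Fin 3) (μ : MSSMWeight) :
    weightProj n (μ + (colourWeight i - colourWeight j)) * colourOp n i j =
      colourOp n i j * weightProj n μ :=
  weightProj_mul_blockOp n weight_of_colourRep μ

theorem weightProj_mul_isospinOp (n : MSSMField →₀ ℕ) (i j : Fin 2) (μ : MSSMWeight) :
    weightProj n (μ + (isospinWeight i - isospinWeight j)) * isospinOp n i j =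
      isospinOp n i j * weightProj n μ :=
  weightProj_mul_blockOp n weight_of_isospinRep μ

theorem weightProj_mul_blockOp_diagonal (n : MSSMField →₀ ℕ) {b : MatterBlocks}
    {χ : MSSMWeight →+ ℂ} (hb : b.toMatrix = Matrix.diagonal fun c => χ c.weight)
    (μ : MSSMWeight) : weightProj n μ * blockOp n b = χ μ • weightProj n μ := by
  refine LinearMap.ext fun v => Subtype.ext ?_
  rw [Module.End.mul_apply, coe_weightProj, coe_blockOp, LinearMap.smul_apply,
    Submodule.coe_smul, coe_weightProj]
  ext a
  rw [coeff_smul, coeff_weightedHomogeneousComponent, coeff_weightedHomogeneousComponent, hb,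
    coeff_linDer_diagonal]
  split_ifs with h
  · rw [← h, Finsupp.weight_apply, Finsupp.sum_fintype _ _ (by simp), map_sum]
    congr 1
    exact Finset.sum_congr rfl fun c _ => by rw [map_nsmul, nsmul_eq_mul]
  · simp

theorem weightProj_mul_colourOp_diag (n : MSSMField →₀ ℕ) (i : Fin 3) (μ : MSSMWeight) :
    weightProj n μ * colourOp n i i = colourCoord i μ • weightProj n μ :=
  weightProj_mul_blockOp_diagonal n (colourRep_diag i) μ

theorem weightProj_mul_isospinOp_diag (n : MSSMField →₀ ℕ) (i : Fin 2) (μ : MSSMWeight) :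
    weightProj n μ * isospinOp n i i = isospinCoord i μ • weightProj n μ :=
  weightProj_mul_blockOp_diagonal n (isospinRep_diag i) μ

theorem fischer_colourOp (n : MSSMField →₀ ℕ) (i j : Fin 3) (v w : multidegreePiece n) :
    fischer (v : MvPolynomial MSSMComponent ℂ) (colourOp n i j w) =
      fischer (colourOp n j i v : MvPolynomial MSSMComponent ℂ) w := by
  rw [colourOp, colourOp, coe_blockOp, coe_blockOp, fischer_linDer, conjTranspose_colourRep,
    conjTranspose_tracelessUnit]

theorem fischer_isospinOp (n : MSSMField →₀ ℕ) (i j : Fin 2) (v w : multidegreePiece n) :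
    fischer (v : MvPolynomial MSSMComponent ℂ) (isospinOp n i j w) =
      fischer (isospinOp n j i v : MvPolynomial MSSMComponent ℂ) w := by
  rw [isospinOp, isospinOp, coe_blockOp, coe_blockOp, fischer_linDer, conjTranspose_isospinRep,
    conjTranspose_tracelessUnit]

/-- The sum of the Casimir operators of `SU(3)` and `SU(2)` on the polynomials of
multidegree `n`. -/
noncomputable def gaugeCasimir (n : MSSMField →₀ ℕ) : Module.End ℂ (multidegreePiece n) :=
  casimir (colourOp n) + casimir (isospinOp n)

theorem fischer_gaugeCasimir (n : MSSMField →₀ ℕ) (v w : multidegreePiece n) :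
    fischer (v : MvPolynomial MSSMComponent ℂ) (gaugeCasimir n w) =
      (∑ i, ∑ j, fischer (colourOp n j i v : MvPolynomial MSSMComponent ℂ) (colourOp n j i w)) +
      ∑ i, ∑ j, fischer (isospinOp n j i v : MvPolynomial MSSMComponent ℂ) (isospinOp n j i w) := by
  simp only [gaugeCasimir, casimir, LinearMap.add_apply, LinearMap.sum_apply,
    Submodule.coe_add, Submodule.coe_sum, fischer_add_right, fischer_sum_right,
    Module.End.mul_apply, fischer_colourOp, fischer_isospinOp]

/-- The kernel of the Casimir operator consists of the invariants, because the Casimir operator is a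
sum of operators `A† A` for the Fischer inner product. -/
theorem gaugeCasimir_eq_zero_iff (n : MSSMField →₀ ℕ) (v : multidegreePiece n) :
    gaugeCasimir n v = 0 ↔ (∀ i j, colourOp n i j v = 0) ∧ ∀ i j, isospinOp n i j v = 0 := by
  constructor
  · intro h
    have h1 := congrArg Complex.re (fischer_gaugeCasimir n v v)
    have h0 : fischer (v : MvPolynomial MSSMComponent ℂ) ((0 : multidegreePiece n) :
        MvPolynomial MSSMComponent ℂ) = 0 := by simp [fischer]
    rw [h, h0, Complex.add_re, Complex.re_sum, Complex.re_sum, Complex.zero_re] at h1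
    simp only [Complex.re_sum] at h1
    have n1 : ∀ i ∈ Finset.univ, 0 ≤ ∑ j, (fischer (colourOp n j i v : MvPolynomial MSSMComponent ℂ)
        (colourOp n j i v)).re :=
      fun i _ => Finset.sum_nonneg fun j _ => fischer_self_re_nonneg _
    have n2 : ∀ i ∈ Finset.univ, 0 ≤ ∑ j,
        (fischer (isospinOp n j i v : MvPolynomial MSSMComponent ℂ) (isospinOp n j i v)).re :=
      fun i _ => Finset.sum_nonneg fun j _ => fischer_self_re_nonneg _
    have z := (add_eq_zero_iff_of_nonneg (Finset.sum_nonneg n1) (Finset.sum_nonneg n2)).mp h1.symm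
    rw [Finset.sum_eq_zero_iff_of_nonneg n1, Finset.sum_eq_zero_iff_of_nonneg n2] at z
    constructor
    · intro i j
      have := z.1 j (Finset.mem_univ _)
      rw [Finset.sum_eq_zero_iff_of_nonneg fun _ _ => fischer_self_re_nonneg _] at this
      exact Subtype.ext (eq_zero_of_fischer_self (this i (Finset.mem_univ _)))
    · intro i j
      have := z.2 j (Finset.mem_univ _)
      rw [Finset.sum_eq_zero_iff_of_nonneg fun _ _ => fischer_self_re_nonneg _] at this
      exact Subtype.ext (eq_zero_of_fischer_self (this i (Finset.mem_univ _)))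
  · rintro ⟨h1, h2⟩
    simp [gaugeCasimir, casimir, LinearMap.sum_apply, h1, h2]

theorem gaugeCasimir_ker_sq (n : MSSMField →₀ ℕ) (v : multidegreePiece n)
    (h : gaugeCasimir n (gaugeCasimir n v) = 0) : gaugeCasimir n v = 0 := by
  obtain ⟨h1, h2⟩ := (gaugeCasimir_eq_zero_iff n _).mp h
  have := fischer_gaugeCasimir n (gaugeCasimir n v) v
  refine Subtype.ext (eq_zero_of_fischer_self ?_)
  have h0 : ∀ w : MvPolynomial MSSMComponent ℂ, fischer 0 w = 0 := by simp [fischer]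
  rw [this]
  simp only [h1, h2, Submodule.coe_zero, h0, Finset.sum_const_zero, add_zero, Complex.zero_re]

theorem commute_colourOp_gaugeCasimir (n : MSSMField →₀ ℕ) (i j : Fin 3) :
    Commute (colourOp n i j) (gaugeCasimir n) :=
  ((isGLFamily_colourOp n).commute_casimir i j).add_right <|
    Commute.sum_right _ _ _ fun _ _ => Commute.sum_right _ _ _ fun _ _ =>
      (commute_colourOp_isospinOp n _ _ _ _).mul_right (commute_colourOp_isospinOp n _ _ _ _)

theorem commute_isospinOp_gaugeCasimir (n : MSSMField →₀ ℕ) (i j : Fin 2) :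
    Commute (isospinOp n i j) (gaugeCasimir n) :=
  (Commute.sum_right _ _ _ fun _ _ => Commute.sum_right _ _ _ fun _ _ =>
      (commute_colourOp_isospinOp n _ _ _ _).symm.mul_right
        (commute_colourOp_isospinOp n _ _ _ _).symm).add_right <|
    (isGLFamily_isospinOp n).commute_casimir i j

/-- The polynomials of multidegree `n` which have weight zero and are annihilated by the Lie
algebras of `SU(3)` and `SU(2)`. -/
noncomputable def lieInvariants (n : MSSMField →₀ ℕ) : Submodule ℂ (multidegreePiece n) :=
  LinearMap.ker (weightProj n 0 - 1) ⊓
    ((⨅ i, ⨅ j, LinearMap.ker (colourOp n i j)) ⊓ ⨅ i, ⨅ j, LinearMap.ker (isospinOp n i j))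

theorem mem_lieInvariants (n : MSSMField →₀ ℕ) (v : multidegreePiece n) :
    v ∈ lieInvariants n ↔ weightProj n 0 v = v ∧ (∀ i j, colourOp n i j v = 0) ∧
      ∀ i j, isospinOp n i j v = 0 := by
  simp [lieInvariants, sub_eq_zero]

/-- The weight `-(a α₁ + b α₂ + c β)`, where `α₁`, `α₂` are the simple roots of `SU(3)` and `β` is
the root of `SU(2)`. -/
def rootWeight (a b c : ℕ) : MSSMWeight :=
  (-2 * a + b, a - 2 * b, -2 * c, 0)

/-- The alternating sum over the Weyl group of `SU(3) × SU(2)` of the values at `-(ρ - w ρ)`. -/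
def weylSum (m : MSSMWeight → ℂ) : ℂ :=
  m (rootWeight 0 0 0) - m (rootWeight 1 0 0) - m (rootWeight 0 1 0) + m (rootWeight 2 1 0) +
    m (rootWeight 1 2 0) - m (rootWeight 2 2 0) -
  (m (rootWeight 0 0 1) - m (rootWeight 1 0 1) - m (rootWeight 0 1 1) + m (rootWeight 2 1 1) +
    m (rootWeight 1 2 1) - m (rootWeight 2 2 1))

theorem colourCoord_rootWeight (a b c : ℕ) : colourCoord 0 (rootWeight a b c) = -a ∧
    colourCoord 1 (rootWeight a b c) = a - b ∧ colourCoord 2 (rootWeight a b c) = b := by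
  refine ⟨?_, ?_, ?_⟩ <;> simp [colourCoord, rootWeight] <;> ring

theorem isospinCoord_rootWeight (a b c : ℕ) : isospinCoord 0 (rootWeight a b c) = -c ∧
    isospinCoord 1 (rootWeight a b c) = c := by
  refine ⟨?_, ?_⟩ <;> (simp [isospinCoord, rootWeight]; try ring)

theorem eq_mul_one_sub_add {A : Type*} [Ring A] (E C C' P : A) :
    E = E * (1 - (C + C') * P) + (E * C * P + E * C' * P) := by
  noncomm_ring

/-- The multiplicity of the trivial representation is the alternating sum over the Weyl group of the
weight multiplicities at `-(ρ - w ρ)`. The part of the trace where the Casimir operator is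
invertible does not contribute. -/
theorem finrank_lieInvariants (n : MSSMField →₀ ℕ) :
    (Module.finrank ℂ (lieInvariants n) : ℂ) =
      weylSum fun μ => LinearMap.trace ℂ _ (weightProj n μ) := by
  obtain ⟨P, hP, hPC⟩ := exists_inverse_off_kernel (gaugeCasimir n) (gaugeCasimir_ker_sq n)
  have hcomm : ∀ T : Module.End ℂ (multidegreePiece n), Commute T (gaugeCasimir n) →
      Commute T P := fun T hT => by
    have : P ∈ Subalgebra.centralizer ℂ {T} := by
      refine Algebra.adjoin_le ?_ hP
      rintro _ rfl
      rw [SetLike.mem_coe, Subalgebra.mem_centralizer_iff]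
      rintro _ rfl
      exact hT
    exact (Subalgebra.mem_centralizer_iff ℂ).mp this T rfl
  have hcol := fun i j => hcomm _ (commute_colourOp_gaugeCasimir n i j)
  have hiso := fun i j => hcomm _ (commute_isospinOp_gaugeCasimir n i j)
  -- `1 - P C` is the projection onto the kernel of the Casimir operator
  set π : Module.End ℂ (multidegreePiece n) := 1 - P * gaugeCasimir n with hπ
  have hker : ∀ v, (∀ i j, colourOp n i j (π v) = 0) ∧ ∀ i j, isospinOp n i j (π v) = 0 := by
    intro v
    rw [← gaugeCasimir_eq_zero_iff, ← Module.End.mul_apply, hPC, LinearMap.zero_apply]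
  have hsplit : ∀ μ, LinearMap.trace ℂ _ (weightProj n μ) =
      LinearMap.trace ℂ _ (weightProj n μ * π) +
      (LinearMap.trace ℂ _ (weightProj n μ * casimir (colourOp n) * P) +
        LinearMap.trace ℂ _ (weightProj n μ * casimir (isospinOp n) * P)) := by
    intro μ
    rw [← map_add, ← map_add]
    congr 1
    rw [hπ, ← (hcomm _ (Commute.refl _)).eq]
    exact eq_mul_one_sub_add (weightProj n μ) (casimir (colourOp n)) (casimir (isospinOp n)) P
  have h3 := fun c => trace_casimir_three (isGLFamily_colourOp n)
    (E := fun a b => weightProj n (rootWeight a b c))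
    (fun a b => by
      rw [← weightProj_mul_colourOp]
      congr 2
      simp [rootWeight, colourWeight]; constructor <;> ring)
    (fun a b => by
      rw [← weightProj_mul_colourOp]
      congr 2
      simp [rootWeight, colourWeight]; constructor <;> ring)
    (fun a b => by
      rw [← weightProj_mul_colourOp]
      congr 2
      simp [rootWeight, colourWeight]; constructor <;> ring)
    (fun a b => by rw [weightProj_mul_colourOp_diag, (colourCoord_rootWeight a b c).1])
    (fun a b => by rw [weightProj_mul_colourOp_diag, (colourCoord_rootWeight a b c).2.1])
    (fun a b => by rw [weightProj_mul_colourOp_diag, (colourCoord_rootWeight a b c).2.2]) hcol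
  have h2 := fun a b => trace_casimir_two (isGLFamily_isospinOp n)
    (E := fun c => weightProj n (rootWeight a b c))
    (fun c => by
      rw [← weightProj_mul_isospinOp]
      congr 2
      simp [rootWeight, isospinWeight]; ring)
    (fun c => by rw [weightProj_mul_isospinOp_diag, (isospinCoord_rootWeight a b c).1])
    (fun c => by rw [weightProj_mul_isospinOp_diag, (isospinCoord_rootWeight a b c).2]) hiso
  -- invariants have weight zero
  have hzero : ∀ a b c : ℕ, (a ≠ 0 ∨ b ≠ 0 ∨ c ≠ 0) →
      LinearMap.trace ℂ _ (weightProj n (rootWeight a b c) * π) = 0 := by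
    intro a b c habc
    have key : ∀ (T : Module.End ℂ (multidegreePiece n)) (x : ℂ), x ≠ 0 →
        weightProj n (rootWeight a b c) * T = x • weightProj n (rootWeight a b c) →
        T * π = 0 → weightProj n (rootWeight a b c) * π = 0 := by
      intro T x hx h1 h2
      have : x • (weightProj n (rootWeight a b c) * π) = 0 := by
        rw [← smul_mul_assoc, ← h1, mul_assoc, h2, mul_zero]
      exact (smul_eq_zero.mp this).resolve_left hx
    have : weightProj n (rootWeight a b c) * π = 0 := by
      rcases habc with h | h | h
      · exact key _ _ (by rw [(colourCoord_rootWeight a b c).1]; simpa using h)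
          (weightProj_mul_colourOp_diag n 0 _) (LinearMap.ext fun v => (hker v).1 0 0)
      · exact key _ _ (by rw [(colourCoord_rootWeight a b c).2.2]; simpa using h)
          (weightProj_mul_colourOp_diag n 2 _) (LinearMap.ext fun v => (hker v).1 2 2)
      · exact key _ _ (by rw [(isospinCoord_rootWeight a b c).2]; simpa using h)
          (weightProj_mul_isospinOp_diag n 1 _) (LinearMap.ext fun v => (hker v).2 1 1)
    rw [this, map_zero]
  have hproj : LinearMap.IsProj (lieInvariants n) (weightProj n 0 * π) := by
    constructor
    · intro v
      rw [mem_lieInvariants]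
      refine ⟨?_, fun i j => ?_, fun i j => ?_⟩
      · rw [← Module.End.mul_apply, ← mul_assoc, weightProj_mul_self]
      · rw [Module.End.mul_apply, ← Module.End.mul_apply, ← weightProj_mul_colourOp,
          Module.End.mul_apply, (hker v).1, map_zero]
      · rw [Module.End.mul_apply, ← Module.End.mul_apply, ← weightProj_mul_isospinOp,
          Module.End.mul_apply, (hker v).2, map_zero]
    · intro v hv
      obtain ⟨h1, h2⟩ := (mem_lieInvariants n v).mp hv
      rw [Module.End.mul_apply, hπ, LinearMap.sub_apply, Module.End.mul_apply,
        (gaugeCasimir_eq_zero_iff n v).mpr h2, map_zero, sub_zero, Module.End.one_apply, h1]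
  have htr := trace_of_isProj hproj
  have hr0 : rootWeight 0 0 0 = 0 := by simp [rootWeight]
  rw [← htr, weylSum]
  simp only [hsplit]
  rw [hzero 1 0 0 (by simp), hzero 0 1 0 (by simp), hzero 2 1 0 (by simp), hzero 1 2 0 (by simp),
    hzero 2 2 0 (by simp), hzero 0 0 1 (by simp), hzero 1 0 1 (by simp), hzero 0 1 1 (by simp),
    hzero 2 1 1 (by simp), hzero 1 2 1 (by simp), hzero 2 2 1 (by simp), ← hr0]
  linear_combination h3 1 - h3 0 - h2 0 0 + h2 1 0 + h2 0 1 - h2 2 1 - h2 1 2 + h2 2 2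

end Multiplicity

/-! ### Gauge invariance and the Lie algebra -/

section GaugeInvariance

open MvPolynomial
open scoped Kronecker

/-- The value at a point of the complex torus of the character of a given weight. -/
noncomputable def weightChar (z₁ z₂ y ξ : ℂ) (μ : MSSMWeight) : ℂ :=
  z₁ ^ μ.1 * z₂ ^ μ.2.1 * y ^ μ.2.2.1 * ξ ^ μ.2.2.2

theorem weightChar_zero (z₁ z₂ y ξ : ℂ) : weightChar z₁ z₂ y ξ 0 = 1 := by simp [weightChar]

theorem weightChar_add {z₁ z₂ y ξ : ℂ} (h₁ : z₁ ≠ 0) (h₂ : z₂ ≠ 0) (hy : y ≠ 0) (hξ : ξ ≠ 0)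
    (μ ν : MSSMWeight) :
    weightChar z₁ z₂ y ξ (μ + ν) = weightChar z₁ z₂ y ξ μ * weightChar z₁ z₂ y ξ ν := by
  simp only [weightChar, Prod.fst_add, Prod.snd_add, zpow_add₀ h₁, zpow_add₀ h₂, zpow_add₀ hy,
    zpow_add₀ hξ]
  ring

theorem prod_weightChar {z₁ z₂ y ξ : ℂ} (h₁ : z₁ ≠ 0) (h₂ : z₂ ≠ 0) (hy : y ≠ 0) (hξ : ξ ≠ 0)
    (a : MSSMComponent →₀ ℕ) : ∏ c, weightChar z₁ z₂ y ξ c.weight ^ a c =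
      weightChar z₁ z₂ y ξ (Finsupp.weight MSSMComponent.weight a) := by
  let φ : Multiplicative MSSMWeight →* ℂ :=
    { toFun := fun μ => weightChar z₁ z₂ y ξ μ.toAdd
      map_one' := weightChar_zero _ _ _ _
      map_mul' := fun μ ν => weightChar_add h₁ h₂ hy hξ _ _ }
  rw [Finsupp.weight_apply, Finsupp.sum_fintype _ _ (by simp)]
  change ∏ c, φ (Multiplicative.ofAdd c.weight) ^ a c =
    φ (Multiplicative.ofAdd (∑ c, a c • c.weight))
  rw [ofAdd_sum, map_prod]
  exact Finset.prod_congr rfl fun c _ => by rw [ofAdd_nsmul, map_pow]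

/-- The action on the matter fields of colour matrices `A` (on triplets) and `A'` (on antitriplets),
an isospin matrix `B` and a `U(1)` parameter `ξ`. -/
noncomputable def gaugeBlocks (A A' : Matrix (Fin 3) (Fin 3) ℂ) (B : Matrix (Fin 2) (Fin 2) ℂ)
    (ξ : ℂ) : MatterBlocks :=
  (ξ • A ⊗ₖ B, ξ ^ (-4 : ℤ) • A', ξ ^ (2 : ℤ) • A', ξ ^ (-3 : ℤ) • B, ξ ^ (3 : ℤ) • B,
    ξ ^ (-3 : ℤ) • B, ξ ^ (6 : ℤ))

theorem gaugeBlocks_mul (A A' C C' : Matrix (Fin 3) (Fin 3) ℂ) (B D : Matrix (Fin 2) (Fin 2) ℂ)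
    (ξ η : ℂ) : gaugeBlocks A A' B ξ * gaugeBlocks C C' D η =
      gaugeBlocks (A * C) (A' * C') (B * D) (ξ * η) := by
  simp only [gaugeBlocks, Prod.mk_mul_mk, Matrix.mul_kronecker_mul, smul_mul_assoc, mul_smul_comm,
    smul_smul, mul_zpow]
  refine Prod.ext ?_ (Prod.ext ?_ (Prod.ext ?_ (Prod.ext ?_ (Prod.ext ?_ (Prod.ext ?_ rfl))))) <;>
    simp only [mul_comm]

theorem linearForm_gaugeBlocks (g : MSSMGaugeGroup) : linearForm
    (gaugeBlocks g.1.1 (g.1.1.map star) g.2.1.1 g.2.2).toMatrix = g.transform := by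
  funext c
  rw [linearForm, sum_mssmComponent]
  cases c <;>
    simp [gaugeBlocks, MatterBlocks.toMatrix, MSSMGaugeGroup.transform, ite_mul, apply_ite C,
      Finset.sum_ite_irrel, Finset.sum_ite_eq, mul_assoc]

theorem mem_mssmInvariants (p : MvPolynomial MSSMComponent ℂ) : p ∈ MSSMInvariants ↔
    ∀ g : MSSMGaugeGroup,
      linSubst (gaugeBlocks g.1.1 (g.1.1.map star) g.2.1.1 g.2.2).toMatrix p = p := by
  simp only [MSSMInvariants, Algebra.mem_iInf, AlgHom.mem_equalizer, linSubst,
    linearForm_gaugeBlocks]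
  rfl

/-- The point of the maximal torus of `SL(3)` with coordinates `z₁`, `z₂`. -/
noncomputable def colourTorus (z₁ z₂ : ℂ) : Fin 3 → ℂ := ![z₁, z₂ / z₁, 1 / z₂]

/-- The point of the maximal torus of `SL(2)` with coordinate `y`. -/
noncomputable def isospinTorus (y : ℂ) : Fin 2 → ℂ := ![y, 1 / y]

theorem gaugeBlocks_torus {z₁ z₂ y ξ : ℂ} (h₁ : z₁ ≠ 0) (h₂ : z₂ ≠ 0) (hy : y ≠ 0) (hξ : ξ ≠ 0) :
    (gaugeBlocks (Matrix.diagonal (colourTorus z₁ z₂)) (Matrix.diagonal (colourTorus z₁ z₂)⁻¹)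
      (Matrix.diagonal (isospinTorus y)) ξ).toMatrix =
    Matrix.diagonal fun c => weightChar z₁ z₂ y ξ c.weight := by
  have hc : ∀ a, weightChar z₁ z₂ y ξ (colourWeight a) = colourTorus z₁ z₂ a := by
    intro a
    fin_cases a <;> simp [weightChar, colourWeight, colourTorus, div_eq_inv_mul]
  have hc' : ∀ a, weightChar z₁ z₂ y ξ (-colourWeight a) = (colourTorus z₁ z₂ a)⁻¹ := by
    intro a
    fin_cases a <;> simp [weightChar, colourWeight, colourTorus, div_eq_mul_inv]
  have hs : ∀ α, weightChar z₁ z₂ y ξ (isospinWeight α) = isospinTorus y α := by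
    intro a
    fin_cases a <;> simp [weightChar, isospinWeight, isospinTorus]
  have hk : ∀ k, weightChar z₁ z₂ y ξ (0, 0, 0, k) = ξ ^ k := by
    intro k; simp [weightChar]
  have hadd := weightChar_add h₁ h₂ hy hξ
  ext c c'
  rw [Matrix.diagonal_apply]
  cases c <;> cases c' <;>
    simp only [gaugeBlocks, MatterBlocks.toMatrix, MSSMComponent.weight, hadd, hc, hc', hs, hk,
      Matrix.smul_apply, Matrix.kronecker_apply, Matrix.diagonal_apply, smul_eq_mul,
      Pi.inv_apply, MSSMComponent.Q.injEq, MSSMComponent.u.injEq, MSSMComponent.d.injEq,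
      MSSMComponent.L.injEq, MSSMComponent.e.injEq, MSSMComponent.Hu.injEq,
      MSSMComponent.Hd.injEq, reduceCtorEq, if_false] <;>
    first
    | done
    | (split_ifs <;> (simp_all; try ring))

theorem gaugeBlocks_one : gaugeBlocks 1 1 1 1 = 1 := by
  simp [gaugeBlocks]

theorem linSubst_torus {z₁ z₂ y ξ : ℂ} (h₁ : z₁ ≠ 0) (h₂ : z₂ ≠ 0) (hy : y ≠ 0) (hξ : ξ ≠ 0)
    (p : MvPolynomial MSSMComponent ℂ) (a : MSSMComponent →₀ ℕ) :
    coeff a (linSubst (gaugeBlocks (Matrix.diagonal (colourTorus z₁ z₂))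
      (Matrix.diagonal (colourTorus z₁ z₂)⁻¹) (Matrix.diagonal (isospinTorus y)) ξ).toMatrix p) =
    weightChar z₁ z₂ y ξ (Finsupp.weight MSSMComponent.weight a) * coeff a p := by
  rw [gaugeBlocks_torus h₁ h₂ hy hξ, coeff_linSubst_diagonal, prod_weightChar h₁ h₂ hy hξ]

theorem linSubst_torus_of_weight_zero {z₁ z₂ y ξ : ℂ} (h₁ : z₁ ≠ 0) (h₂ : z₂ ≠ 0) (hy : y ≠ 0)
    (hξ : ξ ≠ 0) {p : MvPolynomial MSSMComponent ℂ}
    (hp : IsWeightedHomogeneous MSSMComponent.weight p 0) :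
    linSubst (gaugeBlocks (Matrix.diagonal (colourTorus z₁ z₂))
      (Matrix.diagonal (colourTorus z₁ z₂)⁻¹) (Matrix.diagonal (isospinTorus y)) ξ).toMatrix p =
    p := by
  ext a
  rw [linSubst_torus h₁ h₂ hy hξ]
  by_cases h : coeff a p = 0
  · simp [h]
  · rw [hp h, weightChar_zero, one_mul]

theorem colourTorus_one : colourTorus 1 1 = 1 := by
  ext a; fin_cases a <;> simp [colourTorus]

theorem isospinTorus_one : isospinTorus 1 = 1 := by
  ext a; fin_cases a <;> simp [isospinTorus]

theorem linDer_colourRep_of_mem {n : MSSMField →₀ ℕ} {v : multidegreePiece n}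
    (hv : v ∈ lieInvariants n) (i j : Fin 3) :
    linDer (colourRep (tracelessUnit 3 i j)).toMatrix (v : MvPolynomial MSSMComponent ℂ) = 0 := by
  have := ((mem_lieInvariants n v).mp hv).2.1 j i
  rw [colourOp] at this
  rw [← coe_blockOp n, this, Submodule.coe_zero]

theorem linDer_isospinRep_of_mem {n : MSSMField →₀ ℕ} {v : multidegreePiece n}
    (hv : v ∈ lieInvariants n) (i j : Fin 2) :
    linDer (isospinRep (tracelessUnit 2 i j)).toMatrix (v : MvPolynomial MSSMComponent ℂ) = 0 := by
  have := ((mem_lieInvariants n v).mp hv).2.2 j i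
  rw [isospinOp] at this
  rw [← coe_blockOp n, this, Submodule.coe_zero]

theorem weight_zero_of_mem {n : MSSMField →₀ ℕ} {v : multidegreePiece n}
    (hv : v ∈ lieInvariants n) :
    IsWeightedHomogeneous MSSMComponent.weight (v : MvPolynomial MSSMComponent ℂ) 0 := by
  rw [← ((mem_lieInvariants n v).mp hv).1, coe_weightProj]
  exact weightedHomogeneousComponent_isWeightedHomogeneous _ _

theorem tracelessUnit_of_ne {n : ℕ} {i j : Fin n} (h : i ≠ j) :
    tracelessUnit n i j = Matrix.single i j 1 := by simp [tracelessUnit, h]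

/-- Lie algebra invariants are invariant under `SL(3)`, since `SL(3)` is generated by its diagonal
matrices and the transvections. -/
theorem linSubst_colour_of_mem {n : MSSMField →₀ ℕ} {v : multidegreePiece n}
    (hv : v ∈ lieInvariants n) (A : Matrix (Fin 3) (Fin 3) ℂ) (hA : A.det = 1) :
    linSubst (gaugeBlocks A A⁻¹.transpose 1 1).toMatrix (v : MvPolynomial MSSMComponent ℂ) = v := by
  refine Matrix.diagonal_transvection_induction
    (fun A => linSubst (gaugeBlocks A A⁻¹.transpose 1 1).toMatrix
      (v : MvPolynomial MSSMComponent ℂ) = v) A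
    (fun D hD => ?_) (fun t => ?_) fun A B hA' hB' => ?_
  · rw [hA, Matrix.det_diagonal, Fin.prod_univ_three] at hD
    have h0 : D 0 ≠ 0 := fun h => by simp [h] at hD
    have h1 : D 1 ≠ 0 := fun h => by simp [h] at hD
    have hDt : D = colourTorus (D 0) (D 0 * D 1) := by
      ext a
      fin_cases a
      · rfl
      · simp [colourTorus, h0]
      · simpa [colourTorus] using (eq_inv_of_mul_eq_one_right hD)
    have hinv : (Matrix.diagonal D)⁻¹ = Matrix.diagonal D⁻¹ := by
      refine Matrix.inv_eq_left_inv ?_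
      rw [Matrix.diagonal_mul_diagonal, ← Matrix.diagonal_one]
      congr 1
      ext a
      have : D a ≠ 0 := by
        fin_cases a
        · exact h0
        · exact h1
        · exact fun h => by simp at h; simp [h] at hD
      simp [this]
    rw [hinv, Matrix.diagonal_transpose, hDt]
    have := linSubst_torus_of_weight_zero h0 (mul_ne_zero h0 h1) one_ne_zero one_ne_zero
      (weight_zero_of_mem hv)
    rwa [isospinTorus_one, Matrix.diagonal_one'] at this
  · obtain ⟨i, j, hij, c⟩ := t
    have hinv : (Matrix.transvection i j c)⁻¹ = Matrix.transvection i j (-c) := by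
      refine Matrix.inv_eq_left_inv ?_
      rw [Matrix.transvection_mul_transvection_same _ _ hij, neg_add_cancel,
        Matrix.transvection_zero]
    have hN : gaugeBlocks (Matrix.transvection i j c) (Matrix.transvection i j c)⁻¹.transpose 1 1 =
        1 + c • colourRep (tracelessUnit 3 i j) := by
      rw [hinv, tracelessUnit_of_ne hij]
      refine Prod.ext ?_ (Prod.ext ?_ (Prod.ext ?_ (Prod.ext ?_ (Prod.ext ?_
        (Prod.ext ?_ ?_))))) <;>
        simp [gaugeBlocks, colourRep, Matrix.transvection, Matrix.add_kronecker,
          ← Matrix.smul_kronecker, ← Matrix.single_neg]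
    have hsq : (colourRep (tracelessUnit 3 i j)).toMatrix *
        (colourRep (tracelessUnit 3 i j)).toMatrix = 0 := by
      rw [← MatterBlocks.toMatrix_mul, tracelessUnit_of_ne hij]
      have : colourRep (Matrix.single i j 1) * colourRep (Matrix.single i j 1) = (0 : ℂ) • 1 := by
        simp [colourRep, ← Matrix.mul_kronecker_mul, hij, hij.symm]
      rw [this, MatterBlocks.toMatrix_smul, zero_smul]
    change linSubst (gaugeBlocks (Matrix.transvection i j c)
      (Matrix.transvection i j c)⁻¹.transpose 1 1).toMatrix _ = _
    rw [hN, MatterBlocks.toMatrix_add, MatterBlocks.toMatrix_smul, MatterBlocks.toMatrix_one]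
    exact linSubst_one_add_smul hsq (linDer_colourRep_of_mem hv i j) c
  · have : gaugeBlocks (A * B) (A * B)⁻¹.transpose 1 1 =
        gaugeBlocks A A⁻¹.transpose 1 1 * gaugeBlocks B B⁻¹.transpose 1 1 := by
      rw [gaugeBlocks_mul, Matrix.mul_inv_rev, Matrix.transpose_mul, one_mul, one_mul]
    rw [this, MatterBlocks.toMatrix_mul, linSubst_mul, hA', hB']

/-- Lie algebra invariants are invariant under `SL(2)`. -/
theorem linSubst_isospin_of_mem {n : MSSMField →₀ ℕ} {v : multidegreePiece n}
    (hv : v ∈ lieInvariants n) (B : Matrix (Fin 2) (Fin 2) ℂ) (hB : B.det = 1) :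
    linSubst (gaugeBlocks 1 1 B 1).toMatrix (v : MvPolynomial MSSMComponent ℂ) = v := by
  refine Matrix.diagonal_transvection_induction (fun B => linSubst (gaugeBlocks 1 1 B 1).toMatrix
    (v : MvPolynomial MSSMComponent ℂ) = v) B
    (fun D hD => ?_) (fun t => ?_) fun A B hA' hB' => ?_
  · rw [hB, Matrix.det_diagonal, Fin.prod_univ_two] at hD
    have h0 : D 0 ≠ 0 := fun h => by simp [h] at hD
    have hDt : D = isospinTorus (D 0) := by
      ext a
      fin_cases a
      · rfl
      · simpa [isospinTorus] using (eq_inv_of_mul_eq_one_right hD)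
    rw [hDt]
    have := linSubst_torus_of_weight_zero one_ne_zero one_ne_zero h0 one_ne_zero
      (weight_zero_of_mem hv)
    rwa [colourTorus_one, inv_one, Matrix.diagonal_one'] at this
  · obtain ⟨i, j, hij, c⟩ := t
    have hN : gaugeBlocks 1 1 (Matrix.transvection i j c) 1 =
        1 + c • isospinRep (tracelessUnit 2 i j) := by
      rw [tracelessUnit_of_ne hij]
      refine Prod.ext ?_ (Prod.ext ?_ (Prod.ext ?_ (Prod.ext ?_ (Prod.ext ?_
        (Prod.ext ?_ ?_))))) <;>
        simp [gaugeBlocks, isospinRep, Matrix.transvection, Matrix.kronecker_add,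
          ← Matrix.kronecker_smul]
    have hsq : (isospinRep (tracelessUnit 2 i j)).toMatrix *
        (isospinRep (tracelessUnit 2 i j)).toMatrix = 0 := by
      rw [← MatterBlocks.toMatrix_mul, tracelessUnit_of_ne hij]
      have : isospinRep (Matrix.single i j 1) * isospinRep (Matrix.single i j 1) = (0 : ℂ) • 1 := by
        simp [isospinRep, ← Matrix.mul_kronecker_mul, hij.symm]
      rw [this, MatterBlocks.toMatrix_smul, zero_smul]
    change linSubst (gaugeBlocks 1 1 (Matrix.transvection i j c) 1).toMatrix _ = _
    rw [hN, MatterBlocks.toMatrix_add, MatterBlocks.toMatrix_smul, MatterBlocks.toMatrix_one]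
    exact linSubst_one_add_smul hsq (linDer_isospinRep_of_mem hv i j) c
  · have : gaugeBlocks 1 1 (A * B) 1 = gaugeBlocks 1 1 A 1 * gaugeBlocks 1 1 B 1 := by
      rw [gaugeBlocks_mul, one_mul, one_mul]
    rw [this, MatterBlocks.toMatrix_mul, linSubst_mul, hA', hB']

/-- A gauge transformation is the product of elements of `SL(3)`, of `SL(2)` and of `U(1)`; the last
factor belongs to the torus. -/
theorem mem_mssmInvariants_of_mem_lieInvariants {n : MSSMField →₀ ℕ} {v : multidegreePiece n}
    (hv : v ∈ lieInvariants n) : (v : MvPolynomial MSSMComponent ℂ) ∈ MSSMInvariants := by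
  rw [mem_mssmInvariants]
  rintro ⟨⟨A, hA⟩, ⟨B, hB⟩, w⟩
  rw [Matrix.mem_specialUnitaryGroup_iff] at hA hB
  have hA' : A.map star = A⁻¹.transpose := by
    have h1 : A⁻¹ = star A := Matrix.inv_eq_left_inv (Matrix.mem_unitaryGroup_iff'.mp hA.1)
    rw [h1, Matrix.star_eq_conjTranspose, Matrix.conjTranspose, Matrix.transpose_map,
      Matrix.transpose_transpose]
  have hsplit : gaugeBlocks A (A.map star) B w = gaugeBlocks A A⁻¹.transpose 1 1 *
      (gaugeBlocks 1 1 B 1 * gaugeBlocks 1 1 1 w) := by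
    simp only [gaugeBlocks_mul, hA', mul_one, one_mul]
  have hw := linSubst_torus_of_weight_zero one_ne_zero one_ne_zero one_ne_zero
    (Circle.coe_ne_zero w) (weight_zero_of_mem hv)
  rw [colourTorus_one, inv_one, isospinTorus_one, Matrix.diagonal_one', Matrix.diagonal_one'] at hw
  change linSubst (gaugeBlocks A (A.map star) B w).toMatrix _ = _
  rw [hsplit, MatterBlocks.toMatrix_mul, MatterBlocks.toMatrix_mul, linSubst_mul, linSubst_mul,
    linSubst_colour_of_mem hv A hA.2, linSubst_isospin_of_mem hv B hB.2, hw]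

theorem eq_zero_of_forall_zpow_eq_one {k : ℤ} (h : ∀ w : ℂ, ‖w‖ = 1 → w ^ k = 1) : k = 0 := by
  by_contra hk
  have h1 := h (Complex.exp ((Real.pi / k : ℝ) * Complex.I)) (Complex.norm_exp_ofReal_mul_I _)
  rw [← Complex.exp_int_mul] at h1
  have h2 : (k : ℂ) * ((Real.pi / k : ℝ) * Complex.I) = Real.pi * Complex.I := by
    have : (k : ℂ) ≠ 0 := by exact_mod_cast hk
    push_cast
    field_simp
  rw [h2, Complex.exp_pi_mul_I] at h1
  norm_num at h1

theorem diagonal_mem_specialUnitaryGroup {m : Type*} [Fintype m] [DecidableEq m] {d : m → ℂ}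
    (h1 : ∀ i, ‖d i‖ = 1) (h2 : ∏ i, d i = 1) :
    Matrix.diagonal d ∈ Matrix.specialUnitaryGroup m ℂ := by
  rw [Matrix.mem_specialUnitaryGroup_iff, Matrix.det_diagonal, Matrix.mem_unitaryGroup_iff]
  refine ⟨?_, h2⟩
  rw [Matrix.star_eq_conjTranspose, Matrix.diagonal_conjTranspose, Matrix.diagonal_mul_diagonal,
    ← Matrix.diagonal_one]
  congr 1
  ext i
  rw [Pi.star_apply, Complex.star_def, Complex.mul_conj, Complex.normSq_eq_norm_sq, h1]
  simp

/-- Invariance under the maximal torus forces weight zero. -/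
theorem weight_zero_of_mem_mssmInvariants {p : MvPolynomial MSSMComponent ℂ}
    (hp : p ∈ MSSMInvariants) : IsWeightedHomogeneous MSSMComponent.weight p 0 := by
  rw [mem_mssmInvariants] at hp
  have key : ∀ z₁ z₂ y ξ : ℂ, ‖z₁‖ = 1 → ‖z₂‖ = 1 → ‖y‖ = 1 → ‖ξ‖ = 1 → ∀ a, coeff a p ≠ 0 →
      weightChar z₁ z₂ y ξ (Finsupp.weight MSSMComponent.weight a) = 1 := by
    intro z₁ z₂ y ξ h₁ h₂ hy hξ a ha
    have n₁ : z₁ ≠ 0 := fun h => by simp [h] at h₁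
    have n₂ : z₂ ≠ 0 := fun h => by simp [h] at h₂
    have ny : y ≠ 0 := fun h => by simp [h] at hy
    have nξ : ξ ≠ 0 := fun h => by simp [h] at hξ
    have hc : ∀ i, ‖colourTorus z₁ z₂ i‖ = 1 := by
      intro i; fin_cases i <;> simp [colourTorus, h₁, h₂]
    have hs : ∀ i, ‖isospinTorus y i‖ = 1 := by
      intro i; fin_cases i <;> simp [isospinTorus, hy]
    have hmap : (Matrix.diagonal (colourTorus z₁ z₂)).map star =
        Matrix.diagonal (colourTorus z₁ z₂)⁻¹ := by
      rw [Matrix.diagonal_map (by simp)]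
      congr 1
      ext i
      rw [Pi.inv_apply, Complex.inv_eq_conj (hc i)]
      rfl
    have h := hp (⟨_, diagonal_mem_specialUnitaryGroup hc (by
        simp [Fin.prod_univ_three, colourTorus]; field_simp)⟩,
      ⟨_, diagonal_mem_specialUnitaryGroup hs (by
        simp [isospinTorus, ny])⟩, ⟨ξ, mem_sphere_zero_iff_norm.mpr hξ⟩)
    simp only [hmap] at h
    have h2 := congrArg (coeff a) h
    rw [linSubst_torus n₁ n₂ ny nξ] at h2
    exact mul_right_cancel₀ ha (by rw [h2, one_mul])
  intro a ha
  refine Prod.ext ?_ (Prod.ext ?_ (Prod.ext ?_ ?_)) <;>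
    refine eq_zero_of_forall_zpow_eq_one fun w hw => ?_
  · simpa [weightChar] using key w 1 1 1 hw (by simp) (by simp) (by simp) a ha
  · simpa [weightChar] using key 1 w 1 1 (by simp) hw (by simp) (by simp) a ha
  · simpa [weightChar] using key 1 1 w 1 (by simp) (by simp) hw (by simp) a ha
  · simpa [weightChar] using key 1 1 1 w (by simp) (by simp) (by simp) hw a ha

/-- The tangent vector of a curve in `SO(3)` through the identity annihilates the invariants. On
real matrices the triplets and the antitriplets transform in the same way, so that the curve acts
by matrices depending analytically on its parameter. -/
theorem linDer_colourRep_of_curve {p : MvPolynomial MSSMComponent ℂ} (hp : p ∈ MSSMInvariants)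
    {R : ℂ → Matrix (Fin 3) (Fin 3) ℂ} {N : Matrix (Fin 3) (Fin 3) ℂ} (h1 : R 0 = 1)
    (hR : ∀ a b, HasDerivAt (fun s => R s a b) (N a b) 0) (hN : N.transpose = -N)
    (hU : ∀ s : ℝ, R s ∈ Matrix.specialUnitaryGroup (Fin 3) ℂ)
    (hreal : ∀ s : ℝ, (R s).map star = R s) :
    linDer (colourRep N).toMatrix p = 0 := by
  rw [mem_mssmInvariants] at hp
  refine linDer_eq_zero_of_invariant (G := fun s => (gaugeBlocks (R s) (R s) 1 1).toMatrix)
    ?_ ?_ fun s => ?_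
  · rw [h1, gaugeBlocks_one, MatterBlocks.toMatrix_one]
  · intro c c'
    cases c <;> cases c' <;>
      simp only [gaugeBlocks, MatterBlocks.toMatrix, colourRep, hN, neg_neg, Matrix.kronecker_apply,
        one_smul, one_zpow, Matrix.zero_apply, ite_self] <;>
      first
      | exact hasDerivAt_const _ _
      | (split_ifs
         · first
           | exact (hR _ _).mul_const _
           | exact hR _ _
         · exact hasDerivAt_const _ _)
  · have := hp (⟨R s, hU s⟩, 1, 1)
    simpa only [hreal, Circle.coe_one, OneMemClass.coe_one] using this

theorem linDer_isospinRep_of_curve {p : MvPolynomial MSSMComponent ℂ} (hp : p ∈ MSSMInvariants)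
    {R : ℂ → Matrix (Fin 2) (Fin 2) ℂ} {N : Matrix (Fin 2) (Fin 2) ℂ} (h1 : R 0 = 1)
    (hR : ∀ a b, HasDerivAt (fun s => R s a b) (N a b) 0)
    (hU : ∀ s : ℝ, R s ∈ Matrix.specialUnitaryGroup (Fin 2) ℂ) :
    linDer (isospinRep N).toMatrix p = 0 := by
  rw [mem_mssmInvariants] at hp
  refine linDer_eq_zero_of_invariant (G := fun s => (gaugeBlocks 1 1 (R s) 1).toMatrix)
    ?_ ?_ fun s => ?_
  · rw [h1, gaugeBlocks_one, MatterBlocks.toMatrix_one]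
  · intro c c'
    cases c <;> cases c' <;>
      simp only [gaugeBlocks, MatterBlocks.toMatrix, isospinRep, Matrix.kronecker_apply,
        one_smul, one_zpow, Matrix.zero_apply, ite_self] <;>
      first
      | exact hasDerivAt_const _ _
      | exact hR _ _
      | (split_ifs
         · first
           | exact (hR _ _).const_mul _
           | exact hR _ _
         · exact hasDerivAt_const _ _)
  · have := hp (1, ⟨R s, hU s⟩, 1)
    have h1 : (1 : Matrix (Fin 3) (Fin 3) ℂ).map star = 1 := Matrix.map_one _ (by simp) (by simp)
    simpa only [h1, Circle.coe_one, OneMemClass.coe_one] using this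

/-- The rotation by the angle `s` in the plane of the first two coordinates. -/
noncomputable def rotation₀₁ (s : ℂ) : Matrix (Fin 3) (Fin 3) ℂ :=
  !![Complex.cos s, Complex.sin s, 0; -Complex.sin s, Complex.cos s, 0; 0, 0, 1]

/-- The rotation by the angle `s` in the plane of the last two coordinates. -/
noncomputable def rotation₁₂ (s : ℂ) : Matrix (Fin 3) (Fin 3) ℂ :=
  !![1, 0, 0; 0, Complex.cos s, Complex.sin s; 0, -Complex.sin s, Complex.cos s]

/-- The rotation of the plane by the angle `s`. -/
noncomputable def rotation₂ (s : ℂ) : Matrix (Fin 2) (Fin 2) ℂ :=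
  !![Complex.cos s, Complex.sin s; -Complex.sin s, Complex.cos s]

theorem mem_specialUnitaryGroup_of_real {m : Type*} [Fintype m] [DecidableEq m]
    {A : Matrix m m ℂ} (h1 : A.map star = A) (h2 : A * A.transpose = 1) (h3 : A.det = 1) :
    A ∈ Matrix.specialUnitaryGroup m ℂ := by
  rw [Matrix.mem_specialUnitaryGroup_iff, Matrix.mem_unitaryGroup_iff, Matrix.star_eq_conjTranspose,
    Matrix.conjTranspose, Matrix.transpose_map, h1]
  exact ⟨h2, h3⟩

theorem hasDerivAt_cos_zero : HasDerivAt Complex.cos 0 0 := by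
  simpa using Complex.hasDerivAt_cos 0

theorem hasDerivAt_sin_zero : HasDerivAt Complex.sin 1 0 := by
  simpa using Complex.hasDerivAt_sin 0

theorem linDer_rotation₀₁ {p : MvPolynomial MSSMComponent ℂ} (hp : p ∈ MSSMInvariants) :
    linDer (colourRep (tracelessUnit 3 0 1 - tracelessUnit 3 1 0)).toMatrix p = 0 := by
  rw [tracelessUnit_of_ne (by decide), tracelessUnit_of_ne (by decide)]
  have hreal : ∀ s : ℝ, (rotation₀₁ s).map star = rotation₀₁ s := by
    intro s
    ext a b
    fin_cases a <;> fin_cases b <;>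
      simp [rotation₀₁, ← Complex.cos_conj, ← Complex.sin_conj]
  refine linDer_colourRep_of_curve hp (R := rotation₀₁) ?_ ?_ ?_
    (fun s => mem_specialUnitaryGroup_of_real (hreal s) ?_ ?_) hreal
  · ext a b; fin_cases a <;> fin_cases b <;> simp [rotation₀₁]
  · intro a b
    fin_cases a <;> fin_cases b <;>
      simp [rotation₀₁, hasDerivAt_const, hasDerivAt_cos_zero,
        hasDerivAt_sin_zero, hasDerivAt_sin_zero.fun_neg]
  · simp
  · ext a b
    have := Complex.sin_sq_add_cos_sq s
    fin_cases a <;> fin_cases b <;> simp [rotation₀₁, Matrix.mul_apply, Fin.sum_univ_three] <;>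
      first | linear_combination this | ring
  · have := Complex.sin_sq_add_cos_sq s
    simp [rotation₀₁, Matrix.det_fin_three]
    linear_combination this

theorem linDer_rotation₁₂ {p : MvPolynomial MSSMComponent ℂ} (hp : p ∈ MSSMInvariants) :
    linDer (colourRep (tracelessUnit 3 1 2 - tracelessUnit 3 2 1)).toMatrix p = 0 := by
  rw [tracelessUnit_of_ne (by decide), tracelessUnit_of_ne (by decide)]
  have hreal : ∀ s : ℝ, (rotation₁₂ s).map star = rotation₁₂ s := by
    intro s
    ext a b
    fin_cases a <;> fin_cases b <;>
      simp [rotation₁₂, ← Complex.cos_conj, ← Complex.sin_conj]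
  refine linDer_colourRep_of_curve hp (R := rotation₁₂) ?_ ?_ ?_
    (fun s => mem_specialUnitaryGroup_of_real (hreal s) ?_ ?_) hreal
  · ext a b; fin_cases a <;> fin_cases b <;> simp [rotation₁₂]
  · intro a b
    fin_cases a <;> fin_cases b <;>
      simp [rotation₁₂, hasDerivAt_const, hasDerivAt_cos_zero,
        hasDerivAt_sin_zero, hasDerivAt_sin_zero.fun_neg]
  · simp
  · ext a b
    have := Complex.sin_sq_add_cos_sq s
    fin_cases a <;> fin_cases b <;> simp [rotation₁₂, Matrix.mul_apply, Fin.sum_univ_three] <;>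
      first | linear_combination this | ring
  · have := Complex.sin_sq_add_cos_sq s
    simp [rotation₁₂, Matrix.det_fin_three]
    linear_combination this

theorem linDer_rotation₂ {p : MvPolynomial MSSMComponent ℂ} (hp : p ∈ MSSMInvariants) :
    linDer (isospinRep (tracelessUnit 2 0 1 - tracelessUnit 2 1 0)).toMatrix p = 0 := by
  rw [tracelessUnit_of_ne (by decide), tracelessUnit_of_ne (by decide)]
  have hreal : ∀ s : ℝ, (rotation₂ s).map star = rotation₂ s := by
    intro s
    ext a b
    fin_cases a <;> fin_cases b <;>
      simp [rotation₂, ← Complex.cos_conj, ← Complex.sin_conj]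
  refine linDer_isospinRep_of_curve hp (R := rotation₂) ?_ ?_
    (fun s => mem_specialUnitaryGroup_of_real (hreal s) ?_ ?_)
  · ext a b; fin_cases a <;> fin_cases b <;> simp [rotation₂]
  · intro a b
    fin_cases a <;> fin_cases b <;>
      simp [rotation₂, hasDerivAt_cos_zero,
        hasDerivAt_sin_zero, hasDerivAt_sin_zero.fun_neg]
  · ext a b
    have := Complex.sin_sq_add_cos_sq s
    fin_cases a <;> fin_cases b <;> simp [rotation₂, Matrix.mul_apply, Fin.sum_univ_two] <;>
      first | linear_combination this | ring
  · have := Complex.sin_sq_add_cos_sq s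
    simp [rotation₂, Matrix.det_fin_two]
    linear_combination this

/-- If two operators of different weights agree on a vector of weight zero, both annihilate it. -/
theorem eq_zero_of_weights_ne {n : MSSMField →₀ ℕ} {S T : Module.End ℂ (multidegreePiece n)}
    {α β : MSSMWeight} (hS : weightProj n (0 + α) * S = S * weightProj n 0)
    (hT : weightProj n (0 + β) * T = T * weightProj n 0) (hαβ : α ≠ β) {v : multidegreePiece n}
    (hv : weightProj n 0 v = v) (h : S v = T v) : S v = 0 ∧ T v = 0 := by
  rw [zero_add] at hS hT
  have h1 : weightProj n α (S v) = S v := by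
    rw [← Module.End.mul_apply, hS, Module.End.mul_apply, hv]
  have h2 : weightProj n β (T v) = T v := by
    rw [← Module.End.mul_apply, hT, Module.End.mul_apply, hv]
  have h3 : weightProj n α (weightProj n β (T v)) = 0 := by
    refine Subtype.ext ?_
    rw [coe_weightProj, coe_weightProj]
    exact (weightedHomogeneousComponent_isWeightedHomogeneous β _).weightedHomogeneousComponent_ne
      α hαβ
  have h4 : S v = 0 := by rw [← h1, h, ← h2, h3]
  exact ⟨h4, h ▸ h4⟩

/-- The invariants of the Lie algebra are the gauge invariants. Conversely to
`mem_mssmInvariants_of_mem_lieInvariants`, a gauge invariant is killed by the antisymmetric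
combinations `E_ij - E_ji` of simple root vectors, since rotations are gauge transformations. As it
has weight zero, the two terms have different weights and vanish separately. -/
theorem mem_lieInvariants_iff (n : MSSMField →₀ ℕ) (v : multidegreePiece n) :
    v ∈ lieInvariants n ↔ (v : MvPolynomial MSSMComponent ℂ) ∈ MSSMInvariants := by
  refine ⟨mem_mssmInvariants_of_mem_lieInvariants, fun h => ?_⟩
  have hv : weightProj n 0 v = v :=
    Subtype.ext (weight_zero_of_mem_mssmInvariants h).weightedHomogeneousComponent_same
  have hz : ∀ b : MatterBlocks, linDer b.toMatrix (v : MvPolynomial MSSMComponent ℂ) = 0 →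
      blockOp n b v = 0 := fun b hb => Subtype.ext hb
  have c01 := hz _ (linDer_rotation₀₁ h)
  have c12 := hz _ (linDer_rotation₁₂ h)
  have s01 := hz _ (linDer_rotation₂ h)
  rw [colourRep_sub, blockOp_sub] at c01 c12
  rw [isospinRep_sub, blockOp_sub] at s01
  obtain ⟨h10, h01⟩ := eq_zero_of_weights_ne (weightProj_mul_colourOp n 1 0 0)
    (weightProj_mul_colourOp n 0 1 0) (by simp [colourWeight]) hv (sub_eq_zero.mp c01)
  obtain ⟨h21, h12⟩ := eq_zero_of_weights_ne (weightProj_mul_colourOp n 2 1 0)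
    (weightProj_mul_colourOp n 1 2 0) (by simp [colourWeight]) hv (sub_eq_zero.mp c12)
  obtain ⟨i10, i01⟩ := eq_zero_of_weights_ne (weightProj_mul_isospinOp n 1 0 0)
    (weightProj_mul_isospinOp n 0 1 0) (by simp [isospinWeight]) hv (sub_eq_zero.mp s01)
  have hdiag : ∀ i, colourOp n i i v = 0 := by
    intro i
    have h1 := weightProj_mul_colourOp n i i 0
    rw [sub_self, add_zero, weightProj_mul_colourOp_diag, map_zero] at h1
    have h2 := LinearMap.congr_fun h1 v
    rw [Module.End.mul_apply, hv] at h2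
    rw [← h2, LinearMap.smul_apply, zero_smul]
  have idiag : ∀ i, isospinOp n i i v = 0 := by
    intro i
    have h1 := weightProj_mul_isospinOp n i i 0
    rw [sub_self, add_zero, weightProj_mul_isospinOp_diag, map_zero] at h1
    have h2 := LinearMap.congr_fun h1 v
    rw [Module.End.mul_apply, hv] at h2
    rw [← h2, LinearMap.smul_apply, zero_smul]
  have h02 : colourOp n 0 2 v = 0 := by
    have h1 := LinearMap.congr_fun (isGLFamily_colourOp n 0 1 1 2) v
    rw [if_pos rfl, if_neg (by decide)] at h1
    simpa [h01, h12, eq_comm] using h1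
  have h20 : colourOp n 2 0 v = 0 := by
    have h1 := LinearMap.congr_fun (isGLFamily_colourOp n 2 1 1 0) v
    rw [if_pos rfl, if_neg (by decide)] at h1
    simpa [h10, h21, eq_comm] using h1
  rw [mem_lieInvariants]
  refine ⟨hv, fun i j => ?_, fun i j => ?_⟩
  · match i, j with
    | 0, 0 => exact hdiag 0
    | 0, 1 => exact h01
    | 0, 2 => exact h02
    | 1, 0 => exact h10
    | 1, 1 => exact hdiag 1
    | 1, 2 => exact h12
    | 2, 0 => exact h20
    | 2, 1 => exact h21
    | 2, 2 => exact hdiag 2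
  · match i, j with
    | 0, 0 => exact idiag 0
    | 0, 1 => exact i01
    | 1, 0 => exact i10
    | 1, 1 => exact idiag 1

end GaugeInvariance

/-! ### The coordinate ring of the vacuum moduli space -/

section ModuliSpace

open MvPolynomial

/-- Without superpotential, eliminating the scalar fields leaves the ideal of relations among the
polynomials `r j`. -/
theorem moduliIdeal_zero {Φ J : Type*} (r : J → MvPolynomial Φ ℂ) :
    moduliIdeal 0 r = RingHom.ker (aeval r : MvPolynomial J ℂ →ₐ[ℂ] MvPolynomial Φ ℂ) := by
  -- substituting `r j` for `y j` kills the ideal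
  let ψ : MvPolynomial (Φ ⊕ J) ℂ →ₐ[ℂ] MvPolynomial Φ ℂ := aeval (Sum.elim X r)
  have hψ : vacuumIdeal 0 r ≤ RingHom.ker ψ := by
    refine Ideal.span_le.mpr ?_
    rintro _ (⟨i, rfl⟩ | ⟨j, rfl⟩)
    · simp
    · have : ψ (rename Sum.inl (r j)) = r j := by
        simp only [ψ, aeval_rename, Sum.elim_comp_inl, aeval_X_left_apply]
      simp [ψ, RingHom.mem_ker] at this ⊢
      rw [this, sub_self]
  have hr : ∀ q, ψ (rename Sum.inr q) = aeval r q := by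
    intro q
    simp only [ψ, aeval_rename, Sum.elim_comp_inr]
  -- modulo the ideal, every polynomial in the `y j` is the polynomial obtained by substitution
  have hmod : ∀ q, rename Sum.inr q - rename Sum.inl (aeval r q) ∈ vacuumIdeal 0 r := by
    intro q
    rw [← Ideal.Quotient.eq]
    have : (Ideal.Quotient.mkₐ ℂ (vacuumIdeal 0 r)).comp (rename Sum.inr) =
        (Ideal.Quotient.mkₐ ℂ (vacuumIdeal 0 r)).comp ((rename Sum.inl).comp (aeval r)) := by
      apply MvPolynomial.algHom_ext
      intro j
      simp only [AlgHom.comp_apply, rename_X, aeval_X]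
      exact Ideal.Quotient.eq.mpr (Ideal.subset_span (Or.inr ⟨j, rfl⟩))
    exact AlgHom.congr_fun this q
  ext q
  rw [moduliIdeal, Ideal.mem_comap, RingHom.mem_ker]
  constructor
  · intro h
    have h1 : ψ (rename Sum.inr q) = 0 := hψ h
    rw [← hr, h1]
  · intro h
    have h1 := hmod q
    rwa [h, map_zero, sub_zero] at h1

/-- The evaluation of the coordinates of the moduli space at the generators. -/
noncomputable def moduliEval {Φ J : Type*} (r : J → MvPolynomial Φ ℂ) :
    ModuliRing (0 : MvPolynomial Φ ℂ) r →ₐ[ℂ] MvPolynomial Φ ℂ :=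
  Ideal.Quotient.liftₐ (moduliIdeal 0 r) (aeval r) fun q hq => by
    rwa [moduliIdeal_zero, RingHom.mem_ker] at hq

theorem moduliEval_mk {Φ J : Type*} (r : J → MvPolynomial Φ ℂ) (q : MvPolynomial J ℂ) :
    moduliEval r (Ideal.Quotient.mkₐ ℂ (moduliIdeal 0 r) q) = aeval r q := by
  rw [moduliEval]
  exact Ideal.Quotient.liftₐ_apply _ _ _ _

theorem moduliEval_injective {Φ J : Type*} (r : J → MvPolynomial Φ ℂ) :
    Function.Injective (moduliEval r) := by
  rw [injective_iff_map_eq_zero]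
  intro x hx
  obtain ⟨q, rfl⟩ := Ideal.Quotient.mkₐ_surjective ℂ _ x
  rw [moduliEval_mk] at hx
  refine Ideal.Quotient.eq_zero_iff_mem.mpr ?_
  rwa [moduliIdeal_zero, RingHom.mem_ker]

/-- Substituting weighted homogeneous polynomials preserves weighted homogeneity. -/
theorem isWeightedHomogeneous_aeval {Φ J Λ : Type*} [AddCommMonoid Λ] {w : Φ → Λ} {δ : J → Λ}
    {r : J → MvPolynomial Φ ℂ} (hr : ∀ j, IsWeightedHomogeneous w (r j) (δ j)) {n : Λ}
    {q : MvPolynomial J ℂ} (hq : IsWeightedHomogeneous δ q n) :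
    IsWeightedHomogeneous w (aeval r q) n := by
  rw [aeval_def, eval₂_eq]
  refine IsWeightedHomogeneous.sum _ _ _ fun d hd => ?_
  rw [algebraMap_eq]
  refine IsWeightedHomogeneous.C_mul ?_ _
  have := IsWeightedHomogeneous.prod d.support (fun j => r j ^ d j) (fun j => d j • δ j)
    fun j _ => (hr j).pow (d j)
  rwa [← hq (mem_support_iff.mp hd), Finsupp.weight_apply]

theorem map_moduliPiece {J : Type*} {r : J → MvPolynomial MSSMComponent ℂ}
    {δ : J → MSSMField →₀ ℕ} (hr : IsMSSMGeneratingSystem r δ) (n : MSSMField →₀ ℕ) :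
    (moduliPiece 0 r δ n).map (moduliEval r).toLinearMap =
      multidegreePiece n ⊓ Subalgebra.toSubmodule MSSMInvariants := by
  ext p
  rw [moduliPiece, ← Submodule.map_comp, Submodule.mem_map, Submodule.mem_inf]
  have hrange : ∀ p, p ∈ MSSMInvariants ↔ ∃ q : MvPolynomial J ℂ, aeval r q = p := by
    intro p
    rw [← hr.adjoin_eq, Algebra.adjoin_range_eq_range_aeval]
    rfl
  constructor
  · rintro ⟨q, hq, rfl⟩
    rw [LinearMap.comp_apply, AlgHom.toLinearMap_apply, AlgHom.toLinearMap_apply, moduliEval_mk]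
    exact ⟨isWeightedHomogeneous_aeval hr.homogeneous hq, (hrange _).mpr ⟨q, rfl⟩⟩
  · rintro ⟨h1, h2⟩
    obtain ⟨q, rfl⟩ := (hrange p).mp h2
    refine ⟨weightedHomogeneousComponent δ n q,
      weightedHomogeneousComponent_isWeightedHomogeneous n q, ?_⟩
    rw [LinearMap.comp_apply, AlgHom.toLinearMap_apply, AlgHom.toLinearMap_apply, moduliEval_mk]
    -- compare the components of multidegree `n`
    have hcomp : ∀ q : MvPolynomial J ℂ, weightedHomogeneousComponent MSSMComponent.degree n
        (aeval r q) = aeval r (weightedHomogeneousComponent δ n q) := by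
      intro q
      induction q using MvPolynomial.induction_on' with
      | add p q hp hq => simp only [map_add, hp, hq]
      | monomial a x =>
        have h1 := isWeightedHomogeneous_monomial δ a x (m := _) rfl
        have h2 := isWeightedHomogeneous_aeval hr.homogeneous h1
        by_cases h : Finsupp.weight δ a = n
        · rw [← h, h2.weightedHomogeneousComponent_same, h1.weightedHomogeneousComponent_same]
        · rw [h2.weightedHomogeneousComponent_ne _ (Ne.symm h),
            h1.weightedHomogeneousComponent_ne _ (Ne.symm h), map_zero]
    rw [← hcomp]
    exact IsWeightedHomogeneous.weightedHomogeneousComponent_same h1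

/-- The graded pieces of the coordinate ring of the moduli space are the spaces of invariants. -/
theorem finrank_moduliPiece {J : Type*} {r : J → MvPolynomial MSSMComponent ℂ}
    {δ : J → MSSMField →₀ ℕ} (hr : IsMSSMGeneratingSystem r δ) (n : MSSMField →₀ ℕ) :
    Module.Finite ℂ (moduliPiece 0 r δ n) ∧
      Module.finrank ℂ (moduliPiece 0 r δ n) = Module.finrank ℂ (lieInvariants n) := by
  let e₁ := Submodule.equivMapOfInjective (moduliEval r).toLinearMap (moduliEval_injective r)
    (moduliPiece 0 r δ n)
  let e₂ := LinearEquiv.ofEq _ _ (map_moduliPiece hr n)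
  let e₃ := Submodule.comapSubtypeEquivOfLe
    (inf_le_left : multidegreePiece n ⊓ Subalgebra.toSubmodule MSSMInvariants ≤ multidegreePiece n)
  have h : lieInvariants n = Submodule.comap (multidegreePiece n).subtype
      (multidegreePiece n ⊓ Subalgebra.toSubmodule MSSMInvariants) := by
    ext v
    rw [mem_lieInvariants_iff]
    exact ⟨fun h => ⟨v.2, h⟩, fun h => h.2⟩
  let e := ((LinearEquiv.ofEq _ _ h).trans e₃).trans (e₁.trans e₂).symm
  have hfin : Module.Finite ℂ (lieInvariants n) := inferInstance
  exact ⟨Module.Finite.equiv e, e.finrank_eq.symm⟩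

end ModuliSpace

/-! ### The integrand -/

section Integrand

theorem weightChar_pow (z₁ z₂ y ξ : ℂ) (k : ℕ) (μ : MSSMWeight) :
    weightChar (z₁ ^ k) (z₂ ^ k) (y ^ k) (ξ ^ k) μ = weightChar z₁ z₂ y ξ μ ^ k := by
  have h : ∀ (z : ℂ) (m : ℤ), (z ^ k) ^ m = (z ^ m) ^ k := by
    intro z m
    rw [← zpow_natCast, ← zpow_natCast, ← zpow_mul, ← zpow_mul, mul_comm]
  simp only [weightChar, h, mul_pow]

theorem norm_weightChar {z₁ z₂ y ξ : ℂ} (h₁ : ‖z₁‖ = 1) (h₂ : ‖z₂‖ = 1) (hy : ‖y‖ = 1)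
    (hξ : ‖ξ‖ = 1) (μ : MSSMWeight) : ‖weightChar z₁ z₂ y ξ μ‖ = 1 := by
  simp [weightChar, h₁, h₂, hy, hξ]

theorem mssmCharacterSum_eq (t : MSSMField → ℂ) (ξ y z₁ z₂ : ℂ) :
    mssmCharacterSum t ξ y z₁ z₂ =
      ∑ c : MSSMComponent, t c.field * weightChar z₁ z₂ y ξ c.weight := by
  rw [sum_mssmComponent, mssmCharacterSum]
  simp only [Finset.sum_add_distrib, ← add_assoc]
  have hQ : ∀ i, ∑ a, ∑ α, t (MSSMComponent.Q i a α).field *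
      weightChar z₁ z₂ y ξ (MSSMComponent.Q i a α).weight =
      t (.Q i) * (ξ * (y + 1 / y) * (z₁ + 1 / z₂ + z₂ / z₁)) := by
    intro i
    simp [Fin.sum_univ_three, MSSMComponent.field, MSSMComponent.weight, weightChar,
      colourWeight, isospinWeight]
    ring
  have hu : ∀ i, ∑ a, t (MSSMComponent.u i a).field *
      weightChar z₁ z₂ y ξ (MSSMComponent.u i a).weight =
      t (.u i) * (1 / ξ ^ 4 * (z₁ / z₂ + z₂ + 1 / z₁)) := by
    intro i
    simp [Fin.sum_univ_three, MSSMComponent.field, MSSMComponent.weight, weightChar,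
      colourWeight]
    ring
  have hd : ∀ i, ∑ a, t (MSSMComponent.d i a).field *
      weightChar z₁ z₂ y ξ (MSSMComponent.d i a).weight =
      t (.d i) * (ξ ^ 2 * (z₁ / z₂ + z₂ + 1 / z₁)) := by
    intro i
    simp [Fin.sum_univ_three, MSSMComponent.field, MSSMComponent.weight, weightChar,
      colourWeight]
    ring
  have hL : ∀ i, ∑ α, t (MSSMComponent.L i α).field *
      weightChar z₁ z₂ y ξ (MSSMComponent.L i α).weight =
      t (.L i) * (1 / ξ ^ 3 * (y + 1 / y)) := by
    intro i
    simp [MSSMComponent.field, MSSMComponent.weight, weightChar, isospinWeight]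
    ring
  have he : ∀ i, t (MSSMComponent.e i).field *
      weightChar z₁ z₂ y ξ (MSSMComponent.e i).weight = t (.e i) * ξ ^ 6 := by
    intro i
    simp [MSSMComponent.field, MSSMComponent.weight, weightChar]
  have hHu : ∑ α, t (MSSMComponent.Hu α).field *
      weightChar z₁ z₂ y ξ (MSSMComponent.Hu α).weight = t .Hu * (ξ ^ 3 * (y + 1 / y)) := by
    simp [MSSMComponent.field, MSSMComponent.weight, weightChar, isospinWeight]
    ring
  have hHd : ∑ α, t (MSSMComponent.Hd α).field *
      weightChar z₁ z₂ y ξ (MSSMComponent.Hd α).weight = t .Hd * (1 / ξ ^ 3 * (y + 1 / y)) := by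
    simp [MSSMComponent.field, MSSMComponent.weight, weightChar, isospinWeight]
    ring
  simp only [hQ, hu, hd, hL, he, hHu, hHd]

theorem mssmPlethysticTerm_eq (t : MSSMField → ℂ) (ξ y z₁ z₂ : ℂ) (k : ℕ) :
    mssmPlethysticTerm t ξ y z₁ z₂ k =
      ∑ c : MSSMComponent, (t c.field * weightChar z₁ z₂ y ξ c.weight) ^ k / k := by
  rw [mssmPlethysticTerm, mssmCharacterSum_eq, Finset.sum_div]
  exact Finset.sum_congr rfl fun c _ => by rw [weightChar_pow, mul_pow]

/-- The exponent of the plethystic exponential is a sum of logarithms. -/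
theorem hasSum_mssmPlethysticTerm {t : MSSMField → ℂ} (ht : ∀ f, ‖t f‖ < 1) {z₁ z₂ y ξ : ℂ}
    (h₁ : ‖z₁‖ = 1) (h₂ : ‖z₂‖ = 1) (hy : ‖y‖ = 1) (hξ : ‖ξ‖ = 1) :
    HasSum (fun k : ℕ => mssmPlethysticTerm t ξ y z₁ z₂ (k + 1))
      (∑ c : MSSMComponent, -Complex.log (1 - t c.field * weightChar z₁ z₂ y ξ c.weight)) := by
  have h : HasSum (fun k : ℕ => mssmPlethysticTerm t ξ y z₁ z₂ k)
      (∑ c : MSSMComponent, -Complex.log (1 - t c.field * weightChar z₁ z₂ y ξ c.weight)) := by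
    simp only [mssmPlethysticTerm_eq]
    refine hasSum_sum fun c _ => Complex.hasSum_taylorSeries_neg_log ?_
    rw [norm_mul, norm_weightChar h₁ h₂ hy hξ, mul_one]
    exact ht _
  have h0 : mssmPlethysticTerm t ξ y z₁ z₂ 0 = 0 := by simp [mssmPlethysticTerm]
  rw [hasSum_nat_add_iff 1]
  simpa [h0] using h

theorem one_sub_weightChar_ne_zero {t : MSSMField → ℂ} (ht : ∀ f, ‖t f‖ < 1) {z₁ z₂ y ξ : ℂ}
    (h₁ : ‖z₁‖ = 1) (h₂ : ‖z₂‖ = 1) (hy : ‖y‖ = 1) (hξ : ‖ξ‖ = 1) (c : MSSMComponent) :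
    1 - t c.field * weightChar z₁ z₂ y ξ c.weight ≠ 0 := by
  intro h
  have h1 : ‖t c.field * weightChar z₁ z₂ y ξ c.weight‖ = 1 := by
    rw [← sub_eq_zero.mp h, norm_one]
  rw [norm_mul, norm_weightChar h₁ h₂ hy hξ, mul_one] at h1
  exact (ht c.field).ne h1

/-- The plethystic exponential is the generating function of the monomials in the scalar
components. -/
theorem exp_tsum_mssmPlethysticTerm {t : MSSMField → ℂ} (ht : ∀ f, ‖t f‖ < 1) {z₁ z₂ y ξ : ℂ}
    (h₁ : ‖z₁‖ = 1) (h₂ : ‖z₂‖ = 1) (hy : ‖y‖ = 1) (hξ : ‖ξ‖ = 1) :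
    Complex.exp (∑' k : ℕ, mssmPlethysticTerm t ξ y z₁ z₂ (k + 1)) =
      ∏ c : MSSMComponent, (1 - t c.field * weightChar z₁ z₂ y ξ c.weight)⁻¹ := by
  rw [(hasSum_mssmPlethysticTerm ht h₁ h₂ hy hξ).tsum_eq, Complex.exp_sum]
  refine Finset.prod_congr rfl fun c _ => ?_
  rw [Complex.exp_neg, Complex.exp_log (one_sub_weightChar_ne_zero ht h₁ h₂ hy hξ c)]

/-- The denominator of the integrand is, up to a monomial, the product over the scalar components
of one minus fugacity times character. -/
theorem mssmDenominator_eq (t : MSSMField → ℂ) {x y z₁ z₂ : ℂ} (hx : x ≠ 0) (hy : y ≠ 0)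
    (h₁ : z₁ ≠ 0) (h₂ : z₂ ≠ 0) : mssmDenominator t x y z₁ z₂ =
      x ^ 10 * y ^ 14 * z₁ ^ 12 * z₂ ^ 12 *
        ∏ c : MSSMComponent, (1 - t c.field * weightChar z₁ z₂ y (x ^ (1 / 6 : ℂ)) c.weight) := by
  set ξ := x ^ (1 / 6 : ℂ) with hξ
  have p2 : x ^ (1 / 2 : ℂ) = ξ ^ 3 := by
    rw [hξ, ← Complex.cpow_nat_mul]; norm_num
  have p3 : x ^ (1 / 3 : ℂ) = ξ ^ 2 := by
    rw [hξ, ← Complex.cpow_nat_mul]; norm_num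
  have p23 : x ^ (2 / 3 : ℂ) = ξ ^ 4 := by
    rw [hξ, ← Complex.cpow_nat_mul]; norm_num
  have p1 : x = ξ ^ 6 := by
    rw [hξ, ← Complex.cpow_nat_mul]; norm_num
  have hξ0 : ξ ≠ 0 := fun h => hx (by rw [p1, h]; simp)
  clear_value ξ
  have hQ : ∀ i, (y - ξ * t (.Q i) * z₁) * (ξ * y * t (.Q i) * z₁ - 1) *
      (ξ * y * t (.Q i) - z₂) * (y * z₂ - ξ * t (.Q i)) *
      (y * z₁ - ξ * t (.Q i) * z₂) * (ξ * y * t (.Q i) * z₂ - z₁) =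
      -(y ^ 3 * z₁ ^ 2 * z₂ ^ 2) * ∏ a, ∏ α, (1 - t (MSSMComponent.Q i a α).field *
        weightChar z₁ z₂ y ξ (MSSMComponent.Q i a α).weight) := by
    intro i
    have e1 : y - ξ * t (.Q i) * z₁ = y * (1 - t (.Q i) * (z₁ * y⁻¹ * ξ)) := by field_simp
    have e2 : y * z₁ - ξ * t (.Q i) * z₂ =
      y * z₁ * (1 - t (.Q i) * (z₁⁻¹ * z₂ * y⁻¹ * ξ)) := by field_simp
    have e3 : y * z₂ - ξ * t (.Q i) = y * z₂ * (1 - t (.Q i) * (z₂⁻¹ * y⁻¹ * ξ)) := by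
      field_simp
    have e4 : ξ * y * t (.Q i) * z₁ - 1 = -(1 - t (.Q i) * (z₁ * y * ξ)) := by ring
    have e5 : ξ * y * t (.Q i) - z₂ = -z₂ * (1 - t (.Q i) * (z₂⁻¹ * y * ξ)) := by
      field_simp; ring
    have e6 : ξ * y * t (.Q i) * z₂ - z₁ = -z₁ * (1 - t (.Q i) * (z₁⁻¹ * z₂ * y * ξ)) := by
      field_simp; ring
    rw [e1, e2, e3, e4, e5, e6]
    simp [Fin.prod_univ_three, MSSMComponent.field, MSSMComponent.weight, weightChar,
      colourWeight, isospinWeight]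
    ring
  have hu : ∀ i, (ξ ^ 4 * z₁ - t (.u i)) * (ξ ^ 4 * z₂ - t (.u i) * z₁) *
      (ξ ^ 4 - t (.u i) * z₂) = ξ ^ 12 * z₁ * z₂ * ∏ a, (1 - t (MSSMComponent.u i a).field *
        weightChar z₁ z₂ y ξ (MSSMComponent.u i a).weight) := by
    intro i
    have e1 : ξ ^ 4 * z₁ - t (.u i) = ξ ^ 4 * z₁ * (1 - t (.u i) * (z₁⁻¹ * (ξ ^ 4)⁻¹)) := by
      field_simp
    have e2 : ξ ^ 4 * z₂ - t (.u i) * z₁ =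
      ξ ^ 4 * z₂ * (1 - t (.u i) * (z₁ * z₂⁻¹ * (ξ ^ 4)⁻¹)) := by field_simp
    have e3 : ξ ^ 4 - t (.u i) * z₂ = ξ ^ 4 * (1 - t (.u i) * (z₂ * (ξ ^ 4)⁻¹)) := by
      field_simp
    rw [e1, e2, e3]
    simp [Fin.prod_univ_three, MSSMComponent.field, MSSMComponent.weight, weightChar,
      colourWeight]
    norm_cast
    ring
  have hd : ∀ i, (ξ ^ 2 * t (.d i) - z₁) * (ξ ^ 2 * t (.d i) * z₁ - z₂) *
      (ξ ^ 2 * t (.d i) * z₂ - 1) = -(z₁ * z₂) * ∏ a, (1 - t (MSSMComponent.d i a).field *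
        weightChar z₁ z₂ y ξ (MSSMComponent.d i a).weight) := by
    intro i
    have e1 : ξ ^ 2 * t (.d i) - z₁ = -z₁ * (1 - t (.d i) * (z₁⁻¹ * ξ ^ 2)) := by
      field_simp; ring
    have e2 : ξ ^ 2 * t (.d i) * z₁ - z₂ = -z₂ * (1 - t (.d i) * (z₁ * z₂⁻¹ * ξ ^ 2)) := by
      field_simp; ring
    have e3 : ξ ^ 2 * t (.d i) * z₂ - 1 = -(1 - t (.d i) * (z₂ * ξ ^ 2)) := by ring
    rw [e1, e2, e3]
    simp [Fin.prod_univ_three, MSSMComponent.field, MSSMComponent.weight, weightChar,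
      colourWeight]
    norm_cast
    ring
  have hL : ∀ i, (ξ ^ 3 * y - t (.L i)) * (y * t (.L i) - ξ ^ 3) =
      -(ξ ^ 6 * y) * ∏ α, (1 - t (MSSMComponent.L i α).field *
        weightChar z₁ z₂ y ξ (MSSMComponent.L i α).weight) := by
    intro i
    have e1 : ξ ^ 3 * y - t (.L i) = ξ ^ 3 * y * (1 - t (.L i) * (y⁻¹ * (ξ ^ 3)⁻¹)) := by
      field_simp
    have e2 : y * t (.L i) - ξ ^ 3 = -ξ ^ 3 * (1 - t (.L i) * (y * (ξ ^ 3)⁻¹)) := by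
      field_simp; ring
    rw [e1, e2]
    simp [MSSMComponent.field, MSSMComponent.weight, weightChar, isospinWeight]
    norm_cast
    ring
  have he : ∀ i, ξ ^ 6 * t (.e i) - 1 = -(1 - t (MSSMComponent.e i).field *
      weightChar z₁ z₂ y ξ (MSSMComponent.e i).weight) := by
    intro i
    simp [MSSMComponent.field, MSSMComponent.weight, weightChar]
    ring
  have hHu : (y - t .Hu * ξ ^ 3) * (t .Hu * ξ ^ 3 * y - 1) =
      -y * ∏ α, (1 - t (MSSMComponent.Hu α).field *
        weightChar z₁ z₂ y ξ (MSSMComponent.Hu α).weight) := by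
    have e1 : y - t .Hu * ξ ^ 3 = y * (1 - t .Hu * (y⁻¹ * ξ ^ 3)) := by field_simp
    rw [e1]
    simp [MSSMComponent.field, MSSMComponent.weight, weightChar, isospinWeight]
    norm_cast
    ring
  have hHd : (t .Hd * y - ξ ^ 3) * (ξ ^ 3 * y - t .Hd) =
      -(ξ ^ 6 * y) * ∏ α, (1 - t (MSSMComponent.Hd α).field *
        weightChar z₁ z₂ y ξ (MSSMComponent.Hd α).weight) := by
    have e1 : ξ ^ 3 * y - t .Hd = ξ ^ 3 * y * (1 - t .Hd * (y⁻¹ * (ξ ^ 3)⁻¹)) := by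
      field_simp
    have e2 : t .Hd * y - ξ ^ 3 = -ξ ^ 3 * (1 - t .Hd * (y * (ξ ^ 3)⁻¹)) := by
      field_simp; ring
    rw [e1, e2]
    simp [MSSMComponent.field, MSSMComponent.weight, weightChar, isospinWeight]
    norm_cast
    ring
  have hH : (y - t .Hu * ξ ^ 3) * (t .Hd * y - ξ ^ 3) * (ξ ^ 3 * y - t .Hd) *
      (t .Hu * ξ ^ 3 * y - 1) = (y - t .Hu * ξ ^ 3) * (t .Hu * ξ ^ 3 * y - 1) *
      ((t .Hd * y - ξ ^ 3) * (ξ ^ 3 * y - t .Hd)) := by ring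
  rw [prod_mssmComponent, mssmDenominator, p2, p3, p23, ← hξ, p1]
  simp only [hH, hHu, hHd, hQ, hu, hd, hL, he, Finset.prod_mul_distrib, Finset.prod_neg,
    Finset.prod_const, Finset.card_univ, Fintype.card_fin]
  ring

/-- The four factors of the Haar density, expanded. -/
theorem weylSum_weightChar_neg {z₁ z₂ y : ℂ} (h₁ : z₁ ≠ 0) (h₂ : z₂ ≠ 0) (ξ : ℂ) :
    weylSum (fun μ => weightChar z₁ z₂ y ξ (-μ)) =
      (1 - z₁ * z₂) * (1 - z₁ ^ 2 / z₂) * (1 - z₂ ^ 2 / z₁) * (1 - y ^ 2) := by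
  simp [weylSum, weightChar, rootWeight]
  norm_cast
  field_simp
  ring

/-- On the torus the integrand is the Haar density times the generating function of the monomials
in the scalar components. -/
theorem mssmIntegrand_eq_prod (t : MSSMField → ℂ) {x y z₁ z₂ : ℂ} (hx : x ≠ 0) (hy : y ≠ 0)
    (h₁ : z₁ ≠ 0) (h₂ : z₂ ≠ 0) : mssmIntegrand t x y z₁ z₂ = mssmHaarDensity x y z₁ z₂ *
      ∏ c : MSSMComponent, (1 - t c.field * weightChar z₁ z₂ y (x ^ (1 / 6 : ℂ)) c.weight)⁻¹ := by
  rw [mssmIntegrand, mssmDenominator_eq t hx hy h₁ h₂, Finset.prod_inv_distrib, mssmHaarDensity]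
  generalize ∏ c : MSSMComponent,
    (1 - t c.field * weightChar z₁ z₂ y (x ^ (1 / 6 : ℂ)) c.weight) = P
  rw [div_mul_eq_div_div, div_eq_mul_inv _ P]
  congr 1
  field_simp
  ring

theorem norm_cpow_one_sixth {x : ℂ} (hx : ‖x‖ = 1) : ‖x ^ (1 / 6 : ℂ)‖ = 1 := by
  have h6 : (x ^ (1 / 6 : ℂ)) ^ 6 = x := by
    rw [← Complex.cpow_nat_mul]; norm_num
  have h : ‖x ^ (1 / 6 : ℂ)‖ ^ 6 = 1 := by rw [← norm_pow, h6, hx]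
  exact (pow_eq_one_iff_of_nonneg (norm_nonneg _) (by norm_num)).mp h

theorem mssmDenominator_ne_zero {t : MSSMField → ℂ} (ht : ∀ f, ‖t f‖ < 1) {x y z₁ z₂ : ℂ}
    (hx : ‖x‖ = 1) (hy : ‖y‖ = 1) (h₁ : ‖z₁‖ = 1) (h₂ : ‖z₂‖ = 1) :
    mssmDenominator t x y z₁ z₂ ≠ 0 := by
  have ne : ∀ {z : ℂ}, ‖z‖ = 1 → z ≠ 0 := fun h => norm_ne_zero_iff.mp (by simp [h])
  rw [mssmDenominator_eq t (ne hx) (ne hy) (ne h₁) (ne h₂)]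
  have hP := Finset.prod_ne_zero_iff.mpr fun c (_ : c ∈ Finset.univ) =>
    one_sub_weightChar_ne_zero ht h₁ h₂ hy (norm_cpow_one_sixth hx) c
  exact mul_ne_zero (by simp [ne hx, ne hy, ne h₁, ne h₂]) hP

theorem mssmIntegrand_eq_exp {t : MSSMField → ℂ} (ht : ∀ f, ‖t f‖ < 1) {x y z₁ z₂ : ℂ}
    (hx : ‖x‖ = 1) (hy : ‖y‖ = 1) (h₁ : ‖z₁‖ = 1) (h₂ : ‖z₂‖ = 1) :
    mssmIntegrand t x y z₁ z₂ = mssmHaarDensity x y z₁ z₂ *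
      Complex.exp (∑' k : ℕ, mssmPlethysticTerm t (x ^ (1 / 6 : ℂ)) y z₁ z₂ (k + 1)) := by
  have ne : ∀ {z : ℂ}, ‖z‖ = 1 → z ≠ 0 := fun h => norm_ne_zero_iff.mp (by simp [h])
  rw [exp_tsum_mssmPlethysticTerm ht h₁ h₂ hy (norm_cpow_one_sixth hx),
    mssmIntegrand_eq_prod t (ne hx) (ne hy) (ne h₁) (ne h₂)]

end Integrand

/-! ### Termwise integration -/

section TermwiseIntegration

/-- The product of finitely many geometric series. -/
theorem hasSum_prod_pow {ι : Type*} [Fintype ι] (b : ι → ℂ) (hb : ∀ c, ‖b c‖ < 1) :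
    HasSum (fun a : ι → ℕ => ∏ c, b c ^ a c) (∏ c, (1 - b c)⁻¹) ∧
      Summable fun a : ι → ℕ => ‖∏ c, b c ^ a c‖ := by
  revert b
  refine Fintype.induction_empty_option (P := fun ι [Fintype ι] => ∀ b : ι → ℂ,
    (∀ c, ‖b c‖ < 1) → HasSum (fun a : ι → ℕ => ∏ c, b c ^ a c) (∏ c, (1 - b c)⁻¹) ∧
      Summable fun a : ι → ℕ => ‖∏ c, b c ^ a c‖) ?_ ?_ ?_ ι
  · intro α β _ e ih b hb
    let _ : Fintype α := Fintype.ofEquiv β e.symm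
    obtain ⟨h, h'⟩ := ih (b ∘ e) fun c => hb _
    let E : (β → ℕ) ≃ (α → ℕ) := (e.arrowCongr (Equiv.refl ℕ)).symm
    have he : (fun a : β → ℕ => ∏ c, b c ^ a c) = (fun a => ∏ c, (b ∘ e) c ^ a c) ∘ E :=
      funext fun a => (e.prod_comp fun c => b c ^ a c).symm
    have he' : ∏ c, (1 - b c)⁻¹ = ∏ c, (1 - (b ∘ e) c)⁻¹ :=
      (e.prod_comp fun c => (1 - b c)⁻¹).symm
    have hn : (fun a : β → ℕ => ‖∏ c, b c ^ a c‖) = (fun a => ‖∏ c, (b ∘ e) c ^ a c‖) ∘ E :=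
      funext fun a => congrArg norm (congrFun he a)
    rw [he, he', hn, E.hasSum_iff, E.summable_iff]
    exact ⟨h, h'⟩
  · intro b _
    simp only [Finset.univ_eq_empty, Finset.prod_empty, norm_one]
    exact ⟨hasSum_unique _, Summable.of_finite⟩
  · intro α _ ih b hb
    obtain ⟨h, h'⟩ := ih (fun c => b (some c)) fun c => hb _
    have g := hasSum_geometric_of_norm_lt_one (hb none)
    have g' : Summable fun k : ℕ => ‖b none ^ k‖ := by
      simpa using summable_geometric_of_lt_one (norm_nonneg _) (hb none)
    have hm := summable_mul_of_summable_norm (f := fun k : ℕ => b none ^ k)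
      (g := fun a : α → ℕ => ∏ c, b (some c) ^ a c) g' h'
    have key := g.mul h hm
    have key' := summable_mul_of_summable_norm (f := fun k : ℕ => ‖b none ^ k‖)
      (g := fun a : α → ℕ => ‖∏ c, b (some c) ^ a c‖) (by simpa using g') (by simpa using h')
    let E := Equiv.piOptionEquivProd (β := fun _ : Option α => ℕ)
    have he : (fun a : Option α → ℕ => ∏ c, b c ^ a c) =
        (fun q : ℕ × (α → ℕ) => b none ^ q.1 * ∏ c, b (some c) ^ q.2 c) ∘ E :=
      funext fun a => Fintype.prod_option _
    have hn : (fun a : Option α → ℕ => ‖∏ c, b c ^ a c‖) =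
        (fun q : ℕ × (α → ℕ) => ‖b none ^ q.1‖ * ‖∏ c, b (some c) ^ q.2 c‖) ∘ E :=
      funext fun a => (congrArg norm (congrFun he a)).trans (norm_mul _ _)
    rw [he, hn, Fintype.prod_option, E.hasSum_iff, E.summable_iff]
    exact ⟨key, key'⟩

/-- Term by term integration of a series of functions on the unit circle, dominated by a summable
series of constants. -/
theorem hasSum_circleIntegral_mul {κ : Type*} [Countable κ] {b : κ → ℂ}
    {A : κ → ℂ → ℂ} {g : ℂ → ℂ} {M : ℝ} (hb : Summable fun j => ‖b j‖)
    (hA : ∀ j, CircleIntegrable (A j) 0 1) (hM : ∀ j w, ‖w‖ = 1 → ‖A j w‖ ≤ M)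
    (hg : ∀ w, ‖w‖ = 1 → HasSum (fun j => b j * A j w) (g w)) :
    HasSum (fun j => b j * ∮ w in C(0, 1), A j w) (∮ w in C(0, 1), g w) := by
  have hn : ∀ θ : ℝ, ‖circleMap 0 1 θ‖ = 1 := fun θ => by simp
  have key := intervalIntegral.hasSum_integral_of_dominated_convergence
    (μ := MeasureTheory.volume) (a := 0) (b := 2 * Real.pi)
    (F := fun j θ => deriv (circleMap 0 1) θ • (b j * A j (circleMap 0 1 θ)))
    (f := fun θ => deriv (circleMap 0 1) θ • g (circleMap 0 1 θ))
    (fun j _ => ‖b j‖ * M) ?_ ?_ ?_ ?_ ?_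
  · simp only [← circleIntegral.integral_const_mul]
    exact key
  · intro j
    exact (hA j).const_fun_smul.out.aestronglyMeasurable_restrict_uIoc
  · intro j
    refine Filter.Eventually.of_forall fun θ _ => ?_
    simp only [deriv_circleMap, smul_eq_mul, norm_mul, hn, Complex.norm_I, one_mul]
    exact mul_le_mul_of_nonneg_left (hM j _ (hn θ)) (norm_nonneg _)
  · exact Filter.Eventually.of_forall fun θ _ => hb.mul_right M
  · exact intervalIntegrable_const
  · exact Filter.Eventually.of_forall fun θ _ => (hg _ (hn θ)).const_smul _

/-- The residue theorem for a monomial. -/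
theorem circleIntegral_zpow_sub_one (m : ℤ) :
    (∮ w in C(0, 1), w ^ (m - 1)) = if m = 0 then 2 * (Real.pi : ℂ) * Complex.I else 0 := by
  split_ifs with h
  · have := circleIntegral.integral_sub_center_inv (0 : ℂ) one_ne_zero
    simpa [h] using this
  · have := circleIntegral.integral_sub_zpow_of_ne (n := m - 1) (by omega) (0 : ℂ) 0 1
    simpa using this

theorem circleIntegrable_zpow (m : ℤ) : CircleIntegrable (fun w : ℂ => w ^ m) 0 1 := by
  have := (circleIntegrable_sub_zpow_iff (c := 0) (w := 0) (R := 1) (n := m)).mpr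
    (Or.inr (Or.inr (by simp)))
  simpa using this

/-- Integration over the unit circle extracts the terms with exponent `-1`. -/
theorem hasSum_circleIntegral_zpow {κ : Type*} [Countable κ] {b : κ → ℂ} (q : κ → ℤ)
    {g : ℂ → ℂ} (hb : Summable fun j => ‖b j‖)
    (hg : ∀ w, ‖w‖ = 1 → HasSum (fun j => b j * w ^ (q j - 1)) (g w)) :
    HasSum (fun j => b j * if q j = 0 then 2 * (Real.pi : ℂ) * Complex.I else 0)
      (∮ w in C(0, 1), g w) := by
  simp only [← circleIntegral_zpow_sub_one]
  exact hasSum_circleIntegral_mul hb (fun j => circleIntegrable_zpow _) (M := 1)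
    (fun j w hw => by simp [hw]) hg

end TermwiseIntegration

/-! ### The Hilbert series -/

section HilbertSeries

/-- The signs of the twelve elements of the Weyl group `S₃ × S₂`, in the order of the terms of
`weylSum`. -/
noncomputable def weylSign (s : Fin 6 × Fin 2) : ℂ := ![1, -1, -1, 1, 1, -1] s.1 * ![1, -1] s.2

/-- The weights `w ρ - ρ` for the twelve elements `w` of the Weyl group, in the order of the terms
of `weylSum`. -/
noncomputable def weylRoot (s : Fin 6 × Fin 2) : MSSMWeight :=
  rootWeight (![0, 1, 0, 2, 1, 2] s.1) (![0, 0, 1, 1, 2, 2] s.1) (![0, 1] s.2)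

theorem weylSum_eq_sum (m : MSSMWeight → ℂ) : weylSum m = ∑ s, weylSign s * m (weylRoot s) := by
  rw [Fintype.sum_prod_type]
  simp [Fin.sum_univ_six, weylSign, weylRoot, weylSum]
  ring

theorem weylSum_sum {ι : Type*} (S : Finset ι) (f : ι → ℂ) (m : ι → MSSMWeight → ℂ) :
    ∑ a ∈ S, f a * weylSum (m a) = weylSum fun μ => ∑ a ∈ S, f a * m a μ := by
  simp only [weylSum_eq_sum, Finset.mul_sum]
  rw [Finset.sum_comm]
  exact Finset.sum_congr rfl fun s _ => Finset.sum_congr rfl fun a _ => by ring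

/-- The coefficient of the character of weight `seriesWeight j` in the expansion of the integrand.
The index is a monomial in the scalar components together with an element of the Weyl group. -/
noncomputable def seriesCoeff (t : MSSMField → ℂ)
    (j : (MSSMComponent →₀ ℕ) × (Fin 6 × Fin 2)) : ℂ :=
  (∏ c, t c.field ^ j.1 c) * weylSign j.2

/-- The weight of the term of index `j` in the expansion of the integrand. -/
noncomputable def seriesWeight (j : (MSSMComponent →₀ ℕ) × (Fin 6 × Fin 2)) : MSSMWeight :=
  Finsupp.weight MSSMComponent.weight j.1 - weylRoot j.2

theorem summable_norm_seriesCoeff {t : MSSMField → ℂ} (ht : ∀ f, ‖t f‖ < 1) :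
    Summable fun j => ‖seriesCoeff t j‖ := by
  let e : (MSSMComponent →₀ ℕ) ≃ (MSSMComponent → ℕ) := Finsupp.equivFunOnFinite
  have h := e.summable_iff.mpr
    (hasSum_prod_pow (fun c : MSSMComponent => t c.field) fun c => ht _).2
  have h' : Summable fun s : Fin 6 × Fin 2 => ‖weylSign s‖ := Summable.of_finite
  have := summable_mul_of_summable_norm
    (f := fun a : MSSMComponent →₀ ℕ => ‖∏ c, t c.field ^ a c‖)
    (g := fun s => ‖weylSign s‖) (by simpa [Function.comp_def, e] using h) (by simpa using h')
  simpa only [seriesCoeff, norm_mul] using this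

/-- The expansion of the integrand in characters of the torus. -/
theorem hasSum_mssmIntegrand {t : MSSMField → ℂ} (ht : ∀ f, ‖t f‖ < 1) {x y z₁ z₂ : ℂ}
    (hx : ‖x‖ = 1) (hy : ‖y‖ = 1) (h₁ : ‖z₁‖ = 1) (h₂ : ‖z₂‖ = 1) :
    HasSum (fun j => seriesCoeff t j * (weightChar z₁ z₂ y (x ^ (1 / 6 : ℂ)) (seriesWeight j) /
      (x * y * z₁ * z₂))) (mssmIntegrand t x y z₁ z₂) := by
  have ne : ∀ {z : ℂ}, ‖z‖ = 1 → z ≠ 0 := fun h => norm_ne_zero_iff.mp (by simp [h])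
  have hξ := norm_cpow_one_sixth hx
  set ξ := x ^ (1 / 6 : ℂ) with hξdef
  have hb : ∀ c : MSSMComponent, ‖t c.field * weightChar z₁ z₂ y ξ c.weight‖ < 1 := by
    intro c
    rw [norm_mul, norm_weightChar h₁ h₂ hy hξ, mul_one]
    exact ht _
  obtain ⟨g, g'⟩ := hasSum_prod_pow _ hb
  let e : (MSSMComponent →₀ ℕ) ≃ (MSSMComponent → ℕ) := Finsupp.equivFunOnFinite
  have f := e.hasSum_iff.mpr g
  have f' := e.summable_iff.mpr g'
  have k := hasSum_fintype fun s => weylSign s * weightChar z₁ z₂ y ξ (-weylRoot s) /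
    (x * y * z₁ * z₂)
  have hm := summable_mul_of_summable_norm f' (Summable.of_finite (f := fun s => ‖weylSign s *
    weightChar z₁ z₂ y ξ (-weylRoot s) / (x * y * z₁ * z₂)‖))
  have key := f.mul k hm
  have hsum : ∑ s, weylSign s * weightChar z₁ z₂ y ξ (-weylRoot s) / (x * y * z₁ * z₂) =
      mssmHaarDensity x y z₁ z₂ := by
    rw [← Finset.sum_div, ← weylSum_eq_sum fun μ => weightChar z₁ z₂ y ξ (-μ),
      weylSum_weightChar_neg (ne h₁) (ne h₂), mssmHaarDensity]
  rw [hsum, mul_comm _ (mssmHaarDensity x y z₁ z₂), hξdef,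
    ← mssmIntegrand_eq_prod t (ne hx) (ne hy) (ne h₁) (ne h₂), ← hξdef] at key
  refine key.congr_fun fun j => ?_
  simp only [Function.comp_apply, e, Finsupp.equivFunOnFinite_apply, mul_pow,
    Finset.prod_mul_distrib, prod_weightChar (ne h₁) (ne h₂) (ne hy) (ne hξ)]
  rw [seriesWeight, sub_eq_add_neg, weightChar_add (ne h₁) (ne h₂) (ne hy) (ne hξ), seriesCoeff]
  ring

theorem dvd_weight (c : MSSMComponent) :
    3 ∣ c.weight.1 - c.weight.2.1 - c.weight.2.2.2 ∧ 2 ∣ c.weight.2.2.1 - c.weight.2.2.2 := by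
  rcases c with ⟨i, a, α⟩ | ⟨i, a⟩ | ⟨i, a⟩ | ⟨i, α⟩ | i | α | α <;>
    decide +revert

/-- The weights that occur are characters of the quotient of the gauge group by a central subgroup
of order six which acts trivially on the fields. Hence, where the exponents of `z₁`, `z₂` and `y`
vanish, the exponent of `ξ = x ^ (1 / 6)` is a multiple of six, and the branch of the root does not
matter. -/
theorem dvd_seriesWeight (j : (MSSMComponent →₀ ℕ) × (Fin 6 × Fin 2)) :
    3 ∣ (seriesWeight j).1 - (seriesWeight j).2.1 - (seriesWeight j).2.2.2 ∧
      2 ∣ (seriesWeight j).2.2.1 - (seriesWeight j).2.2.2 := by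
  obtain ⟨a, s⟩ := j
  have ha : 3 ∣ (Finsupp.weight MSSMComponent.weight a).1 -
      (Finsupp.weight MSSMComponent.weight a).2.1 -
      (Finsupp.weight MSSMComponent.weight a).2.2.2 ∧
      2 ∣ (Finsupp.weight MSSMComponent.weight a).2.2.1 -
      (Finsupp.weight MSSMComponent.weight a).2.2.2 := by
    induction a using Finsupp.induction_linear with
    | zero => simp
    | add a b ha hb =>
      simp only [map_add, Prod.fst_add, Prod.snd_add]
      omega
    | single c k =>
      obtain ⟨⟨u, hu⟩, v, hv⟩ := dvd_weight c
      simp only [Finsupp.weight_single, Prod.smul_fst, Prod.smul_snd]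
      simp only [nsmul_eq_mul]
      exact ⟨⟨k * u, by linear_combination (k : ℤ) * hu⟩,
        ⟨k * v, by linear_combination (k : ℤ) * hv⟩⟩
  simp only [seriesWeight, weylRoot, rootWeight, Prod.fst_sub, Prod.snd_sub]
  omega

theorem norm_mssmIntegrand_le {t : MSSMField → ℂ} (ht : ∀ f, ‖t f‖ < 1) {x y z₁ z₂ : ℂ}
    (hx : ‖x‖ = 1) (hy : ‖y‖ = 1) (h₁ : ‖z₁‖ = 1) (h₂ : ‖z₂‖ = 1) :
    ‖mssmIntegrand t x y z₁ z₂‖ ≤ ∑' j, ‖seriesCoeff t j‖ := by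
  rw [← (hasSum_mssmIntegrand ht hx hy h₁ h₂).tsum_eq]
  refine tsum_of_norm_bounded (summable_norm_seriesCoeff ht).hasSum fun j => ?_
  rw [norm_mul, norm_div, norm_weightChar h₁ h₂ hy (norm_cpow_one_sixth hx)]
  simp [hx, hy, h₁, h₂]

theorem torusIntegrable_mssmIntegrand {t : MSSMField → ℂ} (ht : ∀ f, ‖t f‖ < 1) :
    TorusIntegrable (fun v : Fin 4 → ℂ => mssmIntegrand t (v 0) (v 1) (v 2) (v 3)) 0 1 := by
  rw [TorusIntegrable]
  have hm : Measurable fun θ : Fin 4 → ℝ => mssmIntegrand t (torusMap 0 1 θ 0)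
      (torusMap 0 1 θ 1) (torusMap 0 1 θ 2) (torusMap 0 1 θ 3) := by
    unfold mssmIntegrand mssmDenominator torusMap
    fun_prop
  refine MeasureTheory.Measure.integrableOn_of_bounded (M := ∑' j, ‖seriesCoeff t j‖)
    isCompact_Icc.measure_lt_top.ne hm.aestronglyMeasurable
    (Filter.Eventually.of_forall fun θ => ?_)
  have hn : ∀ i, ‖torusMap (0 : Fin 4 → ℂ) 1 θ i‖ = 1 := fun i => by simp [torusMap]
  exact norm_mssmIntegrand_le ht (hn 0) (hn 1) (hn 2) (hn 3)

/-- The plethystic integral is the sum of the coefficients of the terms of weight zero. The four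
integrals are carried out from the inside to the outside; the one over `x` comes last, when the
fractional powers have disappeared. -/
theorem hasSum_mssmPlethysticIntegral {t : MSSMField → ℂ} (ht : ∀ f, ‖t f‖ < 1) :
    HasSum (fun j => seriesCoeff t j * if seriesWeight j = 0 then 1 else 0)
      (mssmPlethysticIntegral t) := by
  have hs := summable_norm_seriesCoeff ht
  have ne : ∀ {z : ℂ}, ‖z‖ = 1 → z ≠ 0 := fun h => norm_ne_zero_iff.mp (by simp [h])
  set p : ℂ := 2 * (Real.pi : ℂ) * Complex.I with hp
  have hp0 : p ≠ 0 := by simp [hp, Real.pi_ne_zero]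
  set q : ℤ → ℂ := fun m => if m = 0 then p else 0 with hq
  have hqb : ∀ m, ‖q m‖ ≤ ‖p‖ := by
    intro m
    simp only [hq]
    split_ifs <;> simp
  have summ : ∀ {u : (MSSMComponent →₀ ℕ) × (Fin 6 × Fin 2) → ℂ} {M : ℝ}, (∀ j, ‖u j‖ ≤ M) →
      Summable fun j => ‖seriesCoeff t j * u j‖ := by
    intro u M hu
    refine (hs.mul_right M).of_nonneg_of_le (fun _ => norm_nonneg _) fun j => ?_
    rw [norm_mul]
    exact mul_le_mul_of_nonneg_left (hu j) (norm_nonneg _)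
  have hX : ∀ (x : ℂ) (k : ℤ), ‖x‖ = 1 → ‖(x ^ (1 / 6 : ℂ)) ^ k / x‖ = 1 := by
    intro x k hx
    rw [norm_div, norm_zpow, norm_cpow_one_sixth hx, hx, one_zpow, div_one]
  have I₂ : ∀ x y z₁ : ℂ, ‖x‖ = 1 → ‖y‖ = 1 → ‖z₁‖ = 1 →
      HasSum (fun j => seriesCoeff t j * (z₁ ^ ((seriesWeight j).1 - 1) *
        y ^ ((seriesWeight j).2.2.1 - 1) * ((x ^ (1 / 6 : ℂ)) ^ (seriesWeight j).2.2.2 / x)) *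
        q (seriesWeight j).2.1) (∮ z₂ in C(0, 1), mssmIntegrand t x y z₁ z₂) := by
    intro x y z₁ hx hy h₁
    refine hasSum_circleIntegral_zpow (fun j => (seriesWeight j).2.1) (summ (M := 1) fun j => ?_)
      fun z₂ h₂ => ?_
    · rw [norm_mul, norm_mul, hX x _ hx]
      simp [hy, h₁]
    · convert hasSum_mssmIntegrand ht hx hy h₁ h₂ using 2 with j
      have := ne hx; have := ne hy; have := ne h₁; have := ne h₂
      rw [weightChar, zpow_sub_one₀ (ne h₁), zpow_sub_one₀ (ne h₂), zpow_sub_one₀ (ne hy)]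
      field_simp
  have I₁ : ∀ x y : ℂ, ‖x‖ = 1 → ‖y‖ = 1 →
      HasSum (fun j => seriesCoeff t j * (q (seriesWeight j).2.1 *
        y ^ ((seriesWeight j).2.2.1 - 1) * ((x ^ (1 / 6 : ℂ)) ^ (seriesWeight j).2.2.2 / x)) *
        q (seriesWeight j).1)
        (∮ z₁ in C(0, 1), ∮ z₂ in C(0, 1), mssmIntegrand t x y z₁ z₂) := by
    intro x y hx hy
    refine hasSum_circleIntegral_zpow (fun j => (seriesWeight j).1) (summ (M := ‖p‖) fun j => ?_)
      fun z₁ h₁ => ?_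
    · rw [norm_mul, norm_mul, hX x _ hx]
      simpa [hy] using hqb _
    · convert I₂ x y z₁ hx hy h₁ using 2 with j
      ring
  have Iy : ∀ x : ℂ, ‖x‖ = 1 →
      HasSum (fun j => seriesCoeff t j * (q (seriesWeight j).2.1 * q (seriesWeight j).1 *
        ((x ^ (1 / 6 : ℂ)) ^ (seriesWeight j).2.2.2 / x)) * q (seriesWeight j).2.2.1)
        (∮ y in C(0, 1), ∮ z₁ in C(0, 1), ∮ z₂ in C(0, 1), mssmIntegrand t x y z₁ z₂) := by
    intro x hx
    refine hasSum_circleIntegral_zpow (fun j => (seriesWeight j).2.2.1)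
      (summ (M := ‖p‖ * ‖p‖) fun j => ?_) fun y hy => ?_
    · rw [norm_mul, norm_mul, hX x _ hx, mul_one]
      exact mul_le_mul (hqb _) (hqb _) (norm_nonneg _) (norm_nonneg _)
    · convert I₁ x y hx hy using 2 with j
      ring
  have Ix : HasSum (fun j => seriesCoeff t j * (q (seriesWeight j).2.1 * q (seriesWeight j).1 *
        q (seriesWeight j).2.2.1) * q ((seriesWeight j).2.2.2 / 6))
        (∮ x in C(0, 1), ∮ y in C(0, 1), ∮ z₁ in C(0, 1), ∮ z₂ in C(0, 1),
          mssmIntegrand t x y z₁ z₂) := by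
    refine hasSum_circleIntegral_zpow (fun j => (seriesWeight j).2.2.2 / 6)
      (summ (M := ‖p‖ * ‖p‖ * ‖p‖) fun j => ?_) fun x hx => ?_
    · rw [norm_mul, norm_mul]
      gcongr <;> exact hqb _
    · convert Iy x hx using 2 with j
      by_cases h : (seriesWeight j).1 = 0 ∧ (seriesWeight j).2.1 = 0 ∧
        (seriesWeight j).2.2.1 = 0
      · obtain ⟨d3, d2⟩ := dvd_seriesWeight j
        -- the exponent of `ξ` is a multiple of six, so the power of `ξ` is an integral power of `x`
        have h6 : (seriesWeight j).2.2.2 = 6 * ((seriesWeight j).2.2.2 / 6) := by omega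
        have hpow : (x ^ (1 / 6 : ℂ)) ^ (seriesWeight j).2.2.2 =
            x ^ ((seriesWeight j).2.2.2 / 6) := by
          have hx6 : (x ^ (1 / 6 : ℂ)) ^ (6 : ℤ) = x := by
            rw [← Complex.cpow_mul_int]; norm_num
          conv_lhs => rw [h6, zpow_mul, hx6]
        rw [hpow, zpow_sub_one₀ (ne hx)]
        ring
      · have h0 : q (seriesWeight j).1 * q (seriesWeight j).2.1 * q (seriesWeight j).2.2.1 = 0 := by
          simp only [hq, mul_eq_zero, ite_eq_right_iff, hp0]
          tauto
        linear_combination (seriesCoeff t j * x ^ ((seriesWeight j).2.2.2 / 6 - 1) -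
          seriesCoeff t j * ((x ^ (1 / 6 : ℂ)) ^ (seriesWeight j).2.2.2 / x)) * h0
  have key := Ix.mul_left (1 / p ^ 4)
  rw [mssmPlethysticIntegral, ← hp]
  refine key.congr_fun fun j => ?_
  by_cases h : seriesWeight j = 0
  · simp only [h, hq, Prod.fst_zero, Prod.snd_zero, Int.zero_ediv, if_true]
    field_simp
  · have h0 : q (seriesWeight j).1 * q (seriesWeight j).2.1 * q (seriesWeight j).2.2.1 *
        q ((seriesWeight j).2.2.2 / 6) = 0 := by
      obtain ⟨d3, d2⟩ := dvd_seriesWeight j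
      simp only [hq, mul_eq_zero, ite_eq_right_iff, hp0]
      by_contra hcon
      refine h (Prod.ext ?_ (Prod.ext ?_ (Prod.ext ?_ ?_)))
      all_goals simp only [Prod.fst_zero, Prod.snd_zero]; omega
    rw [if_neg h]
    linear_combination -(1 / p ^ 4 * seriesCoeff t j) * h0

theorem prod_fugacity_pow (t : MSSMField → ℂ) (a : MSSMComponent →₀ ℕ) :
    ∏ c, t c.field ^ a c = (Finsupp.weight MSSMComponent.degree a).prod fun f k => t f ^ k := by
  rw [← Finsupp.prod_fintype a (fun c k => t c.field ^ k) fun _ => pow_zero _]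
  induction a using Finsupp.induction_linear with
  | zero => simp
  | add a b ha hb =>
    rw [map_add, Finsupp.prod_add_index' (fun _ => pow_zero _) fun _ _ _ => pow_add _ _ _,
      Finsupp.prod_add_index' (fun _ => pow_zero _) fun _ _ _ => pow_add _ _ _, ha, hb]
  | single c k =>
    simp [Finsupp.weight_single, MSSMComponent.degree, Finsupp.smul_single]

/-- The plethystic integral is the generating function of the multiplicities of the trivial
representation. -/
theorem hasSum_finrank_lieInvariants {t : MSSMField → ℂ} (ht : ∀ f, ‖t f‖ < 1) :
    HasSum (fun n : MSSMField →₀ ℕ => (Module.finrank ℂ (lieInvariants n) : ℂ) *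
      n.prod fun f k => t f ^ k) (mssmPlethysticIntegral t) := by
  have h := hasSum_mssmPlethysticIntegral ht
  have h1 := h.prod_fiberwise (g := fun a => (∏ c, t c.field ^ a c) *
    weylSum fun μ => if Finsupp.weight MSSMComponent.weight a = μ then 1 else 0) (fun a => by
      convert hasSum_fintype (β := Fin 6 × Fin 2) _ using 1
      rw [weylSum_eq_sum, Finset.mul_sum]
      simp only [seriesCoeff, seriesWeight, sub_eq_zero, mul_assoc])
  -- collect the monomials of the same multidegree
  have h2 := (Equiv.sigmaFiberEquiv
    (Finsupp.weight (R := ℕ) MSSMComponent.degree)).hasSum_iff.mpr h1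
  refine h2.sigma fun n => ?_
  have : Fintype (multidegreeExponents n) := Fintype.ofFinite _
  have hfin := hasSum_fintype fun a : multidegreeExponents n => (∏ c, t c.field ^ a.1 c) *
    weylSum fun μ => if Finsupp.weight MSSMComponent.weight a.1 = μ then 1 else 0
  have hp : ∀ a : multidegreeExponents n, ∏ c, t c.field ^ a.1 c = n.prod fun f k => t f ^ k := by
    intro a
    rw [prod_fugacity_pow, a.2]
  have hval : (Module.finrank ℂ (lieInvariants n) : ℂ) * (n.prod fun f k => t f ^ k) =
      ∑ a : multidegreeExponents n, (∏ c, t c.field ^ a.1 c) *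
        weylSum fun μ => if Finsupp.weight MSSMComponent.weight a.1 = μ then 1 else 0 := by
    simp only [hp]
    rw [← Finset.mul_sum, mul_comm, finrank_lieInvariants]
    have := weylSum_sum Finset.univ (fun _ => 1) fun (a : multidegreeExponents n) μ =>
      if Finsupp.weight MSSMComponent.weight a.1 = μ then 1 else 0
    simp only [one_mul] at this
    rw [this]
    congr 2
    funext μ
    rw [trace_weightProj, Finset.sum_boole, Nat.card_eq_fintype_card, Fintype.card_subtype]
  rw [hval]
  exact hfin

end HilbertSeries

theorem mainTheorem2 {J : Type*} (r : J → MvPolynomial MSSMComponent ℂ)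
    (δ : J → MSSMField →₀ ℕ) (hr : IsMSSMGeneratingSystem r δ)
    (t : MSSMField → ℂ) (ht : ∀ f, ‖t f‖ < 1) :
    -- the integrand has no pole on the contour, and it is the Haar density times the
    -- plethystic exponential of the characters
    (∀ x y z₁ z₂ : ℂ, ‖x‖ = 1 → ‖y‖ = 1 → ‖z₁‖ = 1 → ‖z₂‖ = 1 →
      mssmDenominator t x y z₁ z₂ ≠ 0 ∧
      Summable (fun k : ℕ => mssmPlethysticTerm t (x ^ (1 / 6 : ℂ)) y z₁ z₂ (k + 1)) ∧
      mssmIntegrand t x y z₁ z₂ = mssmHaarDensity x y z₁ z₂ *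
        Complex.exp (∑' k : ℕ, mssmPlethysticTerm t (x ^ (1 / 6 : ℂ)) y z₁ z₂ (k + 1))) ∧
    -- the integrand is integrable over the product of the four unit circles
    TorusIntegrable (fun v : Fin 4 → ℂ => mssmIntegrand t (v 0) (v 1) (v 2) (v 3)) 0 1 ∧
    -- the graded pieces of the coordinate ring of the moduli space are finite-dimensional
    (∀ n : MSSMField →₀ ℕ,
      Module.Finite ℂ (moduliPiece (0 : MvPolynomial MSSMComponent ℂ) r δ n)) ∧
    -- the Hilbert series converges to the plethystic integral
    HasSum (fun n : MSSMField →₀ ℕ =>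
        (Module.finrank ℂ (moduliPiece (0 : MvPolynomial MSSMComponent ℂ) r δ n) : ℂ) *
          n.prod (fun f k => t f ^ k))
      (mssmPlethysticIntegral t) := by
  refine ⟨fun x y z₁ z₂ hx hy h₁ h₂ => ⟨mssmDenominator_ne_zero ht hx hy h₁ h₂,
    (hasSum_mssmPlethysticTerm ht h₁ h₂ hy (norm_cpow_one_sixth hx)).summable,
    mssmIntegrand_eq_exp ht hx hy h₁ h₂⟩, torusIntegrable_mssmIntegrand ht,
    fun n => (finrank_moduliPiece hr n).1, ?_⟩
  simp only [(finrank_moduliPiece hr _).2]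
  exact hasSum_finrank_lieInvariants ht
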